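/- All graphs are finite, simple and undirected. A graph $G=(V,E)$ is $2$-degenerate if its vertices can be ordered as $v_1,\dots,v_n$ such that each $v_i$ has at most two neighbours among $v_{i+1},\dots,v_n$. A set $S\subseteq V$ is a connected dominating set (CDS) if every vertex lies in $S$ or has a neighbour in $S$, and $G[S]$ is connected (in particular $S\neq\emptyset$); it is a minimal CDS if no proper subset of it is a CDS. (1) There are an algorithm (a program for a random access machine that stores only numbers of size polynomial in $n$), a constant $C$ and a polynomial $p$ such that, given the adjacency matrix of any $2$-degenerate graph $G$ of order $n$, the algorithm outputs every minimal CDS of $G$ exactly once and nothing else, halts after at most $C\cdot 1.9767^n$ steps, and uses at most $p(n)$ memory cells in each of its (finitely many) arrays, the output not being counted. (2) The number $1.9767$ is attained by branching with the following measure for $\alpha=\delta=0.106$. An instance $\mathcal I=(V';O_d,O_n;S)$ is a partition of $V$ into undecided vertices $V'$, solution vertices $S$, and discarded vertices $O_d$ (with a neighbour in $S$) and $O_n$ (without one); its measure is $\mu(\mathcal I)=|V'|+\alpha|O_n|+\delta c$, where $c$ is the number of connected components of $G[S]$. A set $M$ is compatible with $\mathcal I$ if $S\subseteq M\subseteq S\cup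 V'$. The branching number of a vector $(r_1,\dots,r_k)$ of positive reals is the positive root $x$ of $\sum_i x^{-r_i}=1$. The branching vectors $$(1,1+\alpha),\ (1,1+\delta),\ (1,2,2+\alpha),\ (1,2,2+\delta),\ (2-\delta,3-\delta-\alpha,2-\delta,3-\delta),\ (1+\alpha-\delta,2-\delta),$$ $$(1,4-2\alpha,2),\ (1,2,3,4-\alpha),\ (1,2,3,4-\alpha,5-\delta-\alpha),\ (1,2,3,5-2\alpha,5-2\alpha)$$ all have a branching number smaller than $1.9767$. For every $2$-degenerate graph $G$, every instance with $|S|=1$ has a finite search tree in which every child of a node decides at least one further vertex and keeps all earlier decisions, every minimal CDS compatible with an inner node is compatible with one of its children, and every inner node either has a single child, whose measure is not larger, or has children $\mathcal I_1,\dots,\mathcal I_k$ with $\mu(\mathcal I_i)\le\mu(\mathcal I)-r_i$ for one of the vectors $(r_1,\dots,r_k)$ above; at each leaf all vertices are decided or no minimal CDS is compatible with it. (3) Consequently, there is a constant $C'$ such that every $2$-degenerate graph of order $n$ has at most $C'\cdot 1.9767^n$ minimal CDS. -/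

import Mathlib

universe u

namespace CDSEnum

/-! ## Graphs -/

/-- `G` is `d`-degenerate: there is an elimination ordering `e 0, e 1, …` of the vertices such
that every `e i` has at most `d` neighbours among the vertices that are not earlier than it. -/
def IsDegenerate {V : Type u} [Fintype V] (G : SimpleGraph V) (d : ℕ) : Prop :=
  ∃ e : Fin (Fintype.card V) ≃ V,
    ∀ i, {j | i ≤ j ∧ G.Adj (e i) (e j)}.ncard ≤ d

/-- `S` is a connected dominating set of `G`: every vertex lies in `S` or has a neighbour in `S`,
and the induced graph `G[S]` is connected (in particular, `S` is not empty). -/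
def IsCDS {V : Type u} (G : SimpleGraph V) (S : Finset V) : Prop :=
  (∀ v, v ∈ S ∨ ∃ w ∈ S, G.Adj v w) ∧ (G.induce (S : Set V)).Connected

/-- `S` is an inclusion-wise minimal connected dominating set of `G`. -/
def IsMinimalCDS {V : Type u} (G : SimpleGraph V) (S : Finset V) : Prop :=
  Minimal (IsCDS G) S

/-! ## The machine model

A random access machine, programmed in a structured language.  A program uses finitely many
registers and finitely many arrays, all holding natural numbers, and a write-only output tape. -/

/-- Expressions: constants, registers, array reads, arithmetic and comparisons. -/
inductive Expr : Type
  | num (k : ℕ)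
  | var (x : ℕ)
  | get (a : ℕ) (i : Expr)
  | add (e f : Expr)
  | sub (e f : Expr)
  | mul (e f : Expr)
  | lt (e f : Expr)
  | eq (e f : Expr)

/-- Programs: assignment to a register, assignment to an array cell, output of a number,
sequential composition, conditional, and while loop (any non-zero value counts as true). -/
inductive Prog : Type
  | skip
  | assign (x : ℕ) (e : Expr)
  | put (a : ℕ) (i e : Expr)
  | write (e : Expr)
  | seq (p q : Prog)
  | ite (e : Expr) (p q : Prog)
  | loop (e : Expr) (p : Prog)

/-- Contents of the registers, of the arrays and of the output tape. -/
structure Store : Type where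
  vars : ℕ → ℕ
  arr : ℕ → ℕ → ℕ
  out : List ℕ

/-- The value of an expression; subtraction is truncated, comparisons yield `0` or `1`. -/
def Expr.eval (σ : Store) : Expr → ℕ
  | .num k => k
  | .var x => σ.vars x
  | .get a i => σ.arr a (i.eval σ)
  | .add e f => e.eval σ + f.eval σ
  | .sub e f => e.eval σ - f.eval σ
  | .mul e f => e.eval σ * f.eval σ
  | .lt e f => if e.eval σ < f.eval σ then 1 else 0
  | .eq e f => if e.eval σ = f.eval σ then 1 else 0

/-- The number of operations needed to evaluate an expression. -/
def Expr.cost : Expr → ℕ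
  | .num _ => 1
  | .var _ => 1
  | .get _ i => i.cost + 1
  | .add e f => e.cost + f.cost + 1
  | .sub e f => e.cost + f.cost + 1
  | .mul e f => e.cost + f.cost + 1
  | .lt e f => e.cost + f.cost + 1
  | .eq e f => e.cost + f.cost + 1

def Store.setVar (σ : Store) (x v : ℕ) : Store :=
  { σ with vars := Function.update σ.vars x v }

def Store.setArr (σ : Store) (a i v : ℕ) : Store :=
  { σ with arr := Function.update σ.arr a (Function.update (σ.arr a) i v) }

def Store.emit (σ : Store) (v : ℕ) : Store :=
  { σ with out := σ.out ++ [v] }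

/-- `Exec s p σ σ' t`: program `p`, started on `σ`, halts with `σ'` after exactly `t` steps, and it
does so in a memory of size `s`: every number that is stored is smaller than `s`, and only cells
with an index smaller than `s` are written.  As a program has finitely many registers and arrays,
it then occupies `O(s log s)` bits, in words of `O(log s)` bits; the output tape is not counted.
A run that would exceed this memory has no derivation. -/
inductive Exec (s : ℕ) : Prog → Store → Store → ℕ → Prop
  | skip (σ : Store) : Exec s .skip σ σ 1
  | assign (x : ℕ) (e : Expr) (σ : Store) (hv : e.eval σ < s) :
      Exec s (.assign x e) σ (σ.setVar x (e.eval σ)) (e.cost + 1)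
  | put (a : ℕ) (i e : Expr) (σ : Store) (hi : i.eval σ < s) (hv : e.eval σ < s) :
      Exec s (.put a i e) σ (σ.setArr a (i.eval σ) (e.eval σ)) (i.cost + e.cost + 1)
  | write (e : Expr) (σ : Store) (hv : e.eval σ < s) :
      Exec s (.write e) σ (σ.emit (e.eval σ)) (e.cost + 1)
  | seq {p q : Prog} {σ σ₁ σ₂ : Store} {t₁ t₂ : ℕ} (hp : Exec s p σ σ₁ t₁)
      (hq : Exec s q σ₁ σ₂ t₂) : Exec s (.seq p q) σ σ₂ (t₁ + t₂)
  | ite_true {e : Expr} {p q : Prog} {σ σ₁ : Store} {t : ℕ} (he : e.eval σ ≠ 0)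
      (hp : Exec s p σ σ₁ t) : Exec s (.ite e p q) σ σ₁ (e.cost + 1 + t)
  | ite_false {e : Expr} {p q : Prog} {σ σ₁ : Store} {t : ℕ} (he : e.eval σ = 0)
      (hq : Exec s q σ σ₁ t) : Exec s (.ite e p q) σ σ₁ (e.cost + 1 + t)
  | loop_done {e : Expr} {p : Prog} {σ : Store} (he : e.eval σ = 0) :
      Exec s (.loop e p) σ σ (e.cost + 1)
  | loop_step {e : Expr} {p : Prog} {σ σ₁ σ₂ : Store} {t₁ t₂ : ℕ} (he : e.eval σ ≠ 0)
      (hp : Exec s p σ σ₁ t₁) (hl : Exec s (.loop e p) σ₁ σ₂ t₂) :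
      Exec s (.loop e p) σ σ₂ (e.cost + 1 + t₁ + t₂)

open Classical in
/-- The input: register `0` holds the order `n`, array `0` holds the adjacency matrix row by row;
everything else is zero, and the output tape is empty. -/
noncomputable def inputStore {n : ℕ} (G : SimpleGraph (Fin n)) : Store where
  vars x := if x = 0 then n else 0
  arr a k := if a = 0 ∧ ∃ i j : Fin n, k = (i : ℕ) * n + j ∧ G.Adj i j then 1 else 0
  out := []

/-- A vertex set on the output tape: its characteristic vector, followed by the separator `2`. -/
def encodeSet {n : ℕ} (S : Finset (Fin n)) : List ℕ :=
  (List.ofFn fun i : Fin n => if i ∈ S then 1 else 0) ++ [2]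

/-- On input `G`, the program `P` halts within `T` steps in a memory of size `s`, and it outputs
every minimal connected dominating set of `G` exactly once, in some order, and nothing else. -/
def EnumeratesWithin (P : Prog) {n : ℕ} (G : SimpleGraph (Fin n)) (s : ℕ) (T : ℝ) : Prop :=
  ∃ (σ : Store) (t : ℕ) (L : List (Finset (Fin n))),
    Exec s P (inputStore G) σ t ∧ (t : ℝ) ≤ T ∧
    L.Nodup ∧ (∀ S, S ∈ L ↔ IsMinimalCDS G S) ∧ σ.out = L.flatMap encodeSet

/-! ## Branching with a measure -/

/-- An instance `(V'; O_d, O_n; S)` of the branching: `free` is the set `V'` of undecided vertices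
and `sol` the set `S` of vertices put into the solution.  All other vertices are discarded; which of
them lie in `O_d` and which in `O_n` is determined by `S`. -/
structure BranchInstance (V : Type u) where
  free : Finset V
  sol : Finset V
  disj : Disjoint free sol

namespace BranchInstance

variable {V : Type u} [Fintype V] [DecidableEq V]

open Classical in
/-- `O_n`: the discarded vertices without a neighbour in `S`. -/
noncomputable def discardedUndominated (G : SimpleGraph V) (I : BranchInstance V) : Finset V :=
  Finset.univ.filter fun v => v ∉ I.free ∧ v ∉ I.sol ∧ ∀ w ∈ I.sol, ¬ G.Adj v w

/-- The measure `|V'| + α |O_n| + δ c`, where `c` is the number of components of `G[S]`. -/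
noncomputable def measure (G : SimpleGraph V) (α δ : ℝ) (I : BranchInstance V) : ℝ :=
  (I.free.card : ℝ) + α * ((I.discardedUndominated G).card : ℝ)
    + δ * (Nat.card (G.induce (I.sol : Set V)).ConnectedComponent : ℝ)

/-- `M` agrees with the decisions made in `I`. -/
def Compatible (I : BranchInstance V) (M : Finset V) : Prop :=
  I.sol ⊆ M ∧ M ⊆ I.sol ∪ I.free

/-- `J` arises from `I` by deciding at least one more vertex. -/
def Refines (J I : BranchInstance V) : Prop :=
  J.free ⊂ I.free ∧ I.sol ⊆ J.sol ∧ J.sol ⊆ I.sol ∪ I.free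

/-- The instances `Js` form a complete case distinction for the instance `I`. -/
def Covers (G : SimpleGraph V) (Js : List (BranchInstance V)) (I : BranchInstance V) : Prop :=
  (∀ J ∈ Js, J.Refines I) ∧
    ∀ M, IsMinimalCDS G M → I.Compatible M → ∃ J ∈ Js, J.Compatible M

end BranchInstance

/-- The branching vectors. -/
noncomputable def branchingVectors (α δ : ℝ) : List (List ℝ) :=
  [[1, 1 + α],
   [1, 1 + δ],
   [1, 2, 2 + α],
   [1, 2, 2 + δ],
   [2 - δ, 3 - δ - α, 2 - δ, 3 - δ],
   [1 + α - δ, 2 - δ],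
   [1, 4 - 2 * α, 2],
   [1, 2, 3, 4 - α],
   [1, 2, 3, 4 - α, 5 - δ - α],
   [1, 2, 3, 5 - 2 * α, 5 - 2 * α]]

/-- `x` is the branching number of the vector `r = (r₁, …, r_k)` of positive reals: the positive
solution of `x ^ (-r₁) + ⋯ + x ^ (-r_k) = 1`. -/
def IsBranchingNumber (r : List ℝ) (x : ℝ) : Prop :=
  0 < x ∧ (r.map fun a => x ^ (-a)).sum = 1

/-- `HasSearchTree G α δ I`: the instance `I` is completely resolved by a finite search tree in
which every inner node is a reduction to one instance that does not increase the measure, or a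
complete case distinction whose decrease of the measure is not worse than one of the branching
vectors; at a leaf, all vertices are decided or no minimal connected dominating set is left. -/
inductive HasSearchTree {V : Type u} [Fintype V] [DecidableEq V] (G : SimpleGraph V) (α δ : ℝ) :
    BranchInstance V → Prop
  | leaf (I : BranchInstance V) (h : I.free = ∅) : HasSearchTree G α δ I
  | discard (I : BranchInstance V) (h : ∀ M, IsMinimalCDS G M → ¬ I.Compatible M) :
      HasSearchTree G α δ I
  | reduce (I J : BranchInstance V) (hc : BranchInstance.Covers G [J] I)
      (hm : J.measure G α δ ≤ I.measure G α δ) (hJ : HasSearchTree G α δ J) :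
      HasSearchTree G α δ I
  | branch (I : BranchInstance V) (Js : List (BranchInstance V)) (r : List ℝ)
      (hr : r ∈ branchingVectors α δ) (hc : BranchInstance.Covers G Js I)
      (hm : List.Forall₂ (fun J a => J.measure G α δ ≤ I.measure G α δ - a) Js r)
      (hJs : ∀ J ∈ Js, HasSearchTree G α δ J) : HasSearchTree G α δ I

end CDSEnum

/-! Call a vertex undominated if it is outside the solution `S` and has no neighbour in `S`. Since
`S` is not empty, every compatible connected dominating set contains an undecided neighbour of each
undominated vertex (`Undom.exists_mem`). An undominated vertex with at most two undecided neighbours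
therefore gives a good branching. If there is none, let `W` be the set of undecided and of
undominated vertices. By degeneracy some `x ∈ W` has at most two neighbours in `W`. It cannot be
undominated, so it is undecided and adjacent to `S`. If `x` has a discarded undominated neighbour or
touches two components of `S`, taking it saves an extra `α` or `δ`. Otherwise `x` is simple, and the
key lemma `IsSimple.exists_use` applies: a minimal set that contains `x` also contains an undecided
neighbour of `x`, or `x` is its only vertex to dominate some undecided neighbour; else `x` could be
removed. Branching over `x` and its at most two undecided neighbours `y`, `z` leaves a last case
where `y` or `z` is private to `x`. All other neighbours of that vertex are then discarded, and such
neighbours exist because undominated vertices now have at least three undecided neighbours.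

`exists_rule` is this case analysis, and `goodStep_of_mem_rules` shows that each rule is an exact
case distinction governed by one of the vectors. Induction on the number of undecided vertices gives
the search tree. The number `rate`, slightly below 1.9767, satisfies `∑ rate ^ (-rᵢ) ≤ 1` for every
vector (`sum_rate_le_one`). Hence the branching numbers are at most `rate`, and at most `rate ^
μ(I)` minimal sets are compatible with `I` (`HasSearchTree.ncard_le`). Summing over the start sets
`{v}` costs a factor of order `n`, which the gap between `rate` and 1.9767 absorbs.

The machine runs the same branching depth first on a stack. Conditions and cases of the rules are
data, formulas and lists of decisions, so that one compiler and one correctness proof serve all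
rules; the machine tries all assignments of four vertices. The cases of a rule never share a minimal
set and the start states fix the least vertex of the solution, so no set is output twice. The stack
has linear height (`Pending`), and a potential of order `rate ^ μ` that falls in every round bounds
the running time (`GoodStep.sum_weight_le`). -/

namespace CDSEnum

/-! ## Linked vertices -/

section Linked

variable {V : Type u} {G : SimpleGraph V}

/-- `u` and `v` lie in the same component of the subgraph induced by `T`. -/
def Linked (G : SimpleGraph V) (T : Set V) (u v : V) : Prop :=
  ∃ (hu : u ∈ T) (hv : v ∈ T), (G.induce T).Reachable ⟨u, hu⟩ ⟨v, hv⟩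

theorem Linked.refl {T : Set V} {u : V} (hu : u ∈ T) : Linked G T u u := ⟨hu, hu, .refl _⟩

theorem Linked.symm {T : Set V} {u v : V} (h : Linked G T u v) : Linked G T v u :=
  ⟨h.2.1, h.1, h.2.2.symm⟩

theorem Linked.trans {T : Set V} {u v w : V} (h : Linked G T u v) (h' : Linked G T v w) :
    Linked G T u w :=
  ⟨h.1, h'.2.1, h.2.2.trans h'.2.2⟩

theorem Linked.of_adj {T : Set V} {u v : V} (hu : u ∈ T) (hv : v ∈ T) (h : G.Adj u v) :
    Linked G T u v :=
  ⟨hu, hv, SimpleGraph.Adj.reachable (G := G.induce T) (u := ⟨u, hu⟩) (v := ⟨v, hv⟩) h⟩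

/-- Induction along the walks of an induced subgraph. -/
theorem Linked.induction {T : Set V} {u : V} {P : V → Prop} (h0 : P u)
    (hs : ∀ a b, a ∈ T → b ∈ T → Linked G T u a → G.Adj a b → P a → P b) {v : V}
    (h : Linked G T u v) : P v := by
  obtain ⟨hu, hv, h⟩ := h
  rw [SimpleGraph.reachable_iff_reflTransGen] at h
  have : ∀ w : T, Relation.ReflTransGen (G.induce T).Adj ⟨u, hu⟩ w → P w := by
    intro w hw
    induction hw with
    | refl => exact h0
    | @tail b c hb hbc ih =>
      refine hs b c b.2 c.2 ⟨hu, b.2, ?_⟩ hbc ih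
      rwa [SimpleGraph.reachable_iff_reflTransGen]
  exact this ⟨v, hv⟩ h

theorem Linked.mono {T T' : Set V} (hT : T ⊆ T') {u v : V} (h : Linked G T u v) :
    Linked G T' u v :=
  h.induction (Linked.refl (hT h.1))
    fun _ _ ha hb _ hab hP => hP.trans (Linked.of_adj (hT ha) (hT hb) hab)

theorem connected_induce_iff {T : Set V} :
    (G.induce T).Connected ↔ T.Nonempty ∧ ∀ u ∈ T, ∀ v ∈ T, Linked G T u v := by
  constructor
  · intro h
    obtain ⟨⟨w, hw⟩⟩ := h.nonempty
    exact ⟨⟨w, hw⟩, fun u hu v hv => ⟨hu, hv, h.preconnected _ _⟩⟩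
  · rintro ⟨⟨w, hw⟩, h⟩
    have : Nonempty T := ⟨⟨w, hw⟩⟩
    exact ⟨fun u v => (h u u.2 v v.2).2.2⟩

end Linked

/-! ## Connected dominating sets -/

section CDS

variable {V : Type u} {G : SimpleGraph V}

theorem isCDS_iff {S : Finset V} : IsCDS G S ↔
    (∀ v, v ∈ S ∨ ∃ w ∈ S, G.Adj v w) ∧ S.Nonempty ∧ ∀ u ∈ S, ∀ v ∈ S, Linked G S u v := by
  simp only [IsCDS, connected_induce_iff, Finset.mem_coe, Finset.coe_nonempty]

/-- Each added vertex has a neighbour in the smaller set and thus joins its only component. By this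
monotonicity, minimality need only be tested by removing single vertices. -/
theorem IsCDS.mono {S T : Finset V} (hST : S ⊆ T) (h : IsCDS G S) : IsCDS G T := by
  rw [isCDS_iff] at h ⊢
  obtain ⟨hd, ⟨a, ha⟩, hl⟩ := h
  refine ⟨fun v => ?_, ⟨a, hST ha⟩, ?_⟩
  · rcases hd v with h | ⟨w, hw, h⟩
    · exact .inl (hST h)
    · exact .inr ⟨w, hST hw, h⟩
  · have key : ∀ u ∈ T, Linked G T u a := by
      intro u hu
      rcases hd u with h | ⟨w, hw, h⟩
      · exact (hl u h a ha).mono (by exact_mod_cast hST)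
      · exact (Linked.of_adj hu (by exact_mod_cast hST hw) h).trans
          ((hl w hw a ha).mono (by exact_mod_cast hST))
    exact fun u hu v hv => (key u hu).trans (key v hv).symm

theorem isMinimalCDS_iff [DecidableEq V] {S : Finset V} :
    IsMinimalCDS G S ↔ IsCDS G S ∧ ∀ x ∈ S, ¬ IsCDS G (S.erase x) := by
  constructor
  · refine fun h => ⟨h.prop, fun x hx hc => ?_⟩
    exact Finset.notMem_erase x S (h.le_of_le hc (Finset.erase_subset x S) hx)
  · rintro ⟨h, hx⟩
    refine ⟨h, fun T hT hTS x hxS => ?_⟩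
    by_contra hxT
    exact hx x hxS (hT.mono fun y hy =>
      Finset.mem_erase.2 ⟨fun e => hxT (e ▸ hy), hTS hy⟩)

/-- A vertex of a connected dominating set can be removed if its neighbours in the set stay
connected without it and none of its neighbours outside depends on it. -/
theorem IsCDS.erase [DecidableEq V] {M : Finset V} (hM : IsCDS G M) {x s : V} (hs : s ∈ M)
    (hxs : G.Adj x s) (hc : ∀ u ∈ M, G.Adj x u → Linked G (M.erase x : Finset V) s u)
    (hd : ∀ v ∉ M, G.Adj x v → ∃ w ∈ M, w ≠ x ∧ G.Adj v w) : IsCDS G (M.erase x) := by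
  rw [isCDS_iff] at hM ⊢
  obtain ⟨hdom, -, hl⟩ := hM
  have hsx : s ∈ M.erase x := Finset.mem_erase.2 ⟨hxs.ne', hs⟩
  refine ⟨fun v => ?_, ⟨s, hsx⟩, ?_⟩
  · by_cases hvx : v = x
    · exact .inr ⟨s, hsx, hvx ▸ hxs⟩
    by_cases hv : v ∈ M
    · exact .inl (Finset.mem_erase.2 ⟨hvx, hv⟩)
    · right
      by_cases hxv : G.Adj x v
      · obtain ⟨w, hw, hwx, h⟩ := hd v hv hxv
        exact ⟨w, Finset.mem_erase.2 ⟨hwx, hw⟩, h⟩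
      · obtain ⟨w, hw, h⟩ := (hdom v).resolve_left hv
        exact ⟨w, Finset.mem_erase.2 ⟨fun e => hxv (e ▸ h.symm), hw⟩, h⟩
  · have key : ∀ u ∈ M.erase x, Linked G (M.erase x : Finset V) s u := by
      intro u hu
      have hu' := Finset.mem_erase.1 hu
      -- Follow a walk inside `M` from `s`. Whenever it leaves `x`, the next vertex is a neighbour
      -- of `x` and is linked to `s` without `x` by `hc`.
      refine (hl s hs u hu'.2).induction
        (P := fun v => v ≠ x → Linked G (M.erase x : Finset V) s v) ?_ ?_ hu'.1
      · exact fun _ => Linked.refl (by exact_mod_cast hsx)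
      · intro a b ha hb _ hab ih hbx
        by_cases hax : a = x
        · exact hc b hb (hax ▸ hab)
        · exact (ih hax).trans (Linked.of_adj (Finset.mem_coe.2 (Finset.mem_erase.2 ⟨hax, ha⟩))
            (Finset.mem_coe.2 (Finset.mem_erase.2 ⟨hbx, hb⟩)) hab)
    exact fun u hu v hv => (key u hu).symm.trans (key v hv)

/-- A vertex of a connected dominating set with at least two elements has a neighbour in it. -/
theorem IsCDS.exists_adj {M : Finset V} (hM : IsCDS G M) {s : V} (hs : s ∈ M) {v : V}
    (hv : v ≠ s) : ∃ w ∈ M, G.Adj v w := by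
  rw [isCDS_iff] at hM
  rcases hM.1 v with h | h
  · refine (hM.2.2 s hs v h).induction (P := fun v => v ≠ s → ∃ w ∈ M, G.Adj v w) ?_ ?_ hv
    · exact fun h => absurd rfl h
    · exact fun a b ha _ _ hab _ _ => ⟨a, ha, hab.symm⟩
  · exact h

/-- In a 2-degenerate graph, every nonempty set contains a vertex with at most two neighbours in
the set. -/
theorem IsDegenerate.exists_le_two [Fintype V] (hG : IsDegenerate G 2) {W : Set V}
    (hW : W.Nonempty) :
    ∃ v ∈ W, ∃ a b, ∀ u ∈ W, G.Adj v u → u = a ∨ u = b := by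
  obtain ⟨e, he⟩ := hG
  obtain ⟨w, hw⟩ := hW
  -- The earliest vertex of `W` in the elimination order: all its neighbours in `W` come later.
  obtain ⟨i, hi, hmin⟩ := WellFounded.has_min (wellFounded_lt (α := Fin (Fintype.card V)))
    {i | e i ∈ W} ⟨e.symm w, by simpa using hw⟩
  refine ⟨e i, hi, ?_⟩
  set N := {j | i ≤ j ∧ G.Adj (e i) (e j)} with hN
  have hcard : N.ncard ≤ 2 := he i
  have hsub : ∀ u ∈ W, G.Adj (e i) u → e.symm u ∈ N := fun u hu h =>
    ⟨not_lt.1 (hmin (e.symm u) (by simpa using hu)), by simpa using h⟩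
  -- With fewer than two neighbours, the pair is filled up by a repeated or arbitrary vertex; users
  -- of the lemma must not assume `a ≠ b` or adjacency.
  have hab : ∃ a b, N ⊆ {a, b} := by
    rcases Nat.lt_or_ge N.ncard 2 with h | h
    · rcases Nat.lt_or_ge N.ncard 1 with h1 | h1
      · have : N = ∅ := (Set.ncard_eq_zero (Set.toFinite N)).1 (by omega)
        exact ⟨i, i, by simp [this]⟩
      · obtain ⟨a, ha⟩ := Set.ncard_eq_one.1 (show N.ncard = 1 by omega)
        exact ⟨a, a, by simp [ha]⟩
    · obtain ⟨a, b, -, h⟩ := Set.ncard_eq_two.1 (show N.ncard = 2 by omega)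
      exact ⟨a, b, h.le⟩
  obtain ⟨a, b, hab⟩ := hab
  refine ⟨e a, e b, fun u hu h => ?_⟩
  rcases hab (hsub u hu h) with h | h
  · exact .inl (by rw [← h, e.apply_symm_apply])
  · exact .inr (by rw [← Set.mem_singleton_iff.1 h, e.apply_symm_apply])

end CDS

/-! ## Components of induced subgraphs -/

section Components

variable {V : Type u} {G : SimpleGraph V}

/-- The map between components that comes from an inclusion of vertex sets. -/
def componentMap (G : SimpleGraph V) {T T' : Set V} (h : T ⊆ T') :
    (G.induce T).ConnectedComponent → (G.induce T').ConnectedComponent :=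
  SimpleGraph.ConnectedComponent.map (SimpleGraph.induceHomOfLE G h).toHom

theorem card_component_insert_le [Finite V] (T : Set V) (x : V) :
    Nat.card (G.induce (insert x T)).ConnectedComponent ≤
      Nat.card (G.induce T).ConnectedComponent + 1 := by
  rw [← Finite.card_option]
  refine Nat.card_le_card_of_surjective (fun o : Option _ => o.elim
    ((G.induce (insert x T)).connectedComponentMk ⟨x, Set.mem_insert x T⟩)
    (componentMap G (Set.subset_insert x T))) fun c => ?_
  induction c using SimpleGraph.ConnectedComponent.ind with
  | h v =>
    obtain ⟨v, rfl | hv⟩ := v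
    · exact ⟨none, rfl⟩
    · exact ⟨some ((G.induce T).connectedComponentMk ⟨v, hv⟩), rfl⟩

/-- The new vertex lies in the component of its neighbour `s`, so no component is new. -/
theorem componentMap_insert_surjective {T : Set V} {x s : V} (hs : s ∈ T) (h : G.Adj x s) :
    Function.Surjective (componentMap G (Set.subset_insert x T)) := by
  intro c
  induction c using SimpleGraph.ConnectedComponent.ind with
  | h v =>
    obtain ⟨v, rfl | hv⟩ := v
    · refine ⟨(G.induce T).connectedComponentMk ⟨s, hs⟩, ?_⟩
      exact SimpleGraph.ConnectedComponent.sound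
        (Linked.of_adj (Set.mem_insert_of_mem _ hs) (Set.mem_insert _ _) h.symm).2.2
    · exact ⟨(G.induce T).connectedComponentMk ⟨v, hv⟩, rfl⟩

theorem card_component_insert_le_of_adj [Finite V] {T : Set V} {x s : V} (hs : s ∈ T)
    (h : G.Adj x s) :
    Nat.card (G.induce (insert x T)).ConnectedComponent ≤
      Nat.card (G.induce T).ConnectedComponent :=
  Nat.card_le_card_of_surjective _ (componentMap_insert_surjective hs h)

/-- Were the numbers of components equal, the surjection between them would be injective, but it
identifies the components of `s` and `t`, which meet at `x`. -/
theorem card_component_insert_lt [Finite V] {T : Set V} {x s t : V} (hs : s ∈ T) (ht : t ∈ T)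
    (hxs : G.Adj x s) (hxt : G.Adj x t) (hst : ¬ Linked G T s t) :
    Nat.card (G.induce (insert x T)).ConnectedComponent + 1 ≤
      Nat.card (G.induce T).ConnectedComponent := by
  rw [Nat.succ_le_iff]
  refine lt_of_le_of_ne (card_component_insert_le_of_adj hs hxs) fun he => hst ?_
  have hb := (Nat.bijective_iff_surjective_and_card _).2
    ⟨componentMap_insert_surjective hs hxs, he.symm⟩
  refine ⟨hs, ht, SimpleGraph.ConnectedComponent.exact (hb.1 ?_)⟩
  refine SimpleGraph.ConnectedComponent.sound ?_
  have hx := Set.mem_insert x T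
  exact ((Linked.of_adj (Set.mem_insert_of_mem x hs) hx hxs.symm).trans
    (Linked.of_adj hx (Set.mem_insert_of_mem x ht) hxt)).2.2

end Components

/-! ## States of the search -/

/-- A state of the search assigns to each vertex `0` (undecided), `1` (in the solution)
or `2` (discarded). -/
abbrev State (V : Type u) := V → ℕ

section State

variable {V : Type u}

/-- `v` has a neighbour in the solution. -/
def Dom (G : SimpleGraph V) (st : State V) (v : V) : Prop := ∃ w, st w = 1 ∧ G.Adj v w

/-- The vertices in the solution. -/
def solSet (st : State V) : Set V := {v | st v = 1}

theorem solSet_take [DecidableEq V] {st : State V} (x : V) :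
    solSet (Function.update st x 1) = insert x (solSet st) := by
  ext v
  by_cases h : v = x <;> simp [solSet, h]

theorem dom_take [DecidableEq V] {G : SimpleGraph V} {st : State V} {x v : V}
    (hv : Dom G st v) (hx : st x = 0) :
    Dom G (Function.update st x 1) v := by
  obtain ⟨w, hw, h⟩ := hv
  refine ⟨w, ?_, h⟩
  rw [Function.update_of_ne (by rintro rfl; omega), hw]

theorem solSet_out [DecidableEq V] {st : State V} {x : V} (hx : st x = 0) {k : ℕ} (hk : k ≠ 1) :
    solSet (Function.update st x k) = solSet st := by
  ext v
  by_cases h : v = x <;> simp [solSet, h, hk, hx]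

theorem dom_congr {G : SimpleGraph V} {st st' : State V} (h : solSet st = solSet st') {v : V} :
    Dom G st v ↔ Dom G st' v := by
  have h' : ∀ w, st w = 1 ↔ st' w = 1 := fun w => by
    simpa [solSet] using congrArg (w ∈ ·) h
  simp [Dom, h']

open Classical in
/-- Discard all undecided neighbours of `y`. -/
noncomputable def clearNbrs (G : SimpleGraph V) (y : V) (st : State V) : State V :=
  fun u => if st u = 0 ∧ G.Adj y u then 2 else st u

theorem solSet_clearNbrs {G : SimpleGraph V} {st : State V} {y : V} :
    solSet (clearNbrs G y st) = solSet st := by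
  ext v
  simp only [solSet, Set.mem_ofPred_eq, clearNbrs]
  split_ifs with h <;> simp_all

variable [Fintype V]

/-- The branching instance given by a state. -/
def toInstance (st : State V) : BranchInstance V where
  free := Finset.univ.filter fun v => st v = 0
  sol := Finset.univ.filter fun v => st v = 1
  disj := by
    rw [Finset.disjoint_left]
    intro v hv hv'
    simp_all

@[simp] theorem mem_free {st : State V} {v : V} : v ∈ (toInstance st).free ↔ st v = 0 := by
  simp [toInstance]

@[simp] theorem mem_sol {st : State V} {v : V} : v ∈ (toInstance st).sol ↔ st v = 1 := by
  simp [toInstance]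

theorem coe_sol (st : State V) : ((toInstance st).sol : Set V) = solSet st := by
  ext v
  simp [solSet]

theorem card_component_take_of_dom {G : SimpleGraph V} {st : State V} {x : V} (hd : Dom G st x) :
    (Nat.card (G.induce (insert x (solSet st))).ConnectedComponent : ℝ) ≤
      Nat.card (G.induce (solSet st)).ConnectedComponent := by
  obtain ⟨s, hs, hxs⟩ := hd
  exact_mod_cast card_component_insert_le_of_adj (T := solSet st) hs hxs

/-! ### How single decisions change the measure -/

variable [DecidableEq V] {G : SimpleGraph V}

theorem mem_discardedUndominated {st : State V} {v : V} :
    v ∈ (toInstance st).discardedUndominated G ↔ st v ≠ 0 ∧ st v ≠ 1 ∧ ¬ Dom G st v := by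
  simp [BranchInstance.discardedUndominated, Dom]

/-- The measure of a state. -/
noncomputable def mu (G : SimpleGraph V) (α δ : ℝ) (st : State V) : ℝ :=
  (toInstance st).measure G α δ

variable {α δ : ℝ} {st : State V}

theorem mu_eq : mu G α δ st = ((toInstance st).free.card : ℝ)
    + α * (((toInstance st).discardedUndominated G).card : ℝ)
    + δ * (Nat.card (G.induce (solSet st)).ConnectedComponent : ℝ) := by
  rw [mu, BranchInstance.measure, coe_sol]

theorem mu_nonneg (hα : 0 ≤ α) (hδ : 0 ≤ δ) : 0 ≤ mu G α δ st := by
  rw [mu_eq]; positivity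

theorem free_card_update {x : V} (hx : st x = 0) {k : ℕ} (hk : k ≠ 0) :
    ((toInstance (Function.update st x k)).free.card : ℝ) = (toInstance st).free.card - 1 := by
  have : (toInstance (Function.update st x k)).free = (toInstance st).free.erase x := by
    ext v
    by_cases h : v = x <;> simp [h, hk]
  rw [this, Finset.card_erase_of_mem (by simpa using hx), Nat.cast_sub]
  · simp
  · exact Finset.card_pos.2 ⟨x, by simpa using hx⟩

theorem discardedUndominated_take_subset {x : V} (hx : st x = 0) :
    (toInstance (Function.update st x 1)).discardedUndominated G ⊆
      (toInstance st).discardedUndominated G := by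
  intro v hv
  rw [mem_discardedUndominated] at hv ⊢
  have hvx : v ≠ x := by rintro rfl; simp at hv
  rw [Function.update_of_ne hvx] at hv
  exact ⟨hv.1, hv.2.1, fun h => hv.2.2 (dom_take h hx)⟩

theorem discardedUndominated_take_card {x : V} (hx : st x = 0) :
    (((toInstance (Function.update st x 1)).discardedUndominated G).card : ℝ) ≤
      ((toInstance st).discardedUndominated G).card := by
  exact_mod_cast Finset.card_le_card (discardedUndominated_take_subset hx)

theorem discardedUndominated_take_card_lt {x v : V} (hx : st x = 0) (h0 : st v ≠ 0)
    (h1 : st v ≠ 1) (hd : ¬ Dom G st v) (hxv : G.Adj x v) :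
    (((toInstance (Function.update st x 1)).discardedUndominated G).card : ℝ) ≤
      ((toInstance st).discardedUndominated G).card - 1 := by
  have : ((toInstance (Function.update st x 1)).discardedUndominated G).card <
      ((toInstance st).discardedUndominated G).card := by
    refine Finset.card_lt_card ((Finset.ssubset_iff_of_subset
      (discardedUndominated_take_subset hx)).2 ⟨v, ?_, ?_⟩)
    · rw [mem_discardedUndominated]; exact ⟨h0, h1, hd⟩
    · rw [mem_discardedUndominated]
      exact fun h => h.2.2 ⟨x, by simp, hxv.symm⟩
  have h : ((toInstance (Function.update st x 1)).discardedUndominated G).card + 1 ≤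
      ((toInstance st).discardedUndominated G).card := this
  have h' : ((((toInstance (Function.update st x 1)).discardedUndominated G).card + 1 : ℕ) : ℝ) ≤
      ((toInstance st).discardedUndominated G).card := by exact_mod_cast h
  push_cast at h'
  linarith

/-- The vertex leaves `V'`, opens at most one component, and `O_n` can only shrink. The variants
below sharpen one term each: a dominated vertex opens no component, a neighbour in `O_n` leaves that
set, and two touched components merge. -/
theorem mu_take (hα : 0 ≤ α) (hδ : 0 ≤ δ) {x : V} (hx : st x = 0) :
    mu G α δ (Function.update st x 1) ≤ mu G α δ st - (1 - δ) := by
  have h : (Nat.card (G.induce (insert x (solSet st))).ConnectedComponent : ℝ) ≤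
      Nat.card (G.induce (solSet st)).ConnectedComponent + 1 := by
    exact_mod_cast card_component_insert_le _ x
  rw [mu_eq, mu_eq, free_card_update hx one_ne_zero, solSet_take]
  nlinarith [mul_le_mul_of_nonneg_left h hδ,
    mul_le_mul_of_nonneg_left (discardedUndominated_take_card (G := G) hx) hα]

theorem mu_take_undom (hα : 0 ≤ α) (hδ : 0 ≤ δ) {x v : V} (hx : st x = 0) (h0 : st v ≠ 0)
    (h1 : st v ≠ 1) (hd : ¬ Dom G st v) (hxv : G.Adj x v) :
    mu G α δ (Function.update st x 1) ≤ mu G α δ st - (1 + α - δ) := by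
  have h : (Nat.card (G.induce (insert x (solSet st))).ConnectedComponent : ℝ) ≤
      Nat.card (G.induce (solSet st)).ConnectedComponent + 1 := by
    exact_mod_cast card_component_insert_le _ x
  rw [mu_eq, mu_eq, free_card_update hx one_ne_zero, solSet_take]
  nlinarith [mul_le_mul_of_nonneg_left h hδ,
    mul_le_mul_of_nonneg_left (discardedUndominated_take_card_lt hx h0 h1 hd hxv) hα]

theorem mu_take_of_dom (hα : 0 ≤ α) (hδ : 0 ≤ δ) {x : V} (hx : st x = 0) (hd : Dom G st x) :
    mu G α δ (Function.update st x 1) ≤ mu G α δ st - 1 := by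
  rw [mu_eq, mu_eq, free_card_update hx one_ne_zero, solSet_take]
  nlinarith [mul_le_mul_of_nonneg_left (card_component_take_of_dom hd) hδ,
    mul_le_mul_of_nonneg_left (discardedUndominated_take_card (G := G) hx) hα]

theorem mu_take_of_dom_undom (hα : 0 ≤ α) (hδ : 0 ≤ δ) {x v : V} (hx : st x = 0)
    (hdx : Dom G st x) (h0 : st v ≠ 0) (h1 : st v ≠ 1) (hd : ¬ Dom G st v) (hxv : G.Adj x v) :
    mu G α δ (Function.update st x 1) ≤ mu G α δ st - (1 + α) := by
  rw [mu_eq, mu_eq, free_card_update hx one_ne_zero, solSet_take]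
  nlinarith [mul_le_mul_of_nonneg_left (card_component_take_of_dom hdx) hδ,
    mul_le_mul_of_nonneg_left (discardedUndominated_take_card_lt hx h0 h1 hd hxv) hα]

theorem mu_take_of_not_linked (hα : 0 ≤ α) (hδ : 0 ≤ δ) {x s t : V} (hx : st x = 0)
    (hs : st s = 1) (ht : st t = 1) (hxs : G.Adj x s) (hxt : G.Adj x t)
    (hst : ¬ Linked G (solSet st) s t) :
    mu G α δ (Function.update st x 1) ≤ mu G α δ st - (1 + δ) := by
  have h : ((Nat.card (G.induce (insert x (solSet st))).ConnectedComponent + 1 : ℕ) : ℝ) ≤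
      Nat.card (G.induce (solSet st)).ConnectedComponent := by
    exact_mod_cast card_component_insert_lt (T := solSet st) hs ht hxs hxt hst
  push_cast at h
  rw [mu_eq, mu_eq, free_card_update hx one_ne_zero, solSet_take]
  nlinarith [mul_le_mul_of_nonneg_left h hδ,
    mul_le_mul_of_nonneg_left (discardedUndominated_take_card (G := G) hx) hα]

/-- At worst the discarded vertex moves from `V'` to `O_n`; if it is dominated, it does not even do
that. -/
theorem mu_out (hα : 0 ≤ α) {x : V} (hx : st x = 0) {k : ℕ} (h0 : k ≠ 0) (h1 : k ≠ 1) :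
    mu G α δ (Function.update st x k) ≤ mu G α δ st - (1 - α) := by
  have h : ((toInstance (Function.update st x k)).discardedUndominated G) ⊆
      insert x ((toInstance st).discardedUndominated G) := by
    intro v hv
    rw [mem_discardedUndominated, dom_congr (solSet_out hx h1)] at hv
    by_cases hvx : v = x
    · exact Finset.mem_insert.2 (.inl hvx)
    · rw [Function.update_of_ne hvx] at hv
      exact Finset.mem_insert_of_mem (mem_discardedUndominated.2 hv)
  have h' : (((toInstance (Function.update st x k)).discardedUndominated G).card : ℝ) ≤
      ((toInstance st).discardedUndominated G).card + 1 := by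
    exact_mod_cast (Finset.card_le_card h).trans (Finset.card_insert_le _ _)
  rw [mu_eq, mu_eq, free_card_update hx h0, solSet_out hx h1]
  nlinarith [mul_le_mul_of_nonneg_left h' hα]

theorem mu_out_of_dom (hα : 0 ≤ α) {x : V} (hx : st x = 0) {k : ℕ} (h0 : k ≠ 0) (h1 : k ≠ 1)
    (hd : Dom G st x) : mu G α δ (Function.update st x k) ≤ mu G α δ st - 1 := by
  have h : ((toInstance (Function.update st x k)).discardedUndominated G) ⊆
      ((toInstance st).discardedUndominated G) := by
    intro v hv
    rw [mem_discardedUndominated, dom_congr (solSet_out hx h1)] at hv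
    by_cases hvx : v = x
    · exact absurd (hvx ▸ hd) hv.2.2
    · rw [Function.update_of_ne hvx] at hv
      exact mem_discardedUndominated.2 hv
  have h' : (((toInstance (Function.update st x k)).discardedUndominated G).card : ℝ) ≤
      ((toInstance st).discardedUndominated G).card := by
    exact_mod_cast Finset.card_le_card h
  rw [mu_eq, mu_eq, free_card_update hx h0, solSet_out hx h1]
  nlinarith [mul_le_mul_of_nonneg_left h' hα]

/-- Every cleared vertex gains at least `1 - α ≥ 0`, so it suffices to exhibit some of them, the set
`B`. -/
theorem mu_clearNbrs (hα : 0 ≤ α) (hα1 : α ≤ 1) {y : V} (B : Finset V)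
    (hB : ∀ u ∈ B, st u = 0 ∧ G.Adj y u) :
    mu G α δ (clearNbrs G y st) ≤ mu G α δ st - B.card * (1 - α) := by
  classical
  set N := (toInstance st).free.filter (fun u => G.Adj y u) with hN
  have hBN : (B.card : ℝ) ≤ N.card := by
    refine Nat.cast_le.2 (Finset.card_le_card fun u hu => ?_)
    simpa [hN] using hB u hu
  have hfree : (toInstance (clearNbrs G y st)).free = (toInstance st).free \ N := by
    ext u
    simp only [mem_free, clearNbrs, hN, Finset.mem_sdiff, Finset.mem_filter]
    split_ifs with h <;> simp_all
  have hcard : ((toInstance (clearNbrs G y st)).free.card : ℝ) =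
      (toInstance st).free.card - N.card := by
    have hs : N ⊆ (toInstance st).free := Finset.filter_subset _ _
    rw [hfree, Finset.card_sdiff_of_subset hs, Nat.cast_sub (Finset.card_le_card hs)]
  have hsub : (toInstance (clearNbrs G y st)).discardedUndominated G ⊆
      (toInstance st).discardedUndominated G ∪ N := by
    intro v hv
    rw [mem_discardedUndominated, dom_congr solSet_clearNbrs] at hv
    rw [Finset.mem_union]
    by_cases h : st v = 0 ∧ G.Adj y v
    · exact .inr (by simpa [hN] using h)
    · left
      rw [mem_discardedUndominated]
      simpa [clearNbrs, h] using hv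
  have hdis : (((toInstance (clearNbrs G y st)).discardedUndominated G).card : ℝ) ≤
      ((toInstance st).discardedUndominated G).card + N.card := by
    exact_mod_cast (Finset.card_le_card hsub).trans (Finset.card_union_le _ _)
  rw [mu_eq, mu_eq, hcard, solSet_clearNbrs]
  nlinarith [mul_le_mul_of_nonneg_left hdis hα, mul_le_mul_of_nonneg_right hBN (sub_nonneg.2 hα1)]

end State

/-! ## Sound branching steps -/

section Accept

variable {V : Type u} {G : SimpleGraph V} {st : State V}

/-- `M` agrees with the decisions of the state. -/
def Accept (st : State V) (M : Finset V) : Prop :=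
  (∀ v, st v = 1 → v ∈ M) ∧ ∀ v ∈ M, st v ≤ 1

variable {M : Finset V}

theorem accept_clearNbrs {y : V} :
    Accept (clearNbrs G y st) M ↔ Accept st M ∧ ∀ u, st u = 0 → G.Adj y u → u ∉ M := by
  simp only [Accept, clearNbrs]
  constructor
  · rintro ⟨h1, h2⟩
    refine ⟨⟨fun v hv => h1 v ?_, fun v hv => ?_⟩, fun u hu hy h => ?_⟩
    · rw [if_neg (by omega), hv]
    · have := h2 v hv
      split_ifs at this <;> omega
    · simpa [hu, hy] using h2 u h
  · rintro ⟨⟨h1, h2⟩, h⟩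
    refine ⟨fun v hv => h1 v ?_, fun v hv => ?_⟩
    · split_ifs at hv <;> omega
    · rw [if_neg fun hh => h v hh.1 hh.2 hv]
      exact h2 v hv

variable [DecidableEq V]

theorem accept_take {x : V} (hx : st x = 0) :
    Accept (Function.update st x 1) M ↔ Accept st M ∧ x ∈ M := by
  simp only [Accept, Function.update_apply]
  constructor
  · rintro ⟨h1, h2⟩
    refine ⟨⟨fun v hv => h1 v (by simp [hv]), fun v hv => ?_⟩, h1 x (by simp)⟩
    by_cases h : v = x
    · rw [h, hx]; omega
    · simpa [h] using h2 v hv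
  · rintro ⟨⟨h1, h2⟩, hxM⟩
    refine ⟨fun v hv => ?_, fun v hv => ?_⟩
    · by_cases h : v = x
      · rwa [h]
      · exact h1 v (by simpa [h] using hv)
    · split_ifs
      · exact le_rfl
      · exact h2 v hv

theorem accept_drop {x : V} (hx : st x = 0) :
    Accept (Function.update st x 2) M ↔ Accept st M ∧ x ∉ M := by
  simp only [Accept, Function.update_apply]
  constructor
  · rintro ⟨h1, h2⟩
    refine ⟨⟨fun v hv => h1 v ?_, fun v hv => ?_⟩, fun h => ?_⟩
    · rw [if_neg (by rintro rfl; omega), hv]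
    · by_cases h : v = x
      · rw [h, hx]; omega
      · simpa [h] using h2 v hv
    · simpa using h2 x h
  · rintro ⟨⟨h1, h2⟩, hxM⟩
    refine ⟨fun v hv => ?_, fun v hv => ?_⟩
    · by_cases h : v = x
      · simp [h] at hv
      · exact h1 v (by simpa [h] using hv)
    · rw [if_neg (by rintro rfl; exact hxM hv)]
      exact h2 v hv

end Accept

/-! ### Simple vertices and their use in minimal sets -/

section Steps

variable {V : Type u} {G : SimpleGraph V} {st : State V}

/-- `c` arises from `st` by decisions on undecided vertices, at least one of them. -/
def Ext (st c : State V) : Prop :=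
  (∀ v, c v = st v ∨ st v = 0 ∧ c v < 3) ∧ ∃ v, st v = 0 ∧ c v ≠ 0

theorem Ext.base [DecidableEq V] {x : V} (hx : st x = 0) {k : ℕ} (hk : k ≠ 0) (hk' : k < 3) :
    Ext st (Function.update st x k) := by
  refine ⟨fun v => ?_, x, hx, by simpa using hk⟩
  by_cases h : v = x
  · subst h; simp [hx, hk']
  · simp [h]

theorem Ext.update [DecidableEq V] {c : State V} {x : V} (hx : st x = 0) {k : ℕ} (hk : k ≠ 0)
    (hk' : k < 3) (h : Ext st c) : Ext st (Function.update c x k) := by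
  obtain ⟨h1, v, hv, hcv⟩ := h
  refine ⟨fun v => ?_, v, hv, ?_⟩
  · by_cases h : v = x
    · subst h; simp [hx, hk']
    · simpa [h] using h1 v
  · by_cases h : v = x
    · subst h; simpa using hk
    · simpa [h] using hcv

theorem Ext.clearNbrs {c : State V} {y : V} (h : Ext st c) : Ext st (clearNbrs G y c) := by
  obtain ⟨h1, v, hv, hcv⟩ := h
  refine ⟨fun v => ?_, v, hv, by simp [CDSEnum.clearNbrs, hcv]⟩
  have := h1 v
  simp only [CDSEnum.clearNbrs]
  split_ifs <;> omega

/-- `v` is neither in the solution nor adjacent to it. -/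
def Undom (G : SimpleGraph V) (st : State V) (v : V) : Prop := st v ≠ 1 ∧ ¬ Dom G st v

/-- `x` is undecided, adjacent to exactly one component of the solution, and to no discarded
vertex that is not dominated. -/
def IsSimple (G : SimpleGraph V) (st : State V) (x : V) : Prop :=
  st x = 0 ∧ Dom G st x ∧ (∀ v, G.Adj x v → st v ≠ 0 → ¬ Undom G st v) ∧
    ∀ s t, st s = 1 → st t = 1 → G.Adj x s → G.Adj x t → Linked G (solSet st) s t

/-- The undecided neighbours of `v` satisfy `P`. -/
def FreeNbrs (G : SimpleGraph V) (st : State V) (v : V) (P : V → Prop) : Prop :=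
  ∀ u, st u = 0 → G.Adj v u → P u

/-- The vertex `s` ensures that `v` has a neighbour in `M` even if `v` itself lies in `M`. This
neighbour is not yet in the solution because `v` is undominated. -/
theorem Undom.exists_mem {v : V} (hv : Undom G st v) (hs : ∃ s, st s = 1) {M : Finset V}
    (hM : IsMinimalCDS G M) (hA : Accept st M) : ∃ u ∈ M, st u = 0 ∧ G.Adj v u := by
  obtain ⟨s, hs⟩ := hs
  obtain ⟨w, hw, hvw⟩ := hM.prop.exists_adj (hA.1 s hs) (v := v) (by rintro rfl; exact hv.1 hs)
  have h1 := hA.2 w hw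
  have h2 : st w ≠ 1 := fun h => hv.2 ⟨w, h, hvw⟩
  exact ⟨w, hw, by omega, hvw⟩

/-- A vertex that is adjacent to just one component of the solution belongs to a minimal connected
dominating set only together with an undecided neighbour, or if it is the only one to dominate an
undecided neighbour. -/
theorem IsSimple.exists_use {x : V} (hx : IsSimple G st x) {M : Finset V}
    (hM : IsMinimalCDS G M) (hA : Accept st M) (hxM : x ∈ M) :
    ∃ y, st y = 0 ∧ G.Adj x y ∧
      (y ∈ M ∨ y ∉ M ∧ ¬ Dom G st y ∧ ∀ w ∈ M, G.Adj y w → w = x) := by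
  classical
  obtain ⟨hx0, ⟨s, hs, hxs⟩, hn, hl⟩ := hx
  by_contra! hcon
  have hsub : solSet st ⊆ ((M.erase x : Finset V) : Set V) := fun v hv => by
    have hv : st v = 1 := hv
    exact Finset.mem_coe.2 (Finset.mem_erase.2 ⟨by rintro rfl; omega, hA.1 v hv⟩)
  -- Under `hcon`, `M` without `x` is still connected and dominating. The neighbours of `x` in `M`
  -- are solution vertices, all in one component of the solution. A neighbour outside `M` is
  -- dominated by the solution or is undecided with another dominator; simplicity excludes the
  -- remaining possibility.
  refine (isMinimalCDS_iff.1 hM).2 x hxM (hM.prop.erase (hA.1 s hs) hxs ?_ ?_)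
  · intro u hu hxu
    have hu1 := hA.2 u hu
    rcases (show st u = 0 ∨ st u = 1 by omega) with h | h
    · exact absurd hu (hcon u h hxu).1
    · exact (hl s u hs h hxs hxu).mono hsub
  · intro v hv hxv
    have key : Dom G st v → ∃ w ∈ M, w ≠ x ∧ G.Adj v w := by
      rintro ⟨w, hw, hvw⟩
      exact ⟨w, hA.1 w hw, by rintro rfl; omega, hvw⟩
    by_cases hd : Dom G st v
    · exact key hd
    by_cases h0 : st v = 0
    · obtain ⟨w, hw, hvw, hwx⟩ := (hcon v h0 hxv).2 hv hd
      exact ⟨w, hw, hwx, hvw⟩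
    · exact absurd ⟨fun h => hv (hA.1 v h), hd⟩ (hn v hxv h0)

theorem Undom.eq_zero {y w : V} (hy : Undom G st y) {M : Finset V} (hA : Accept st M)
    (hw : w ∈ M) (h : G.Adj y w) : st w = 0 := by
  have h1 := hA.2 w hw
  have h2 : st w ≠ 1 := fun e => hy.2 ⟨w, e, h⟩
  omega

/-- The hypothesis makes `x` the only decided vertex of `M` next to `y`, so clearing spares `x` and
forbids every other dominator of `y`. Thus "`y` is private to `x`" becomes a condition on states. -/
theorem accept_clearNbrs_iff {c : State V} {M : Finset V} (hc : Accept c M) {x y : V}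
    (h : ∀ u ∈ M, G.Adj y u → (c u = 0 ↔ u ≠ x)) :
    Accept (clearNbrs G y c) M ↔ ∀ w ∈ M, G.Adj y w → w = x := by
  rw [accept_clearNbrs]
  constructor
  · rintro ⟨-, h'⟩ w hw hyw
    by_contra hwx
    exact h' w ((h w hw hyw).2 hwx) hyw hw
  · exact fun h' => ⟨hc, fun u hu hyu huM => (h u huM hyu).1 hu (h' u huM hyu)⟩

/-- If `x` is used and none of its neighbours `y`, `z` is, then `x` is the only vertex to dominate
one of them. -/
theorem IsSimple.private_or {x y z : V} (hx : IsSimple G st x)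
    (hN : FreeNbrs G st x fun u => u = y ∨ u = z) {M : Finset V}
    (hM : IsMinimalCDS G M) (hA : Accept st M) (hxM : x ∈ M) (hyM : y ∉ M) (hzM : z ∉ M) :
    (∀ w ∈ M, G.Adj y w → w = x) ∨ ∀ w ∈ M, G.Adj z w → w = x := by
  obtain ⟨y', hy', hxy', h⟩ := hx.exists_use hM hA hxM
  rcases hN y' hy' hxy' with rfl | rfl
  · exact .inl (h.resolve_left hyM).2.2
  · exact .inr (h.resolve_left hzM).2.2

theorem countP_drop_take [DecidableEq V] {x : V} (hx : st x = 0) {M : Finset V} (hA : Accept st M) :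
    open Classical in
    [Function.update st x 2, Function.update st x 1].countP (fun c => Accept c M) = 1 := by
  by_cases hxM : x ∈ M <;>
    simp [accept_take, accept_drop, hx, hA, hxM]

end Steps

/-! ### One exact case distinction for each rule -/

section GoodStep

variable {V : Type u} [Fintype V] [DecidableEq V] {G : SimpleGraph V} {st : State V} {α δ : ℝ}

open Classical in
/-- The states `cs` form an exact case distinction for `st`, whose decrease of the measure is
controlled. -/
structure GoodStep (G : SimpleGraph V) (α δ : ℝ) (st : State V) (cs : List (State V)) : Prop where
  ext : ∀ c ∈ cs, Ext st c
  -- This bounds the growth of the stack in one round.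
  length : cs.length ≤ 5
  count : ∀ M, IsMinimalCDS G M → Accept st M → cs.countP (fun c => Accept c M) = 1
  -- A single case must gain a fixed amount: reductions also cost a round of the machine and have to
  -- be paid for by the measure.
  drop : cs = [] ∨ (∃ c, cs = [c] ∧ mu G α δ c ≤ mu G α δ st - 4 / 5) ∨
    ∃ r ∈ branchingVectors α δ, List.Forall₂ (fun c a => mu G α δ c ≤ mu G α δ st - a) cs r

theorem mu_decide (hα : 0 ≤ α) (hδ : 0 ≤ δ) {x : V} (hx : st x = 0) {k : ℕ} (hk : k ≠ 0)
    (hd : Dom G st x) : mu G α δ (Function.update st x k) ≤ mu G α δ st - 1 := by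
  by_cases h : k = 1
  · rw [h]; exact mu_take_of_dom hα hδ hx hd
  · exact mu_out_of_dom hα hx hk h hd

theorem mu_decide_two (hα : 0 ≤ α) (hδ : 0 ≤ δ) {x y : V} (hx : st x = 0) (hd : Dom G st x)
    (hy : st y = 0) (hxy : G.Adj x y) {k : ℕ} (hk : k ≠ 0) :
    mu G α δ (Function.update (Function.update st x 1) y k) ≤ mu G α δ st - 2 := by
  have h1 := mu_take_of_dom hα hδ hx hd
  have h2 := mu_decide (G := G) (st := Function.update st x 1) hα hδ (x := y)
    (by simp [hxy.ne', hy]) hk ⟨x, by simp, hxy.symm⟩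
  linarith

theorem mu_decide_three (hα : 0 ≤ α) (hδ : 0 ≤ δ) {x y z : V} (hx : st x = 0)
    (hd : Dom G st x) (hy : st y = 0) (hz : st z = 0) (hyz : y ≠ z) (hxy : G.Adj x y)
    (hxz : G.Adj x z) {k l : ℕ} (hk : k ≠ 0) (hl : l ≠ 0) :
    mu G α δ (Function.update (Function.update (Function.update st x 1) y k) z l) ≤
      mu G α δ st - 3 := by
  have h1 := mu_decide_two hα hδ hx hd hy hxy hk
  have h2 := mu_decide (G := G) (st := Function.update (Function.update st x 1) y k) hα hδ (x := z)
    (by simp [hxz.ne', hyz.symm, hz]) hl ⟨x, by simp [hxy.ne], hxz.symm⟩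
  linarith

theorem mu_clearNbrs_one (hα : 0 ≤ α) (hα' : α ≤ 1) {y w : V} (hw : st w = 0)
    (hyw : G.Adj y w) : mu G α δ (clearNbrs G y st) ≤ mu G α δ st - (1 - α) := by
  have := mu_clearNbrs (G := G) (δ := δ) (st := st) hα hα' (y := y) {w} (by simp [hw, hyw])
  simpa using this

theorem goodStep_undom_zero {v : V} (hs : ∃ s, st s = 1) (hv : Undom G st v)
    (hN : FreeNbrs G st v fun _ => False) : GoodStep G α δ st [] where
  ext := by simp
  length := by simp
  count M hM hA := by
    obtain ⟨u, -, hu, h⟩ := hv.exists_mem hs hM hA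
    exact (hN u hu h).elim
  drop := .inl rfl

/-- Only `a` can serve `v`. Taking it may open a component, and `1 - δ` is still at least `4 / 5`.
-/
theorem goodStep_undom_one {v a : V} (hα : 0 ≤ α) (hδ : 0 ≤ δ) (hδ' : δ ≤ 1 / 5)
    (hs : ∃ s, st s = 1) (hv : Undom G st v) (ha : st a = 0)
    (hN : FreeNbrs G st v fun u => u = a) : GoodStep G α δ st [Function.update st a 1] where
  ext := by simp [Ext.base, ha]
  length := by simp
  count M hM hA := by
    obtain ⟨u, huM, hu, h⟩ := hv.exists_mem hs hM hA
    obtain rfl := hN u hu h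
    simp [accept_take, ha, hA, huM]
  drop := by
    refine .inr (.inl ⟨_, rfl, ?_⟩)
    have := mu_take (G := G) hα hδ ha
    linarith

/-- One of `a`, `b` is used; the second case holds the sets with `b` but without `a`. There the `α`
gained because `v` leaves `O_n` pays for `a` possibly entering it. -/
theorem goodStep_discarded_two {v a b : V} (hα : 0 ≤ α) (hδ : 0 ≤ δ) (hs : ∃ s, st s = 1)
    (hv0 : st v ≠ 0) (hv : Undom G st v) (ha : st a = 0) (hb : st b = 0) (hab : a ≠ b)
    (hva : G.Adj v a) (hvb : G.Adj v b) (hN : FreeNbrs G st v fun u => u = a ∨ u = b) :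
    GoodStep G α δ st
      [Function.update st a 1, Function.update (Function.update st b 1) a 2] where
  -- The nested updates need side conditions of side conditions, deeper than the default depth.
  ext := by simp (maxDischargeDepth := 9) [Ext.base, Ext.update, ha, hb]
  length := by simp
  count M hM hA := by
    obtain ⟨u, huM, hu, h⟩ := hv.exists_mem hs hM hA
    have := hN u hu h
    by_cases haM : a ∈ M
    · simp [accept_take, accept_drop, ha, hb, hab, hA, haM, List.countP_cons]
    · have hbM : b ∈ M := by grind
      simp [accept_take, accept_drop, ha, hb, hab, hA, haM, hbM, List.countP_cons]
  drop := by
    refine .inr (.inr ⟨[1 + α - δ, 2 - δ], by simp [branchingVectors], .cons ?_ (.cons ?_ .nil)⟩)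
    · exact mu_take_undom hα hδ ha hv0 hv.1 hv.2 hva.symm
    · have h1 := mu_take_undom hα hδ hb hv0 hv.1 hv.2 hvb.symm
      have h2 := mu_out (G := G) (δ := δ) (st := Function.update st b 1) hα (x := a)
        (by simp [hab, ha]) two_ne_zero (by decide)
      linarith

/-- Once `a` or `b` is taken, `v` is dominated, so deciding it gains a full unit. In the last case
`v` is taken before `a` is discarded; then `a` is dominated and stays out of `O_n`. -/
theorem goodStep_free_two {v a b : V} (hα : 0 ≤ α) (hδ : 0 ≤ δ) (hs : ∃ s, st s = 1)
    (hv0 : st v = 0) (hv : Undom G st v) (ha : st a = 0) (hb : st b = 0) (hab : a ≠ b)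
    (hva : G.Adj v a) (hvb : G.Adj v b) (hN : FreeNbrs G st v fun u => u = a ∨ u = b) :
    GoodStep G α δ st
      [Function.update (Function.update st a 1) v 1,
       Function.update (Function.update (Function.update st b 1) a 2) v 2,
       Function.update (Function.update st a 1) v 2,
       Function.update (Function.update (Function.update st b 1) v 1) a 2] where
  ext := by simp (maxDischargeDepth := 9) [Ext.base, Ext.update, ha, hb, hv0]
  length := by simp
  count M hM hA := by
    obtain ⟨u, huM, hu, h⟩ := hv.exists_mem hs hM hA
    have := hN u hu h
    have eva := hva.ne
    have evb := hvb.ne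
    by_cases haM : a ∈ M
    · by_cases hvM : v ∈ M
      all_goals simp [accept_take, accept_drop, ha, hb, hv0, hab, eva, evb, eva.symm, hA, haM, hvM,
        List.countP_cons]
    · have hbM : b ∈ M := by grind
      by_cases hvM : v ∈ M
      all_goals simp [accept_take, accept_drop, ha, hb, hv0, hab, eva, evb, eva.symm, hA, haM, hbM,
        hvM, List.countP_cons]
  drop := by
    have eva := hva.ne
    have evb := hvb.ne
    have ma := mu_take (G := G) hα hδ ha
    have mb := mu_take (G := G) hα hδ hb
    have key : ∀ k ≠ 0, mu G α δ (Function.update (Function.update st a 1) v k) ≤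
        mu G α δ st - (2 - δ) := by
      intro k hk
      have := mu_decide (G := G) (st := Function.update st a 1) hα hδ (x := v)
        (by simp [eva, hv0]) hk ⟨a, by simp, hva⟩
      linarith
    refine .inr (.inr ⟨[2 - δ, 3 - δ - α, 2 - δ, 3 - δ], by simp [branchingVectors],
      .cons (key 1 one_ne_zero) (.cons ?_ (.cons (key 2 two_ne_zero) (.cons ?_ .nil)))⟩)
    · have h1 := mu_out (G := G) (δ := δ) (st := Function.update st b 1) hα (x := a)
        (by simp [hab, ha]) two_ne_zero (by decide)
      have h2 := mu_decide (G := G) (st := Function.update (Function.update st b 1) a 2) hα hδ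
        (x := v) (by simp [eva, evb, hv0]) two_ne_zero ⟨b, by simp [hab.symm], hvb⟩
      linarith
    · have h1 := mu_decide (G := G) (st := Function.update st b 1) hα hδ (x := v)
        (by simp [evb, hv0]) one_ne_zero ⟨b, by simp, hvb⟩
      have h2 := mu_decide (G := G) (st := Function.update (Function.update st b 1) v 1) hα hδ
        (x := a) (by simp [eva.symm, hab, ha]) two_ne_zero ⟨v, by simp, hva.symm⟩
      linarith

theorem goodStep_dom_undom {x v : V} (hα : 0 ≤ α) (hδ : 0 ≤ δ) (hx : st x = 0)
    (hd : Dom G st x) (hv0 : st v ≠ 0) (hv : Undom G st v) (hxv : G.Adj x v) :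
    GoodStep G α δ st [Function.update st x 2, Function.update st x 1] where
  ext := by simp [Ext.base, hx]
  length := by simp
  count M hM hA := countP_drop_take hx hA
  drop := .inr (.inr ⟨[1, 1 + α], by simp [branchingVectors],
    .cons (mu_decide hα hδ hx two_ne_zero hd)
      (.cons (mu_take_of_dom_undom hα hδ hx hd hv0 hv.1 hv.2 hxv) .nil)⟩)

theorem goodStep_not_linked {x s t : V} (hα : 0 ≤ α) (hδ : 0 ≤ δ) (hx : st x = 0)
    (hs : st s = 1) (ht : st t = 1) (hxs : G.Adj x s) (hxt : G.Adj x t)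
    (hst : ¬ Linked G (solSet st) s t) :
    GoodStep G α δ st [Function.update st x 2, Function.update st x 1] where
  ext := by simp [Ext.base, hx]
  length := by simp
  count M hM hA := countP_drop_take hx hA
  drop := .inr (.inr ⟨[1, 1 + δ], by simp [branchingVectors],
    .cons (mu_decide hα hδ hx two_ne_zero ⟨s, hs, hxs⟩)
      (.cons (mu_take_of_not_linked hα hδ hx hs ht hxs hxt hst) .nil)⟩)

/-- Without undecided neighbours, `x` is of no use to a minimal set. -/
theorem goodStep_simple_zero {x : V} (hα : 0 ≤ α) (hδ : 0 ≤ δ) (hx : IsSimple G st x)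
    (hN : FreeNbrs G st x fun _ => False) : GoodStep G α δ st [Function.update st x 2] where
  ext := by simp [Ext.base, hx.1]
  length := by simp
  count M hM hA := by
    have hxM : x ∉ M := fun hxM => by
      obtain ⟨y, hy, hxy, -⟩ := hx.exists_use hM hA hxM
      exact hN y hy hxy
    simp [accept_drop, hx.1, hA, hxM]
  drop := by
    refine .inr (.inl ⟨_, rfl, ?_⟩)
    have := mu_decide hα hδ hx.1 two_ne_zero hx.2.1
    linarith

/-- As `y` is dominated already, `x` can only serve as a link to `y`. The true gain of the second
case is 2. -/
theorem goodStep_simple_dom {x y : V} (hα : 0 ≤ α) (hδ : 0 ≤ δ) (hδ' : δ ≤ 1 / 5)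
    (hx : IsSimple G st x) (hy : st y = 0) (hxy : G.Adj x y) (hdy : Dom G st y)
    (hN : FreeNbrs G st x fun u => u = y) :
    GoodStep G α δ st
      [Function.update st x 2, Function.update (Function.update st x 1) y 1] where
  ext := by simp (maxDischargeDepth := 9) [Ext.base, Ext.update, hx.1, hy]
  length := by simp
  count M hM hA := by
    by_cases hxM : x ∈ M
    · have hyM : y ∈ M := by
        obtain ⟨y', hy', hxy', h⟩ := hx.exists_use hM hA hxM
        obtain rfl := hN y' hy' hxy'
        exact h.resolve_right fun h => h.2.1 hdy
      simp [accept_take, accept_drop, hx.1, hy, hxy.ne', hA, hxM, hyM, List.countP_cons]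
    · simp [accept_take, accept_drop, hx.1, hy, hxy.ne', hA, hxM, List.countP_cons]
  drop := by
    refine .inr (.inr ⟨[1, 1 + δ], by simp [branchingVectors],
      .cons (mu_decide hα hδ hx.1 two_ne_zero hx.2.1) (.cons ?_ .nil)⟩)
    have := mu_decide_two hα hδ hx.1 hx.2.1 hy hxy one_ne_zero
    linarith

/-- If `x` is used and `y` is not, then `y` is private to `x` and its other undecided neighbours go,
`w` among them. The third case gains `2 + (1 - α)`, more than is claimed. -/
theorem goodStep_simple_undom {x y w : V} (hα : 0 ≤ α) (hα' : α ≤ 1 / 5) (hδ : 0 ≤ δ)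
    (hx : IsSimple G st x) (hy : st y = 0) (hxy : G.Adj x y) (huy : Undom G st y)
    (hN : FreeNbrs G st x fun u => u = y)
    (hw : st w = 0) (hyw : G.Adj y w) (hwx : w ≠ x) :
    GoodStep G α δ st
      [Function.update st x 2, Function.update (Function.update st x 1) y 1,
       clearNbrs G y (Function.update (Function.update st x 1) y 2)] where
  ext := by simp (maxDischargeDepth := 9) [Ext.base, Ext.update, Ext.clearNbrs, hx.1, hy]
  length := by simp
  count M hM hA := by
    have hx0 := hx.1
    have exy := hxy.ne'
    by_cases hxM : x ∈ M
    · by_cases hyM : y ∈ M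
      · simp [accept_take, accept_drop, accept_clearNbrs, hx0, hy, exy, hA, hxM, hyM,
          List.countP_cons]
      · have hp : ∀ w ∈ M, G.Adj y w → w = x := by
          obtain ⟨y', hy', hxy', h⟩ := hx.exists_use hM hA hxM
          obtain rfl := hN y' hy' hxy'
          exact (h.resolve_left hyM).2.2
        have e3 : Accept (clearNbrs G y (Function.update (Function.update st x 1) y 2)) M := by
          rw [accept_clearNbrs_iff (x := x)]
          · exact hp
          · simp [accept_take, accept_drop, hx0, hy, exy, hA, hxM, hyM]
          · intro u hu hyu
            have := huy.eq_zero hA hu hyu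
            have : u ≠ y := hyu.ne'
            by_cases hux : u = x
            · simp [hux, exy.symm]
            · simp [*]
        simp [accept_take, accept_drop, hx0, hy, exy, hA, hxM, hyM, List.countP_cons, e3]
    · simp [accept_take, accept_drop, accept_clearNbrs, hx0, hy, exy, hA, hxM, List.countP_cons]
  drop := by
    refine .inr (.inr ⟨[1, 2, 2 + α], by simp [branchingVectors],
      .cons (mu_decide hα hδ hx.1 two_ne_zero hx.2.1)
        (.cons (mu_decide_two hα hδ hx.1 hx.2.1 hy hxy one_ne_zero) (.cons ?_ .nil))⟩)
    have h1 := mu_decide_two hα hδ hx.1 hx.2.1 hy hxy two_ne_zero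
    have h2 := mu_clearNbrs_one (G := G) (δ := δ)
      (st := Function.update (Function.update st x 1) y 2) hα (by linarith)
      (w := w) (by simp [hyw.ne', hwx, hw]) hyw
    linarith

/-- Neither neighbour can be private to `x`, so one of them is used together with `x`. The last case
really gains 3. -/
theorem goodStep_simple_dom_dom {x y z : V} (hα : 0 ≤ α) (hδ : 0 ≤ δ) (hδ' : δ ≤ 1 / 5)
    (hx : IsSimple G st x) (hy : st y = 0) (hz : st z = 0) (hyz : y ≠ z) (hxy : G.Adj x y)
    (hxz : G.Adj x z) (hdy : Dom G st y) (hdz : Dom G st z)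
    (hN : FreeNbrs G st x fun u => u = y ∨ u = z) :
    GoodStep G α δ st
      [Function.update st x 2, Function.update (Function.update st x 1) y 1,
       Function.update (Function.update (Function.update st x 1) y 2) z 1] where
  ext := by simp (maxDischargeDepth := 9) [Ext.base, Ext.update, hx.1, hy, hz]
  length := by simp
  count M hM hA := by
    have hx0 := hx.1
    have exy := hxy.ne'
    have exz := hxz.ne'
    by_cases hxM : x ∈ M
    · have hyzM : y ∈ M ∨ z ∈ M := by
        obtain ⟨y', hy', hxy', h⟩ := hx.exists_use hM hA hxM
        rcases hN y' hy' hxy' with rfl | rfl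
        · exact .inl (h.resolve_right fun h => h.2.1 hdy)
        · exact .inr (h.resolve_right fun h => h.2.1 hdz)
      by_cases hyM : y ∈ M
      · simp [accept_take, accept_drop, hx0, hy, hz, exy, exz, hyz.symm, hA, hxM, hyM,
          List.countP_cons]
      · simp [accept_take, accept_drop, hx0, hy, hz, exy, exz, hyz.symm, hA, hxM, hyM,
          hyzM.resolve_left hyM, List.countP_cons]
    · simp [accept_take, accept_drop, hx0, hy, hz, exy, exz, hyz.symm, hA, hxM, List.countP_cons]
  drop := by
    refine .inr (.inr ⟨[1, 2, 2 + δ], by simp [branchingVectors],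
      .cons (mu_decide hα hδ hx.1 two_ne_zero hx.2.1)
        (.cons (mu_decide_two hα hδ hx.1 hx.2.1 hy hxy one_ne_zero) (.cons ?_ .nil))⟩)
    have := mu_decide_three hα hδ hx.1 hx.2.1 hy hz hyz hxy hxz two_ne_zero one_ne_zero
    linarith

/-- If neither `y` nor `z` is used, only `z` can be private to `x`, because `y` is dominated.
Clearing around `z` then removes `w`. -/
theorem goodStep_simple_dom_undom {x y z w : V} (hα : 0 ≤ α) (hα' : α ≤ 1 / 5) (hδ : 0 ≤ δ)
    (hx : IsSimple G st x) (hy : st y = 0) (hz : st z = 0) (hyz : y ≠ z) (hxy : G.Adj x y)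
    (hxz : G.Adj x z) (hdy : Dom G st y) (huz : Undom G st z)
    (hN : FreeNbrs G st x fun u => u = y ∨ u = z)
    (hw : st w = 0) (hzw : G.Adj z w) (hwx : w ≠ x) (hwy : w ≠ y) :
    GoodStep G α δ st
      [Function.update st x 2, Function.update (Function.update st x 1) y 1,
       Function.update (Function.update (Function.update st x 1) y 2) z 1,
       clearNbrs G z (Function.update (Function.update (Function.update st x 1) y 2) z 2)] where
  ext := by simp (maxDischargeDepth := 9) [Ext.base, Ext.update, Ext.clearNbrs, hx.1, hy, hz]
  length := by simp
  count M hM hA := by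
    have hx0 := hx.1
    have exy := hxy.ne'
    have exz := hxz.ne'
    have eyz := hyz.symm
    by_cases hxM : x ∈ M
    · by_cases hyM : y ∈ M
      · simp [accept_take, accept_drop, accept_clearNbrs, hx0, hy, hz, exy, exz, eyz, hA, hxM, hyM,
          List.countP_cons]
      by_cases hzM : z ∈ M
      · simp [accept_take, accept_drop, accept_clearNbrs, hx0, hy, hz, exy, exz, eyz, hA, hxM, hyM,
          hzM, List.countP_cons]
      have hp : ∀ w ∈ M, G.Adj z w → w = x := by
        obtain ⟨y', hy', hxy', h⟩ := hx.exists_use hM hA hxM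
        rcases hN y' hy' hxy' with rfl | rfl
        · exact absurd hdy (h.resolve_left hyM).2.1
        · exact (h.resolve_left hzM).2.2
      have e4 : Accept (clearNbrs G z
          (Function.update (Function.update (Function.update st x 1) y 2) z 2)) M := by
        rw [accept_clearNbrs_iff (x := x)]
        · exact hp
        · simp [accept_take, accept_drop, hx0, hy, hz, exy, exz, eyz, hA, hxM, hyM, hzM]
        · intro u hu hzu
          have := huz.eq_zero hA hu hzu
          have h1 : u ≠ y := by rintro rfl; exact hyM hu
          have h2 : u ≠ z := by rintro rfl; exact hzM hu
          by_cases hux : u = x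
          · simp [hux, exy.symm, exz.symm]
          · simp [*]
      simp [accept_take, accept_drop, hx0, hy, hz, exy, exz, eyz, hA, hxM, hyM,
        hzM, List.countP_cons, e4]
    · simp [accept_take, accept_drop, accept_clearNbrs, hx0, hy, hz, exy, exz, eyz, hA, hxM,
        List.countP_cons]
  drop := by
    refine .inr (.inr ⟨[1, 2, 3, 4 - α], by simp [branchingVectors],
      .cons (mu_decide hα hδ hx.1 two_ne_zero hx.2.1)
        (.cons (mu_decide_two hα hδ hx.1 hx.2.1 hy hxy one_ne_zero)
          (.cons (mu_decide_three hα hδ hx.1 hx.2.1 hy hz hyz hxy hxz two_ne_zero one_ne_zero)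
            (.cons ?_ .nil)))⟩)
    have h1 := mu_decide_three hα hδ hx.1 hx.2.1 hy hz hyz hxy hxz two_ne_zero two_ne_zero
    have h2 := mu_clearNbrs_one (G := G) (δ := δ)
      (st := Function.update (Function.update (Function.update st x 1) y 2) z 2) hα (by linarith)
      (w := w) (by simp [hzw.ne', hwx, hwy, hw]) hzw
    linarith

/-- Whichever of `y`, `z` is private to `x` in the last case, the common neighbour `w` is excluded.
-/
theorem goodStep_simple_common {x y z w : V} (hα : 0 ≤ α) (hδ : 0 ≤ δ)
    (hx : IsSimple G st x) (hy : st y = 0) (hz : st z = 0) (hyz : y ≠ z) (hxy : G.Adj x y)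
    (hxz : G.Adj x z)
    (hN : FreeNbrs G st x fun u => u = y ∨ u = z)
    (hw : st w = 0) (hyw : G.Adj y w) (hwx : w ≠ x)
    (hzw : G.Adj z w) :
    GoodStep G α δ st
      [Function.update st x 2, Function.update (Function.update st x 1) y 1,
       Function.update (Function.update (Function.update st x 1) y 2) z 1,
       Function.update (Function.update (Function.update (Function.update st x 1) y 2) z 2) w 2]
      where
  ext := by simp (maxDischargeDepth := 9) [Ext.base, Ext.update, hx.1, hy, hz, hw]
  length := by simp
  count M hM hA := by
    have hx0 := hx.1
    have exy := hxy.ne'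
    have exz := hxz.ne'
    have eyz := hyz.symm
    have eyw := hyw.ne'
    have ezw := hzw.ne'
    by_cases hxM : x ∈ M
    · by_cases hyM : y ∈ M
      · simp [accept_take, accept_drop, hx0, hy, hz, hw, exy, exz, eyz, eyw, ezw, hwx, hA, hxM, hyM,
          List.countP_cons]
      by_cases hzM : z ∈ M
      · simp [accept_take, accept_drop, hx0, hy, hz, hw, exy, exz, eyz, eyw, ezw, hwx, hA, hxM, hyM,
          hzM, List.countP_cons]
      have hwM : w ∉ M := fun hwM => by
        rcases hx.private_or hN hM hA hxM hyM hzM with h | h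
        · exact hwx (h w hwM hyw)
        · exact hwx (h w hwM hzw)
      simp [accept_take, accept_drop, hx0, hy, hz, hw, exy, exz, eyz, eyw, ezw, hwx, hA, hxM, hyM,
        hzM, hwM, List.countP_cons]
    · simp [accept_take, accept_drop, hx0, hy, hz, hw, exy, exz, eyz, eyw, ezw, hwx, hA, hxM,
        List.countP_cons]
  drop := by
    refine .inr (.inr ⟨[1, 2, 3, 4 - α], by simp [branchingVectors],
      .cons (mu_decide hα hδ hx.1 two_ne_zero hx.2.1)
        (.cons (mu_decide_two hα hδ hx.1 hx.2.1 hy hxy one_ne_zero)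
          (.cons (mu_decide_three hα hδ hx.1 hx.2.1 hy hz hyz hxy hxz two_ne_zero one_ne_zero)
            (.cons ?_ .nil)))⟩)
    have h1 := mu_decide_three hα hδ hx.1 hx.2.1 hy hz hyz hxy hxz two_ne_zero two_ne_zero
    have h2 := mu_out (G := G) (δ := δ)
      (st := Function.update (Function.update (Function.update st x 1) y 2) z 2) hα
      (x := w) (by simp [hzw.ne', hyw.ne', hwx, hw]) two_ne_zero (by decide)
    linarith

/-- When `y` and `z` are unused, branch on `w`. If `w` is used, `y` is not private to `x`, so `z`
is, and its other undecided neighbours go. Taking `w` gains only `1 - δ`, as it may open a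
component, and the loss of `t` gains `1 - α`. -/
theorem goodStep_simple_single {x y z w t : V} (hα : 0 ≤ α) (hα' : α ≤ 1 / 5) (hδ : 0 ≤ δ)
    (hx : IsSimple G st x) (hy : st y = 0) (hz : st z = 0) (hyz : y ≠ z) (hxy : G.Adj x y)
    (hxz : G.Adj x z) (huz : Undom G st z)
    (hN : FreeNbrs G st x fun u => u = y ∨ u = z)
    (hw : st w = 0) (hyw : G.Adj y w) (hwx : w ≠ x) (hwz : w ≠ z)
    (hzw : ¬ G.Adj z w)
    (ht : st t = 0) (hzt : G.Adj z t) (htx : t ≠ x) (hty : t ≠ y) :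
    GoodStep G α δ st
      [Function.update st x 2, Function.update (Function.update st x 1) y 1,
       Function.update (Function.update (Function.update st x 1) y 2) z 1,
       Function.update (Function.update (Function.update (Function.update st x 1) y 2) z 2) w 2,
       clearNbrs G z (Function.update
        (Function.update (Function.update (Function.update st x 1) y 2) z 2) w 1)] where
  ext := by simp (maxDischargeDepth := 9) [Ext.base, Ext.update, Ext.clearNbrs, hx.1, hy, hz, hw]
  length := by simp
  count M hM hA := by
    have hx0 := hx.1
    have exy := hxy.ne'
    have exz := hxz.ne'
    have eyz := hyz.symm
    have eyw := hyw.ne'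
    by_cases hxM : x ∈ M
    · by_cases hyM : y ∈ M
      · simp [accept_take, accept_drop, accept_clearNbrs, hx0, hy, hz, hw, exy, exz, eyz, eyw, hwz,
          hwx, hA, hxM, hyM, List.countP_cons]
      by_cases hzM : z ∈ M
      · simp [accept_take, accept_drop, accept_clearNbrs, hx0, hy, hz, hw, exy, exz, eyz, eyw, hwz,
          hwx, hA, hxM, hyM, hzM, List.countP_cons]
      by_cases hwM : w ∈ M
      · have hp : ∀ w ∈ M, G.Adj z w → w = x :=
          (hx.private_or hN hM hA hxM hyM hzM).resolve_left fun h => hwx (h w hwM hyw)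
        have e5 : Accept (clearNbrs G z (Function.update
            (Function.update (Function.update (Function.update st x 1) y 2) z 2) w 1)) M := by
          rw [accept_clearNbrs_iff (x := x)]
          · exact hp
          · simp [accept_take, accept_drop, hx0, hy, hz, hw, exy, exz, eyz, eyw, hwz,
              hwx, hA, hxM, hyM, hzM, hwM]
          · intro u hu hzu
            have := huz.eq_zero hA hu hzu
            have h1 : u ≠ y := by rintro rfl; exact hyM hu
            have h2 : u ≠ z := by rintro rfl; exact hzM hu
            have h3 : u ≠ w := by rintro rfl; exact hzw hzu
            by_cases hux : u = x
            · simp [hux, exy.symm, exz.symm, hwx.symm]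
            · simp [*]
        simp [accept_take, accept_drop, hx0, hy, hz, hw, exy, exz, eyz, eyw, hwz,
          hwx, hA, hxM, hyM, hzM, hwM, List.countP_cons, e5]
      · simp [accept_take, accept_drop, accept_clearNbrs, hx0, hy, hz, hw, exy, exz, eyz, eyw, hwz,
          hwx, hA, hxM, hyM, hzM, hwM, List.countP_cons]
    · simp [accept_take, accept_drop, accept_clearNbrs, hx0, hy, hz, hw, exy, exz, eyz, eyw, hwz,
        hwx, hA, hxM, List.countP_cons]
  drop := by
    refine .inr (.inr ⟨[1, 2, 3, 4 - α, 5 - δ - α], by simp [branchingVectors],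
      .cons (mu_decide hα hδ hx.1 two_ne_zero hx.2.1)
        (.cons (mu_decide_two hα hδ hx.1 hx.2.1 hy hxy one_ne_zero)
          (.cons (mu_decide_three hα hδ hx.1 hx.2.1 hy hz hyz hxy hxz two_ne_zero one_ne_zero)
            (.cons ?_ (.cons ?_ .nil))))⟩)
    all_goals
      have h1 := mu_decide_three hα hδ hx.1 hx.2.1 hy hz hyz hxy hxz two_ne_zero two_ne_zero
    · have h2 := mu_out (G := G) (δ := δ)
        (st := Function.update (Function.update (Function.update st x 1) y 2) z 2) hα
        (x := w) (by simp [hwz, hyw.ne', hwx, hw]) two_ne_zero (by decide)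
      linarith
    · have h2 := mu_take (G := G)
        (st := Function.update (Function.update (Function.update st x 1) y 2) z 2) hα hδ
        (x := w) (by simp [hwz, hyw.ne', hwx, hw])
      have htw : t ≠ w := by rintro rfl; exact hzw hzt
      have h3 := mu_clearNbrs_one (G := G) (δ := δ)
        (st := Function.update
          (Function.update (Function.update (Function.update st x 1) y 2) z 2) w 1)
        hα (by linarith) (w := t) (by simp [htw, hzt.ne', htx, hty, ht]) hzt
      linarith

end GoodStep

/-! ## First-order conditions -/

/-- First-order formulas about a state.  Variables are de Bruijn levels: a quantifier at depth `d`
binds the variable `d`. -/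
inductive Fml : Type
  | adj (i j : ℕ)
  | st (i c : ℕ)
  | eq (i j : ℕ)
  | conn (i j : ℕ)
  | connAvoid (k i j : ℕ)
  | neg (φ : Fml)
  | and (φ ψ : Fml)
  | ex (φ : Fml)

namespace Fml

variable {V : Type u}

/-- Truth of a formula at depth `d`; `conn` and `connAvoid` ask for a connection inside the
solution, the latter avoiding a vertex. -/
def Holds (G : SimpleGraph V) (s : State V) : Fml → ℕ → (ℕ → V) → Prop
  | adj i j, _, env => G.Adj (env i) (env j)
  | st i c, _, env => s (env i) = c
  | eq i j, _, env => env i = env j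
  | conn i j, _, env => Linked G (solSet s) (env i) (env j)
  | connAvoid k i j, _, env => Linked G (solSet s \ {env k}) (env i) (env j)
  | neg φ, d, env => ¬ φ.Holds G s d env
  | and φ ψ, d, env => φ.Holds G s d env ∧ ψ.Holds G s d env
  | ex φ, d, env => ∃ v, φ.Holds G s (d + 1) (Function.update env d v)

/-- The variables of a formula at depth `d` are in scope. -/
def Scoped : Fml → ℕ → Prop
  | adj i j, d => i < d ∧ j < d
  | st i _, d => i < d
  | eq i j, d => i < d ∧ j < d
  | conn i j, d => i < d ∧ j < d
  | connAvoid k i j, d => k < d ∧ i < d ∧ j < d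
  | neg φ, d => φ.Scoped d
  | and φ ψ, d => φ.Scoped d ∧ ψ.Scoped d
  | ex φ, d => φ.Scoped (d + 1)

def or (φ ψ : Fml) : Fml := neg (and (neg φ) (neg ψ))

/-- Conjunction of a list of formulas. -/
def conj : List Fml → Fml
  -- This stands for truth; it requires the variable `0` to be in scope.
  | [] => eq 0 0
  | φ :: l => and φ (conj l)

/-- Here and below, `d` is the depth at which the formula is used, and so the number of the first
variable that it binds. -/
def dom (d i : ℕ) : Fml := ex (and (st d 1) (adj i d))

def undom (d i : ℕ) : Fml := and (neg (st i 1)) (neg (dom d i))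

def freeNbrs (d i : ℕ) (φ : Fml) : Fml := neg (ex (and (st d 0) (and (adj i d) (neg φ))))

def simple (d i : ℕ) : Fml :=
  conj [st i 0, dom d i,
    neg (ex (conj [adj i d, neg (st d 0), undom (d + 1) d])),
    neg (ex (ex (conj [st d 1, st (d + 1) 1, adj i d, adj i (d + 1), neg (conn d (d + 1))])))]

variable {G : SimpleGraph V} {s : State V} {d i j : ℕ} {env : ℕ → V}

theorem holds_or {φ ψ : Fml} :
    (or φ ψ).Holds G s d env ↔ φ.Holds G s d env ∨ ψ.Holds G s d env := by
  simp only [or, Holds]; tauto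

theorem holds_dom (hi : i < d) : (dom d i).Holds G s d env ↔ Dom G s (env i) := by
  simp [dom, Holds, Dom, hi.ne]

theorem holds_undom (hi : i < d) : (undom d i).Holds G s d env ↔ Undom G s (env i) := by
  simp [undom, Holds, holds_dom hi, Undom]

theorem holds_freeNbrs (hi : i < d) {φ : Fml} : (freeNbrs d i φ).Holds G s d env ↔
    FreeNbrs G s (env i) fun u => φ.Holds G s (d + 1) (Function.update env d u) := by
  simp [freeNbrs, Holds, FreeNbrs, hi.ne]

theorem holds_simple (hi : i < d) :
    (simple d i).Holds G s d env ↔ IsSimple G s (env i) := by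
  have h1 : i ≠ d + 1 := by omega
  simp [simple, conj, Holds, IsSimple, holds_dom hi, holds_undom, hi.ne, h1]
  exact fun _ _ _ => ⟨fun h a b ha hb => h a ha b hb, fun h a ha b hb => h a b ha hb⟩

end Fml

/-! ## The branching rules -/

/-- Decisions of a branching rule: put a vertex into the solution, discard it, or discard all its
undecided neighbours. -/
inductive Op : Type
  | take (i : ℕ)
  | drop (i : ℕ)
  | clear (i : ℕ)

/-- The effect of a decision, where `env` assigns vertices to the variables. -/
noncomputable def Op.apply {V : Type u} [DecidableEq V] (G : SimpleGraph V) (env : ℕ → V)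
    (st : State V) : Op → State V
  | take i => Function.update st (env i) 1
  | drop i => Function.update st (env i) 2
  | clear i => clearNbrs G (env i) st

/-- The effect of a list of decisions. -/
noncomputable def applyOps {V : Type u} [DecidableEq V] (G : SimpleGraph V) (env : ℕ → V)
    (st : State V) (ops : List Op) : State V :=
  ops.foldl (Op.apply G env) st

open Fml Op in
/-- The branching rules: a condition on the variables `0`, `1`, `2`, `3`, and the cases. -/
def rules : List (Fml × List (List Op)) :=
  -- Variable `0` is the undominated vertex in the first four rules and the vertex `x` next to the
  -- solution in the others; variable `4` is bound by a quantifier, and `neg (eq 0 0)` is falsity.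
  -- The cases are listed in the form and order of decisions that the measure estimates use.
  [(conj [undom 4 0, freeNbrs 4 0 (neg (eq 0 0))], []),
   (conj [undom 4 0, st 1 0, freeNbrs 4 0 (eq 4 1)], [[take 1]]),
   (conj [neg (st 0 0), undom 4 0, st 1 0, st 2 0, neg (eq 1 2), adj 0 1, adj 0 2,
      freeNbrs 4 0 (or (eq 4 1) (eq 4 2))], [[take 1], [take 2, drop 1]]),
   (conj [st 0 0, undom 4 0, st 1 0, st 2 0, neg (eq 1 2), adj 0 1, adj 0 2,
      freeNbrs 4 0 (or (eq 4 1) (eq 4 2))],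
    [[take 1, take 0], [take 2, drop 1, drop 0], [take 1, drop 0], [take 2, take 0, drop 1]]),
   (conj [st 0 0, dom 4 0, neg (st 1 0), undom 4 1, adj 0 1], [[drop 0], [take 0]]),
   (conj [st 0 0, st 1 1, st 2 1, adj 0 1, adj 0 2, neg (conn 1 2)], [[drop 0], [take 0]]),
   (conj [simple 4 0, freeNbrs 4 0 (neg (eq 0 0))], [[drop 0]]),
   (conj [simple 4 0, st 1 0, adj 0 1, dom 4 1, freeNbrs 4 0 (eq 4 1)],
    [[drop 0], [take 0, take 1]]),
   (conj [simple 4 0, st 1 0, adj 0 1, undom 4 1, freeNbrs 4 0 (eq 4 1),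
      st 3 0, adj 1 3, neg (eq 3 0)],
    [[drop 0], [take 0, take 1], [take 0, drop 1, clear 1]]),
   (conj [simple 4 0, st 1 0, st 2 0, neg (eq 1 2), adj 0 1, adj 0 2, dom 4 1, dom 4 2,
      freeNbrs 4 0 (or (eq 4 1) (eq 4 2))],
    [[drop 0], [take 0, take 1], [take 0, drop 1, take 2]]),
   (conj [simple 4 0, st 1 0, st 2 0, neg (eq 1 2), adj 0 1, adj 0 2, dom 4 1, undom 4 2,
      freeNbrs 4 0 (or (eq 4 1) (eq 4 2)),
      st 3 0, adj 2 3, neg (eq 3 0), neg (eq 3 1)],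
    [[drop 0], [take 0, take 1], [take 0, drop 1, take 2], [take 0, drop 1, drop 2, clear 2]]),
   (conj [simple 4 0, st 1 0, st 2 0, neg (eq 1 2), adj 0 1, adj 0 2,
      freeNbrs 4 0 (or (eq 4 1) (eq 4 2)),
      st 3 0, adj 1 3, neg (eq 3 0), adj 2 3],
    [[drop 0], [take 0, take 1], [take 0, drop 1, take 2], [take 0, drop 1, drop 2, drop 3]]),
   (conj [simple 4 0, st 1 0, st 2 0, neg (eq 1 2), adj 0 1, adj 0 2, undom 4 2,
      freeNbrs 4 0 (or (eq 4 1) (eq 4 2)),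
      st 3 0, adj 1 3, neg (eq 3 0), neg (eq 3 2), neg (adj 2 3),
      ex (conj [st 4 0, adj 2 4, neg (eq 4 0), neg (eq 4 1)])],
    [[drop 0], [take 0, take 1], [take 0, drop 1, take 2], [take 0, drop 1, drop 2, drop 3],
     [take 0, drop 1, drop 2, take 3, clear 2]])]

section Rules

variable {V : Type u} [Fintype V] [DecidableEq V] {G : SimpleGraph V} {st : State V} {α δ : ℝ}

/-- Every applicable rule is an exact case distinction that decreases the measure. -/
theorem goodStep_of_mem_rules (hα : 0 ≤ α) (hα' : α ≤ 1 / 5) (hδ : 0 ≤ δ) (hδ' : δ ≤ 1 / 5)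
    (hs : ∃ s, st s = 1) {env : ℕ → V} {ρ : Fml × List (List Op)} (hρ : ρ ∈ rules)
    (h : ρ.1.Holds G st 4 env) : GoodStep G α δ st (ρ.2.map (applyOps G env st)) := by
  simp only [rules, List.mem_cons, List.not_mem_nil, or_false] at hρ
  rcases hρ with rfl | rfl | rfl | rfl | rfl | rfl | rfl | rfl | rfl | rfl | rfl | rfl | rfl <;>
    simp [Fml.conj, Fml.Holds, Fml.holds_or, Fml.holds_dom, Fml.holds_undom,
      Fml.holds_freeNbrs, Fml.holds_simple] at h <;>
    simp only [List.map_cons, List.map_nil, applyOps, List.foldl_cons, List.foldl_nil, Op.apply]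
  · exact goodStep_undom_zero hs h.1 h.2
  · exact goodStep_undom_one hα hδ hδ' hs h.1 h.2.1 h.2.2
  · obtain ⟨h1, h2, h3, h4, h5, h6, h7, h8⟩ := h
    exact goodStep_discarded_two hα hδ hs h1 h2 h3 h4 h5 h6 h7 h8
  · obtain ⟨h1, h2, h3, h4, h5, h6, h7, h8⟩ := h
    exact goodStep_free_two hα hδ hs h1 h2 h3 h4 h5 h6 h7 h8
  · obtain ⟨h1, h2, h3, h4, h5⟩ := h
    exact goodStep_dom_undom hα hδ h1 h2 h3 h4 h5
  · obtain ⟨h1, h2, h3, h4, h5, h6⟩ := h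
    exact goodStep_not_linked hα hδ h1 h2 h3 h4 h5 h6
  · exact goodStep_simple_zero hα hδ h.1 h.2
  · obtain ⟨h1, h2, h3, h4, h5⟩ := h
    exact goodStep_simple_dom hα hδ hδ' h1 h2 h3 h4 h5
  · obtain ⟨h1, h2, h3, h4, h5, h6, h7, h8⟩ := h
    exact goodStep_simple_undom hα hα' hδ h1 h2 h3 h4 h5 h6 h7 h8
  · obtain ⟨h1, h2, h3, h4, h5, h6, h7, h8, h9⟩ := h
    exact goodStep_simple_dom_dom hα hδ hδ' h1 h2 h3 h4 h5 h6 h7 h8 h9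
  · obtain ⟨h1, h2, h3, h4, h5, h6, h7, h8, h9, h10, h11, h12, h13⟩ := h
    exact goodStep_simple_dom_undom hα hα' hδ h1 h2 h3 h4 h5 h6 h7 h8 h9 h10 h11 h12 h13
  · obtain ⟨h1, h2, h3, h4, h5, h6, h7, h8, h9, h10, h11⟩ := h
    exact goodStep_simple_common hα hδ h1 h2 h3 h4 h5 h6 h7 h8 h9 h10 h11
  · obtain ⟨h1, h2, h3, h4, h5, h6, h7, h8, h9, h10, h11, h12, h13, t, h14, h15, h16, h17⟩ := h
    exact goodStep_simple_single hα hα' hδ h1 h2 h3 h4 h5 h6 h7 h8 h9 h10 h11 h12 h13 h14 h15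
      h16 h17

/-- The assignment of the variables `0`, `1`, `2`, `3`. -/
def env4 {V : Type u} (x y z w : V) : ℕ → V := fun i =>
  if i = 0 then x else if i = 1 then y else if i = 2 then z else w

/-- In a 2-degenerate graph, some rule applies to every state with an undecided vertex. -/
theorem exists_rule (hG : IsDegenerate G 2) (hfree : ∃ v, st v = 0) :
    ∃ ρ ∈ rules, ∃ x y z w : V, ρ.1.Holds G st 4 (env4 x y z w) := by
  by_contra! hE
  simp [rules, Fml.conj, Fml.Holds, Fml.holds_or, Fml.holds_dom, Fml.holds_undom,
      Fml.holds_freeNbrs, Fml.holds_simple, env4] at hE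
  obtain ⟨r1, r2, r3, r4, r5, r6, r7, r8, r9, r10, r11, r12, r13⟩ := hE
  -- As the first four rules fail, an undominated vertex has at least three undecided neighbours,
  -- hence one that avoids any two given vertices.
  have three : ∀ v, Undom G st v → ∀ a b, ∃ c, st c = 0 ∧ G.Adj v c ∧ c ≠ a ∧ c ≠ b := by
    intro v hv a b
    by_contra! hc
    have one : ∀ a, (FreeNbrs G st v fun u => u = a) → False := fun a h => by
      by_cases ha : st a = 0
      · exact r2 v a v v hv ha h
      · exact r1 v v v v hv fun u hu huv => ha (h u hu huv ▸ hu)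
    have hN : FreeNbrs G st v fun u => u = a ∨ u = b := fun u hu huv => by
      by_cases h : u = a
      · exact .inl h
      · exact .inr (hc u hu huv h)
    by_cases ha : st a = 0 ∧ G.Adj v a
    · by_cases hb : st b = 0 ∧ G.Adj v b
      · by_cases hab : a = b
        · exact one b fun u hu huv => (hN u hu huv).elim (fun h => h.trans hab) id
        · by_cases hv0 : st v = 0
          · exact r4 v a b v hv0 hv ha.1 hb.1 hab ha.2 hb.2 hN
          · exact r3 v a b v hv0 hv ha.1 hb.1 hab ha.2 hb.2 hN
      · exact one a fun u hu huv => (hN u hu huv).elim id fun h => absurd ⟨h ▸ hu, h ▸ huv⟩ hb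
    · exact one b fun u hu huv => (hN u hu huv).elim (fun h => absurd ⟨h ▸ hu, h ▸ huv⟩ ha) id
  -- Undominated vertices belong to `W` even when discarded. Three undecided neighbours of `x` would
  -- lie in `W`, so the chosen `x` is not undominated.
  obtain ⟨x, hx, a, b, hab⟩ := hG.exists_le_two (W := {v | st v = 0 ∨ Undom G st v})
    (hfree.imp fun _ h => .inl h)
  have hxu : ¬ Undom G st x := fun h => by
    obtain ⟨c, hc, hxc, hca, hcb⟩ := three x h a b
    exact (hab c (.inl hc) hxc).elim hca hcb
  have hx0 : st x = 0 := hx.resolve_right hxu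
  have hdx : Dom G st x := by
    by_contra h
    exact hxu ⟨by omega, h⟩
  have hsx : IsSimple G st x := ⟨hx0, hdx, fun v hxv hv hu => r5 x v x x hx0 hdx hv hu hxv,
    fun s t hs ht hxs hxt => r6 x s t x hx0 hs ht hxs hxt⟩
  have hN : FreeNbrs G st x fun u => u = a ∨ u = b := fun u hu hxu => hab u (.inl hu) hxu
  have undom : ∀ v, st v = 0 → ¬ Dom G st v → Undom G st v := fun v hv h => ⟨by omega, h⟩
  -- A single undecided neighbour is handled by one of two rules; if it is undominated, `three`
  -- supplies its further neighbour `w`.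
  have one : ∀ y, st y = 0 → G.Adj x y → (FreeNbrs G st x fun u => u = y) →
      False := by
    intro y hy hxy hNy
    by_cases hdy : Dom G st y
    · exact r8 x y x x hsx hy hxy hdy hNy
    · obtain ⟨w, hw, hyw, hwx, -⟩ := three y (undom y hy hdy) x x
      exact hwx (r9 x y x w hsx hy hxy (undom y hy hdy) hNy hw hyw)
  by_cases ha : st a = 0 ∧ G.Adj x a
  · by_cases hb : st b = 0 ∧ G.Adj x b
    · by_cases e : a = b
      · exact one b hb.1 hb.2 fun u hu hxu => (hN u hu hxu).elim (fun h => h.trans e) id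
      · have hNba : FreeNbrs G st x fun u => u = b ∨ u = a :=
          fun u hu hxu => (hN u hu hxu).symm
        by_cases hda : Dom G st a
        · by_cases hdb : Dom G st b
          · exact r10 x a b x hsx ha.1 hb.1 e ha.2 hb.2 hda hdb hN
          · have hub := undom b hb.1 hdb
            obtain ⟨w, hw, hbw, hwx, hwa⟩ := three b hub x a
            exact hwa (r11 x a b w hsx ha.1 hb.1 e ha.2 hb.2 hda hub hN hw hbw hwx)
        · have hua := undom a ha.1 hda
          by_cases hdb : Dom G st b
          · obtain ⟨w, hw, haw, hwx, hwb⟩ := three a hua x b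
            exact hwb (r11 x b a w hsx hb.1 ha.1 (Ne.symm e) hb.2 ha.2 hdb hua hNba hw haw hwx)
          -- Both neighbours are undominated. A further neighbour `w` of `a` is not adjacent to `b`,
          -- or the rule for common neighbours would apply; so the last rule applies, with `t` next
          -- to `b`.
          · have hub := undom b hb.1 hdb
            obtain ⟨w, hw, haw, hwx, hwb⟩ := three a hua x b
            obtain ⟨t, ht, hbt, htx, hta⟩ := three b hub x a
            exact hta (r13 x a b w hsx ha.1 hb.1 e ha.2 hb.2 hub hN hw haw hwx hwb
              (r12 x a b w hsx ha.1 hb.1 e ha.2 hb.2 hN hw haw hwx) t ht hbt htx)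
    · exact one a ha.1 ha.2 fun u hu hxu => (hN u hu hxu).elim id
        fun h => absurd ⟨h ▸ hu, h ▸ hxu⟩ hb
  · by_cases hb : st b = 0 ∧ G.Adj x b
    · exact one b hb.1 hb.2 fun u hu hxu => (hN u hu hxu).elim
        (fun h => absurd ⟨h ▸ hu, h ▸ hxu⟩ ha) id
    · refine r7 x x x x hsx fun u hu hxu => ?_
      rcases hN u hu hxu with rfl | rfl
      exacts [ha ⟨hu, hxu⟩, hb ⟨hu, hxu⟩]

end Rules

/-! ## The branching numbers -/

/-- A number slightly below `1.9767` that is not smaller than any of the branching numbers. -/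
noncomputable def rate : ℝ := 1.97669

theorem rate_pos : 0 < rate := by norm_num [rate]

theorem one_lt_rate : 1 < rate := by norm_num [rate]

set_option exponentiation.threshold 1000 in
-- As `0.106 = 53 / 500`, raising to the power 500 leaves a comparison of rational numbers. The
-- upper bound serves the exponents reduced by `α` or `δ`, the lower bound below those increased by
-- them.
theorem rate_rpow_le : rate ^ (0.106 : ℝ) ≤ 1.0749036 := by
  have h : rate ^ (0.106 : ℝ) = (rate ^ 53) ^ ((500 : ℕ) : ℝ)⁻¹ := by
    rw [← Real.rpow_natCast rate, ← Real.rpow_mul rate_pos.le]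
    norm_num
  rw [h, Real.rpow_inv_le_iff_of_pos (by positivity [rate_pos]) (by norm_num) (by norm_num),
    Real.rpow_natCast]
  norm_num [rate]

set_option exponentiation.threshold 1000 in
theorem le_rate_rpow : 1.0749 ≤ rate ^ (0.106 : ℝ) := by
  have h : rate ^ (0.106 : ℝ) = (rate ^ 53) ^ ((500 : ℕ) : ℝ)⁻¹ := by
    rw [← Real.rpow_natCast rate, ← Real.rpow_mul rate_pos.le]
    norm_num
  rw [h, Real.le_rpow_inv_iff_of_pos (by norm_num) (by positivity [rate_pos]) (by norm_num),
    Real.rpow_natCast]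
  norm_num [rate]

theorem rate_rpow_neg_le {a : ℝ} (k m : ℕ) (h : a = k - m * 0.106) :
    rate ^ (-a) ≤ 1.0749036 ^ m / 1.97669 ^ k := by
  rw [h, show -((k : ℝ) - m * 0.106) = 0.106 * m - k by ring, Real.rpow_sub rate_pos,
    Real.rpow_mul rate_pos.le, Real.rpow_natCast, Real.rpow_natCast]
  exact div_le_div_of_nonneg_right (pow_le_pow_left₀ (Real.rpow_nonneg rate_pos.le _)
    rate_rpow_le m) (pow_nonneg rate_pos.le k)

theorem rate_rpow_neg_le_of_add {a : ℝ} (k : ℕ) (h : a = k + 0.106) :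
    rate ^ (-a) ≤ 1 / (1.97669 ^ k * 1.0749) := by
  rw [h, Real.rpow_neg rate_pos.le, Real.rpow_add rate_pos, Real.rpow_natCast, ← one_div]
  exact one_div_le_one_div_of_le (by norm_num)
    (mul_le_mul_of_nonneg_left le_rate_rpow (pow_nonneg rate_pos.le k))

/-- The critical vectors are `(1, 2, 2 + α)` and `(1, 2, 3, 4 - α, 5 - δ - α)`, whose sums exceed
0.9999. A larger `α` helps the first and harms the second, which explains the choice of 0.106. -/
theorem sum_rate_le_one {r : List ℝ} (hr : r ∈ branchingVectors 0.106 0.106) :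
    (r.map fun a => rate ^ (-a)).sum ≤ 1 := by
  have e1 := rate_rpow_neg_le (a := 1) 1 0 (by norm_num)
  have e1' := rate_rpow_neg_le (a := 1 + 0.106 - 0.106) 1 0 (by norm_num)
  have e2 := rate_rpow_neg_le (a := 2) 2 0 (by norm_num)
  have e3 := rate_rpow_neg_le (a := 3) 3 0 (by norm_num)
  have f1 := rate_rpow_neg_le_of_add (a := 1 + 0.106) 1 (by norm_num)
  have f2 := rate_rpow_neg_le_of_add (a := 2 + 0.106) 2 (by norm_num)
  have g2 := rate_rpow_neg_le (a := 2 - 0.106) 2 1 (by norm_num)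
  have g3 := rate_rpow_neg_le (a := 3 - 0.106) 3 1 (by norm_num)
  have g4 := rate_rpow_neg_le (a := 4 - 0.106) 4 1 (by norm_num)
  have k3 := rate_rpow_neg_le (a := 3 - 0.106 - 0.106) 3 2 (by norm_num)
  have k4 := rate_rpow_neg_le (a := 4 - 2 * 0.106) 4 2 (by norm_num)
  have k5 := rate_rpow_neg_le (a := 5 - 0.106 - 0.106) 5 2 (by norm_num)
  have k5' := rate_rpow_neg_le (a := 5 - 2 * 0.106) 5 2 (by norm_num)
  simp only [branchingVectors, List.mem_cons, List.not_mem_nil, or_false] at hr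
  rcases hr with rfl | rfl | rfl | rfl | rfl | rfl | rfl | rfl | rfl | rfl <;>
    simp only [List.map_cons, List.map_nil, List.sum_cons, List.sum_nil]
  · exact (add_le_add e1 (add_le_add f1 le_rfl)).trans (by norm_num)
  · exact (add_le_add e1 (add_le_add f1 le_rfl)).trans (by norm_num)
  · exact (add_le_add e1 (add_le_add e2 (add_le_add f2 le_rfl))).trans (by norm_num)
  · exact (add_le_add e1 (add_le_add e2 (add_le_add f2 le_rfl))).trans (by norm_num)
  · exact (add_le_add g2 (add_le_add k3 (add_le_add g2 (add_le_add g3 le_rfl)))).trans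
      (by norm_num)
  · exact (add_le_add e1' (add_le_add g2 le_rfl)).trans (by norm_num)
  · exact (add_le_add e1 (add_le_add k4 (add_le_add e2 le_rfl))).trans (by norm_num)
  · exact (add_le_add e1 (add_le_add e2 (add_le_add e3 (add_le_add g4 le_rfl)))).trans
      (by norm_num)
  · exact (add_le_add e1 (add_le_add e2 (add_le_add e3 (add_le_add g4
      (add_le_add k5 le_rfl))))).trans (by norm_num)
  · exact (add_le_add e1 (add_le_add e2 (add_le_add e3 (add_le_add k5'
      (add_le_add k5' le_rfl))))).trans (by norm_num)

/-- Intermediate values on `[1, rate]`: at 1 the sum is the length of the vector, at `rate` it is at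
most 1. -/
theorem exists_branchingNumber {r : List ℝ} (hr : r ∈ branchingVectors 0.106 0.106) :
    ∃ x : ℝ, IsBranchingNumber r x ∧ x < 1.9767 := by
  have hlen : (1 : ℝ) ≤ (r.map fun a => (1 : ℝ) ^ (-a)).sum := by
    simp only [branchingVectors, List.mem_cons, List.not_mem_nil, or_false] at hr
    rcases hr with rfl | rfl | rfl | rfl | rfl | rfl | rfl | rfl | rfl | rfl <;>
      norm_num [Real.one_rpow]
  have hc : ContinuousOn (fun x : ℝ => (r.map fun a => x ^ (-a)).sum) (Set.Icc 1 rate) := by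
    clear hlen hr
    induction r with
    | nil => simpa using continuousOn_const
    | cons a r ih =>
      simp only [List.map_cons, List.sum_cons]
      refine ContinuousOn.add (fun x hx => ContinuousAt.continuousWithinAt ?_) ih
      exact Real.continuousAt_rpow_const x (-a) (.inl (by have := hx.1; positivity))
  obtain ⟨x, hx, he⟩ := intermediate_value_Icc' one_lt_rate.le hc
    (⟨sum_rate_le_one hr, hlen⟩ : (1 : ℝ) ∈ Set.Icc _ _)
  refine ⟨x, ⟨by linarith [hx.1], he⟩, hx.2.trans_lt (by norm_num [rate])⟩

/-- Polynomial factors are absorbed by the gap between `rate` and `1.9767`. -/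
theorem exists_pow_mul_rate_le (k : ℕ) :
    ∃ C : ℝ, ∀ n : ℕ, ((n : ℝ) + 2) ^ k * rate ^ n ≤ C * 1.9767 ^ n := by
  have hq : |rate / 1.9767| < 1 := by
    rw [abs_of_pos (by norm_num [rate])]; norm_num [rate]
  -- The sequence `m ^ k * (rate / 1.9767) ^ m` tends to zero and is read at `m = n + 2`; the shift
  -- explains the square in the constant.
  have ht := (Filter.tendsto_add_atTop_iff_nat 2).2
    (tendsto_pow_const_mul_const_pow_of_abs_lt_one k hq)
  obtain ⟨B, hB⟩ := ht.bddAbove_range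
  refine ⟨B * (1.9767 / rate) ^ 2, fun n => ?_⟩
  have h := hB ⟨n, rfl⟩
  simp only [div_pow, Nat.cast_add, Nat.cast_ofNat] at h
  have hr := rate_pos
  rw [mul_div_assoc', div_le_iff₀ (by positivity)] at h
  have h' : ((n : ℝ) + 2) ^ k * rate ^ n * rate ^ 2 ≤ B * 1.9767 ^ n * 1.9767 ^ 2 := by
    rw [mul_assoc, ← pow_add, mul_assoc B, ← pow_add]; exact h
  rw [div_pow, mul_div_assoc', div_mul_eq_mul_div, le_div_iff₀ (by positivity)]
  linarith

/-! ## The search tree -/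

theorem Ext.exists_sol {V : Type u} {st c : State V} (h : Ext st c) (hs : ∃ s, st s = 1) :
    ∃ s, c s = 1 := by
  obtain ⟨s, hs⟩ := hs
  have := h.1 s
  exact ⟨s, by omega⟩

section Tree

variable {V : Type u} [Fintype V] [DecidableEq V] {G : SimpleGraph V} {st : State V} {α δ : ℝ}

theorem compatible_toInstance {M : Finset V} : (toInstance st).Compatible M ↔ Accept st M := by
  simp only [BranchInstance.Compatible, Accept, Finset.subset_iff, Finset.mem_union, mem_sol,
    mem_free]
  refine and_congr Iff.rfl (forall₂_congr fun v _ => ?_)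
  omega

theorem Ext.refines {c : State V} (h : Ext st c) : (toInstance c).Refines (toInstance st) := by
  obtain ⟨h1, v, hv, hcv⟩ := h
  refine ⟨?_, fun u hu => ?_, fun u hu => ?_⟩
  · rw [Finset.ssubset_iff_of_subset]
    · exact ⟨v, by simpa using hv, by simpa using hcv⟩
    · intro u hu
      have := h1 u
      rw [mem_free] at hu ⊢
      omega
  · have := h1 u
    rw [mem_sol] at hu ⊢
    omega
  · have := h1 u
    rw [Finset.mem_union, mem_sol, mem_free]
    rw [mem_sol] at hu
    omega

theorem Ext.card_free_lt {c : State V} (h : Ext st c) :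
    (toInstance c).free.card < (toInstance st).free.card :=
  Finset.card_lt_card h.refines.1

theorem GoodStep.covers {cs : List (State V)} (h : GoodStep G α δ st cs) :
    BranchInstance.Covers G (cs.map toInstance) (toInstance st) := by
  refine ⟨fun J hJ => ?_, fun M hM hc => ?_⟩
  · obtain ⟨c, hc, rfl⟩ := List.mem_map.1 hJ
    exact (h.ext c hc).refines
  · have := h.count M hM (compatible_toInstance.1 hc)
    obtain ⟨c, hc, hA⟩ := List.countP_pos_iff.1 (by rw [this]; exact one_pos)
    exact ⟨_, List.mem_map_of_mem hc, compatible_toInstance.2 (by simpa using hA)⟩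

theorem hasSearchTree_toInstance (hα : 0 ≤ α) (hα' : α ≤ 1 / 5) (hδ : 0 ≤ δ) (hδ' : δ ≤ 1 / 5)
    (hG : IsDegenerate G 2) (st : State V) (hs : ∃ s, st s = 1) :
    HasSearchTree G α δ (toInstance st) := by
  induction hn : (toInstance st).free.card using Nat.strong_induction_on generalizing st with
  | _ n ih =>
    by_cases hfree : ∃ v, st v = 0
    · obtain ⟨ρ, hρ, x, y, z, w, h⟩ := exists_rule hG hfree
      have hg := goodStep_of_mem_rules hα hα' hδ hδ' hs hρ h
      generalize ρ.2.map (applyOps G (env4 x y z w) st) = cs at hg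
      have htree : ∀ c ∈ cs, HasSearchTree G α δ (toInstance c) := fun c hc =>
        ih _ (hn ▸ (hg.ext c hc).card_free_lt) c ((hg.ext c hc).exists_sol hs) rfl
      have hcov := hg.covers
      rcases hg.drop with rfl | ⟨c, rfl, hc⟩ | ⟨r, hr, hf⟩
      · exact .discard _ fun M hM hc => by simpa using hcov.2 M hM hc
      · exact .reduce _ _ hcov (by simp only [mu] at hc; linarith) (htree c (by simp))
      · refine .branch _ _ r hr hcov (List.forall₂_map_left_iff.2 hf) fun J hJ => ?_
        obtain ⟨c, hc, rfl⟩ := List.mem_map.1 hJ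
        exact htree c hc
    · refine .leaf _ (Finset.eq_empty_of_forall_notMem fun v hv => hfree ⟨v, by simpa using hv⟩)

theorem hasSearchTree (hα : 0 ≤ α) (hα' : α ≤ 1 / 5) (hδ : 0 ≤ δ) (hδ' : δ ≤ 1 / 5)
    (hG : IsDegenerate G 2) (I : BranchInstance V) (hs : I.sol.Nonempty) :
    HasSearchTree G α δ I := by
  have hI : I = toInstance fun v => if v ∈ I.free then 0 else if v ∈ I.sol then 1 else 2 := by
    obtain ⟨F, S, hd⟩ := I
    simp only [toInstance, BranchInstance.mk.injEq]
    constructor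
    · ext v
      by_cases h : v ∈ F <;> by_cases h' : v ∈ S <;> simp [h, h']
    · ext v
      by_cases h : v ∈ F
      · simp [h, Finset.disjoint_left.1 hd h]
      · by_cases h' : v ∈ S <;> simp [h, h']
  rw [hI]
  refine hasSearchTree_toInstance hα hα' hδ hδ' hG _ ?_
  obtain ⟨s, hs⟩ := hs
  exact ⟨s, by simp [hs, Finset.disjoint_right.1 I.disj hs]⟩

/-! ### Counting minimal sets along the search tree -/

theorem ncard_compatible_list_le (Js : List (BranchInstance V)) :
    {M : Finset V | IsMinimalCDS G M ∧ ∃ J ∈ Js, J.Compatible M}.ncard ≤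
      (Js.map fun J => {M : Finset V | IsMinimalCDS G M ∧ J.Compatible M}.ncard).sum := by
  induction Js with
  | nil => simp
  | cons J Js ih =>
    rw [List.map_cons, List.sum_cons]
    refine le_trans (Set.ncard_le_ncard (t := {M : Finset V | IsMinimalCDS G M ∧ J.Compatible M} ∪
      {M : Finset V | IsMinimalCDS G M ∧ ∃ J ∈ Js, J.Compatible M}) ?_ (Set.toFinite _))
      ((Set.ncard_union_le _ _).trans (Nat.add_le_add_left ih _))
    rintro M ⟨hM, K, hK, hc⟩
    rcases List.mem_cons.1 hK with rfl | hK
    · exact .inl ⟨hM, hc⟩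
    · exact .inr ⟨hM, K, hK, hc⟩

theorem sum_rate_rpow_le {β : Type*} {f : β → ℝ} {m : ℝ} {Js : List β} {r : List ℝ}
    (h : List.Forall₂ (fun J a => f J ≤ m - a) Js r) :
    (Js.map fun J => rate ^ f J).sum ≤ rate ^ m * (r.map fun a => rate ^ (-a)).sum := by
  induction h with
  | nil => simp
  | cons h _ ih =>
    simp only [List.map_cons, List.sum_cons, mul_add]
    refine add_le_add ?_ ih
    rw [← Real.rpow_add rate_pos, ← sub_eq_add_neg]
    exact Real.rpow_le_rpow_of_exponent_le one_lt_rate.le h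

/-- A leaf without undecided vertices accepts one set at most, and `1 ≤ rate ^ μ` because `μ ≥ 0`.
At a branching, the bounds of the children add up to at most the bound of the node by
`sum_rate_le_one`. -/
theorem HasSearchTree.ncard_le {I : BranchInstance V}
    (h : HasSearchTree G 0.106 0.106 I) :
    ({M : Finset V | IsMinimalCDS G M ∧ I.Compatible M}.ncard : ℝ) ≤
      rate ^ I.measure G 0.106 0.106 := by
  induction h with
  | leaf I h =>
    have h1 : {M : Finset V | IsMinimalCDS G M ∧ I.Compatible M}.ncard ≤ 1 := by
      refine (Set.ncard_le_one_iff (Set.toFinite _)).2 ?_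
      rintro M N ⟨-, h1, h2⟩ ⟨-, h3, h4⟩
      rw [h, Finset.union_empty] at h2 h4
      exact (h2.antisymm h1).trans (h4.antisymm h3).symm
    refine le_trans (by exact_mod_cast h1) (Real.one_le_rpow one_lt_rate.le ?_)
    unfold BranchInstance.measure
    positivity
  | discard I h =>
    have : {M : Finset V | IsMinimalCDS G M ∧ I.Compatible M} = ∅ :=
      Set.eq_empty_of_forall_notMem fun M hM => h M hM.1 hM.2
    rw [this, Set.ncard_empty]
    exact_mod_cast Real.rpow_nonneg rate_pos.le _
  | reduce I J hc hm hJ ih =>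
    refine le_trans ?_ (ih.trans (Real.rpow_le_rpow_of_exponent_le one_lt_rate.le hm))
    refine Nat.cast_le.2 (Set.ncard_le_ncard ?_ (Set.toFinite _))
    rintro M ⟨hM, hI⟩
    obtain ⟨K, hK, hKM⟩ := hc.2 M hM hI
    exact ⟨hM, List.mem_singleton.1 hK ▸ hKM⟩
  | branch I Js r hr hc hm hJs ih =>
    have h1 : {M : Finset V | IsMinimalCDS G M ∧ I.Compatible M}.ncard ≤
        {M : Finset V | IsMinimalCDS G M ∧ ∃ J ∈ Js, J.Compatible M}.ncard :=
      Set.ncard_le_ncard (fun M ⟨hM, hI⟩ => ⟨hM, hc.2 M hM hI⟩) (Set.toFinite _)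
    have h2 : ((Js.map fun J => {M : Finset V | IsMinimalCDS G M ∧ J.Compatible M}.ncard).sum : ℝ) ≤
        (Js.map fun J => rate ^ J.measure G 0.106 0.106).sum := by
      rw [Nat.cast_list_sum, List.map_map]
      exact List.sum_le_sum ih
    refine (Nat.cast_le.2 (h1.trans (ncard_compatible_list_le Js))).trans (h2.trans ?_)
    refine (sum_rate_rpow_le hm).trans (mul_le_of_le_one_right (Real.rpow_nonneg rate_pos.le _) ?_)
    exact sum_rate_le_one hr

/-- `V'` and `O_n` are disjoint and `α ≤ 1`, so together they contribute at most the order; each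
component of the solution contains a solution vertex. -/
theorem mu_le_card_add (hα' : α ≤ 1) (hδ : 0 ≤ δ) :
    mu G α δ st ≤ Fintype.card V + δ * (toInstance st).sol.card := by
  have h1 : (toInstance st).free.card + ((toInstance st).discardedUndominated G).card ≤
      Fintype.card V := by
    rw [← Finset.card_union_of_disjoint]
    · exact Finset.card_le_univ _
    · rw [Finset.disjoint_left]
      intro v hv hv'
      exact (mem_discardedUndominated.1 hv').1 (mem_free.1 hv)
  have h2 : Nat.card (G.induce (solSet st)).ConnectedComponent ≤ (toInstance st).sol.card := by
    refine (Nat.card_le_card_of_surjective (G.induce (solSet st)).connectedComponentMk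
      Quot.mk_surjective).trans_eq ?_
    rw [← coe_sol, Nat.card_coe_set_eq, Set.ncard_coe_finset]
  have h1' : ((toInstance st).free.card : ℝ) + ((toInstance st).discardedUndominated G).card ≤
      Fintype.card V := by exact_mod_cast h1
  have h2' : (Nat.card (G.induce (solSet st)).ConnectedComponent : ℝ) ≤
      (toInstance st).sol.card := by exact_mod_cast h2
  have h3 : (0 : ℝ) ≤ ((toInstance st).discardedUndominated G).card := by positivity
  rw [mu_eq]
  nlinarith [mul_le_mul_of_nonneg_left h2' hδ, mul_le_mul_of_nonneg_right hα' h3]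

end Tree

theorem exists_ncard_le : ∃ C : ℝ, ∀ (V : Type u) [Fintype V] (G : SimpleGraph V),
    IsDegenerate G 2 →
      ({S : Finset V | IsMinimalCDS G S}.ncard : ℝ) ≤ C * (1.9767 : ℝ) ^ Fintype.card V := by
  obtain ⟨C, hC⟩ := exists_pow_mul_rate_le 1
  refine ⟨C * rate, fun V _ G hG => ?_⟩
  classical
  -- Start with each single vertex as the solution. A minimal set is then counted once for each of
  -- its vertices, which is harmless for an upper bound.
  let s : V → State V := fun v => Function.update (fun _ => 0) v 1
  have hsol : ∀ v, (toInstance (s v)).sol = {v} := fun v => by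
    ext u
    by_cases h : u = v <;> simp [s, h]
  let Js := (Finset.univ : Finset V).toList.map fun v => toInstance (s v)
  have h1 : {S : Finset V | IsMinimalCDS G S}.ncard ≤
      {M : Finset V | IsMinimalCDS G M ∧ ∃ J ∈ Js, J.Compatible M}.ncard := by
    refine Set.ncard_le_ncard (fun M hM => ⟨hM, ?_⟩) (Set.toFinite _)
    obtain ⟨v, hv⟩ := (isCDS_iff.1 hM.prop).2.1
    refine ⟨toInstance (s v), List.mem_map_of_mem (by simp), compatible_toInstance.2 ⟨?_, ?_⟩⟩
    · intro u hu
      by_cases h : u = v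
      · rwa [h]
      · simp [s, h] at hu
    · intro u _
      by_cases h : u = v <;> simp [s, h]
  have h2 : ∀ J ∈ Js, ({M : Finset V | IsMinimalCDS G M ∧ J.Compatible M}.ncard : ℝ) ≤
      rate ^ (Fintype.card V + 1) := by
    intro J hJ
    obtain ⟨v, -, rfl⟩ := List.mem_map.1 hJ
    have ht : HasSearchTree G 0.106 0.106 (toInstance (s v)) :=
      hasSearchTree (by norm_num) (by norm_num) (by norm_num) (by norm_num) hG _ (by simp [hsol])
    refine ht.ncard_le.trans ?_
    have hm := mu_le_card_add (G := G) (st := s v) (α := 0.106) (δ := 0.106)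
      (by norm_num) (by norm_num)
    rw [hsol] at hm
    rw [← Real.rpow_natCast]
    refine Real.rpow_le_rpow_of_exponent_le one_lt_rate.le (hm.trans ?_)
    push_cast [Finset.card_singleton]
    norm_num
  have h3 : ((Js.map fun J => {M : Finset V | IsMinimalCDS G M ∧ J.Compatible M}.ncard).sum : ℝ) ≤
      Fintype.card V * rate ^ (Fintype.card V + 1) := by
    rw [Nat.cast_list_sum, List.map_map]
    refine (List.sum_le_card_nsmul _ (rate ^ (Fintype.card V + 1)) ?_).trans ?_
    · intro x hx
      obtain ⟨J, hJ, rfl⟩ := List.mem_map.1 hx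
      exact h2 J hJ
    · simp [Js]
  refine (Nat.cast_le.2 (h1.trans (ncard_compatible_list_le Js))).trans (h3.trans ?_)
  have h4 := hC (Fintype.card V)
  have hr := rate_pos
  have h5 : 0 ≤ rate ^ Fintype.card V := by positivity
  rw [pow_one] at h4
  calc (Fintype.card V : ℝ) * rate ^ (Fintype.card V + 1)
      ≤ ((Fintype.card V + 2) * rate ^ Fintype.card V) * rate := by rw [pow_succ]; nlinarith
    _ ≤ (C * 1.9767 ^ Fintype.card V) * rate := mul_le_mul_of_nonneg_right h4 hr.le
    _ = C * rate * 1.9767 ^ Fintype.card V := by ring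

/-! ## Reasoning about programs -/

section Store

variable (σ : Store) (x y a b i j v : ℕ)

@[simp] theorem Store.setVar_vars :
    (σ.setVar x v).vars y = if y = x then v else σ.vars y := by
  simp [Store.setVar, Function.update_apply]

@[simp] theorem Store.setVar_arr : (σ.setVar x v).arr = σ.arr := rfl

@[simp] theorem Store.setVar_out : (σ.setVar x v).out = σ.out := rfl

@[simp] theorem Store.setArr_arr :
    (σ.setArr a i v).arr b j = if b = a ∧ j = i then v else σ.arr b j := by
  by_cases h : b = a
  · subst h
    simp [Store.setArr, Function.update_apply]
  · simp [Store.setArr, h]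

@[simp] theorem Store.emit_vars : (σ.emit v).vars = σ.vars := rfl

@[simp] theorem Store.emit_out : (σ.emit v).out = σ.out ++ [v] := rfl

end Store

/-- A bound for the number of steps of a program whose loops are repeated at most `n` times. -/
def timeBound (n : ℕ) : Prog → ℕ
  | .skip => 1
  | .assign _ e => e.cost + 1
  | .put _ i e => i.cost + e.cost + 1
  | .write e => e.cost + 1
  | .seq p q => timeBound n p + timeBound n q
  | .ite e p q => e.cost + 1 + (timeBound n p + timeBound n q)
  | .loop e p => n * (e.cost + 1 + timeBound n p) + (e.cost + 1)

/-- With base `n + 2 ≥ 2`, constants, sums and a further factor `n` are all absorbed by a larger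
exponent. -/
theorem exists_timeBound_le (P : Prog) : ∃ k, ∀ n, timeBound n P ≤ (n + 2) ^ k := by
  have const : ∀ c : ℕ, ∃ k, ∀ n : ℕ, c ≤ (n + 2) ^ k := fun c =>
    ⟨c, fun n => Nat.lt_two_pow_self.le.trans (Nat.pow_le_pow_left (by omega) c)⟩
  have add : ∀ f g : ℕ → ℕ, (∃ k, ∀ n, f n ≤ (n + 2) ^ k) → (∃ k, ∀ n, g n ≤ (n + 2) ^ k) →
      ∃ k, ∀ n, f n + g n ≤ (n + 2) ^ k := by
    rintro f g ⟨k, hk⟩ ⟨l, hl⟩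
    refine ⟨k + l + 1, fun n => ?_⟩
    have h1 : (n + 2) ^ k ≤ (n + 2) ^ (k + l) := Nat.pow_le_pow_right (by omega) (by omega)
    have h2 : (n + 2) ^ l ≤ (n + 2) ^ (k + l) := Nat.pow_le_pow_right (by omega) (by omega)
    have h3 : (n + 2) ^ (k + l) * 2 ≤ (n + 2) ^ (k + l) * (n + 2) :=
      Nat.mul_le_mul_left _ (by omega)
    rw [pow_succ]
    linarith [hk n, hl n]
  induction P with
  | skip => exact const 1
  | assign x e => exact const _
  | put a i e => exact const _
  | write e => exact const _
  | seq p q hp hq => exact add _ _ hp hq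
  | ite e p q hp hq => exact add _ _ (const _) (add _ _ hp hq)
  | loop e p hp =>
    refine add _ _ ?_ (const _)
    obtain ⟨k, hk⟩ := add _ _ (const (e.cost + 1)) hp
    refine ⟨k + 1, fun n => ?_⟩
    rw [pow_succ, mul_comm]
    exact Nat.mul_le_mul (hk n) (by omega)

/-- `P` halts on `σ` within its time bound, in a memory of size `s`, in a store with `Q`. -/
def Does (s n : ℕ) (P : Prog) (σ : Store) (Q : Store → Prop) : Prop :=
  ∃ σ' t, Exec s P σ σ' t ∧ t ≤ timeBound n P ∧ Q σ'

section Does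

variable {s n : ℕ} {σ : Store} {P P' : Prog} {Q Q' : Store → Prop} {e e' : Expr} {x a : ℕ}

theorem Does.mono (h : Does s n P σ Q) (hQ : ∀ τ, Q τ → Q' τ) : Does s n P σ Q' := by
  obtain ⟨τ, t, h1, h2, h3⟩ := h
  exact ⟨τ, t, h1, h2, hQ τ h3⟩

theorem Does.skip (h : Q σ) : Does s n .skip σ Q := ⟨σ, 1, .skip σ, le_rfl, h⟩

theorem Does.assign (hv : e.eval σ < s) (h : Q (σ.setVar x (e.eval σ))) :
    Does s n (.assign x e) σ Q := ⟨_, _, .assign x e σ hv, le_rfl, h⟩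

theorem Does.put (hi : e.eval σ < s) (hv : e'.eval σ < s)
    (h : Q (σ.setArr a (e.eval σ) (e'.eval σ))) : Does s n (.put a e e') σ Q :=
  ⟨_, _, .put a e e' σ hi hv, le_rfl, h⟩

theorem Does.write (hv : e.eval σ < s) (h : Q (σ.emit (e.eval σ))) :
    Does s n (.write e) σ Q := ⟨_, _, .write e σ hv, le_rfl, h⟩

theorem Does.seq (h : Does s n P σ fun τ => Does s n P' τ Q) : Does s n (.seq P P') σ Q := by
  obtain ⟨τ, t, h1, h2, τ', t', h3, h4, h5⟩ := h
  exact ⟨τ', t + t', .seq h1 h3, Nat.add_le_add h2 h4, h5⟩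

theorem Does.ite (h1 : e.eval σ ≠ 0 → Does s n P σ Q) (h2 : e.eval σ = 0 → Does s n P' σ Q) :
    Does s n (.ite e P P') σ Q := by
  by_cases h : e.eval σ = 0
  · obtain ⟨τ, t, h3, h4, h5⟩ := h2 h
    exact ⟨τ, _, .ite_false h h3, by simp only [timeBound]; omega, h5⟩
  · obtain ⟨τ, t, h3, h4, h5⟩ := h1 h
    exact ⟨τ, _, .ite_true h h3, by simp only [timeBound]; omega, h5⟩

end Does

/-- Repeat `P` with the values `0, …, n - 1` in the register `x`. -/
def forLoop (x : ℕ) (P : Prog) : Prog :=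
  .seq (.assign x (.num 0))
    (.loop (.lt (.var x) (.var 0)) (.seq P (.assign x (.add (.var x) (.num 1)))))

theorem Does.forLoop {s n x : ℕ} {P : Prog} {σ : Store} {Q : Store → Prop}
    (I : ℕ → Store → Prop) (hx : x ≠ 0) (hn : σ.vars 0 = n) (hs : n < s)
    (h0 : I 0 (σ.setVar x 0))
    (hI : ∀ i < n, ∀ τ, τ.vars 0 = n → τ.vars x = i → I i τ → Does s n P τ fun τ' =>
      τ'.vars 0 = n ∧ τ'.vars x = i ∧ I (i + 1) (τ'.setVar x (i + 1)))
    (hQ : ∀ τ, τ.vars 0 = n → I n τ → Q τ) : Does s n (forLoop x P) σ Q := by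
  -- Induction on the number `m` of remaining rounds. Each round costs `3 + 1` for the test and 4
  -- for the increment; a last failing test follows.
  have key : ∀ m ≤ n, ∀ τ, τ.vars 0 = n → τ.vars x = n - m → I (n - m) τ →
      ∃ τ' t, Exec s (.loop (.lt (.var x) (.var 0)) (.seq P (.assign x (.add (.var x) (.num 1)))))
        τ τ' t ∧ t ≤ m * (3 + 1 + (timeBound n P + 4)) + (3 + 1) ∧ Q τ' := by
    intro m
    induction m with
    | zero =>
      intro _ τ h1 h2 h3
      refine ⟨τ, _, .loop_done ?_, by simp [Expr.cost], hQ τ h1 h3⟩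
      simp [Expr.eval, h1, h2]
    | succ m ih =>
      intro hm τ h1 h2 h3
      obtain ⟨τ₁, t₁, e1, b1, g1, g2, g3⟩ := hI _ (by omega) τ h1 h2 h3
      have he : (Expr.add (.var x) (.num 1)).eval τ₁ = n - (m + 1) + 1 := by
        simp [Expr.eval, g2]
      have hlt : n - (m + 1) + 1 < s := by omega
      have hnm : n - (m + 1) + 1 = n - m := by omega
      obtain ⟨τ₂, t₂, e2, b2, hq⟩ := ih (by omega) (τ₁.setVar x (n - (m + 1) + 1))
        (by simp [hx.symm, g1]) (by simp [hnm]) (by rw [hnm] at g3 ⊢; exact g3)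
      refine ⟨τ₂, _, .loop_step (by simp [Expr.eval, h1, h2]; omega)
        (.seq e1 (.assign x _ τ₁ (by rw [he]; exact hlt))) (by rw [he]; exact e2), ?_, hq⟩
      simp only [Expr.cost]
      nlinarith
  obtain ⟨τ', t, e1, b, hq⟩ := key n le_rfl (σ.setVar x 0) (by simp [hx.symm, hn]) (by simp)
    (by simpa using h0)
  refine ⟨τ', _, .seq (.assign x (.num 0) σ (by simp [Expr.eval]; omega)) e1, ?_, hq⟩
  simp only [CDSEnum.forLoop, timeBound, Expr.cost, Nat.reduceAdd] at b ⊢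
  omega

/-- `τ` arises from `σ` by changing only registers with a number at least `k`. -/
structure Frame (k : ℕ) (σ τ : Store) : Prop where
  vars : ∀ r < k, τ.vars r = σ.vars r
  arr : τ.arr = σ.arr
  out : τ.out = σ.out

theorem Frame.refl (k : ℕ) (σ : Store) : Frame k σ σ := ⟨fun _ _ => rfl, rfl, rfl⟩

theorem Frame.trans {k : ℕ} {σ τ υ : Store} (h : Frame k σ τ) (h' : Frame k τ υ) :
    Frame k σ υ :=
  ⟨fun r hr => (h'.vars r hr).trans (h.vars r hr), h'.arr.trans h.arr, h'.out.trans h.out⟩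

theorem Frame.mono {k l : ℕ} (hkl : l ≤ k) {σ τ : Store} (h : Frame k σ τ) : Frame l σ τ :=
  ⟨fun r hr => h.vars r (hr.trans_le hkl), h.arr, h.out⟩

theorem Frame.setVar {k x v : ℕ} (hx : k ≤ x) {σ τ : Store} (h : Frame k σ τ) :
    Frame k σ (τ.setVar x v) := by
  refine ⟨fun r hr => ?_, h.arr, h.out⟩
  rw [Store.setVar_vars, if_neg (by omega), h.vars r hr]

/-! ## Evaluation of formulas -/

section Eval

variable {n : ℕ} {G : SimpleGraph (Fin n)} {st : State (Fin n)} {σ τ : Store}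

/-- The register that holds a variable of a formula. -/
def varReg (i : ℕ) : Expr := .var (2 * i + 4)

/-- The index of an entry of the adjacency matrix. -/
def matIdx (i j : Expr) : Expr := .add (.mul i (.var 0)) j

open Classical in
/-- The store holds the adjacency matrix of `G`. -/
structure HasGraph (G : SimpleGraph (Fin n)) (σ : Store) : Prop where
  order : σ.vars 0 = n
  adj : ∀ i j : Fin n, σ.arr 0 (i * n + j) = if G.Adj i j then 1 else 0

/-- The vertices in the solution that are different from `k`. -/
def solAvoid (st : State (Fin n)) (k : ℕ) : Set (Fin n) := {v | st v = 1 ∧ (v : ℕ) ≠ k}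

theorem solAvoid_coe (k : Fin n) : solAvoid st k = solSet st \ {k} := by
  ext v; simp [solAvoid, solSet, Fin.ext_iff]

theorem solAvoid_order : solAvoid st n = solSet st := by
  ext v; simp [solAvoid, solSet, v.2.ne]

open Classical in
/-- The work arrays hold the state `st` and the connections inside its solution. -/
structure HasState (G : SimpleGraph (Fin n)) (st : State (Fin n)) (σ : Store) : Prop where
  state : ∀ v : Fin n, σ.arr 2 v = st v
  conn : ∀ k ≤ n, ∀ u v : Fin n,
    σ.arr 3 ((k * n + u) * n + v) = if Linked G (solAvoid st k) u v then 1 else 0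

theorem HasGraph.frame {k : ℕ} (h : HasGraph G σ) (hk : 0 < k) (hf : Frame k σ τ) :
    HasGraph G τ :=
  ⟨(hf.vars 0 hk).trans h.order, by rw [hf.arr]; exact h.adj⟩

theorem HasState.frame {k : ℕ} (h : HasState G st σ) (hf : Frame k σ τ) : HasState G st τ :=
  ⟨by rw [hf.arr]; exact h.state, by rw [hf.arr]; exact h.conn⟩

/-- The value of an atomic formula. -/
def atom (d : ℕ) (e f : Expr) : Prog := .assign (2 * d + 3) (.eq e f)

/-- A program that evaluates a formula. -/
def Fml.compile : Fml → ℕ → Prog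
  -- At depth `d` the truth value goes to register `2 * d + 3`. The variables `i < d` are in the
  -- registers `2 * i + 4`, all smaller, so evaluation does not disturb them.
  | .adj i j, d => atom d (.get 0 (matIdx (varReg i) (varReg j))) (.num 1)
  | .st i c, d => atom d (.get 2 (varReg i)) (.num c)
  | .eq i j, d => atom d (varReg i) (varReg j)
  | .conn i j, d =>
    atom d (.get 3 (matIdx (matIdx (.var 0) (varReg i)) (varReg j))) (.num 1)
  | .connAvoid k i j, d =>
    atom d (.get 3 (matIdx (matIdx (varReg k) (varReg i)) (varReg j))) (.num 1)
  | .neg φ, d => .seq (φ.compile d) (atom d (.var (2 * d + 3)) (.num 0))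
  | .and φ ψ, d => .seq (φ.compile d) (.ite (.var (2 * d + 3)) (ψ.compile d) .skip)
  | .ex φ, d => .seq (.assign (2 * d + 3) (.num 0)) (forLoop (2 * d + 4)
      (.seq (φ.compile (d + 1)) (.ite (.var (2 * d + 5)) (.assign (2 * d + 3) (.num 1)) .skip)))

theorem atom_does {s d : ℕ} {e f : Expr} {p : Prop} [Decidable p] (hs : 1 < s)
    (h : e.eval σ = f.eval σ ↔ p) :
    Does s n (atom d e f) σ fun τ =>
      Frame (2 * d + 3) σ τ ∧ τ.vars (2 * d + 3) = if p then 1 else 0 := by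
  have he : (Expr.eq e f).eval σ = if p then 1 else 0 := by
    simp only [Expr.eval, h]
  refine Does.assign ?_ ⟨(Frame.refl _ σ).setVar le_rfl, ?_⟩
  · rw [he]; split_ifs <;> omega
  · rw [he]; simp

open Classical in
theorem Fml.compile_does {s : ℕ} (hs : n + 1 < s) (φ : Fml) :
    ∀ (d : ℕ) (env : ℕ → Fin n) (σ : Store), φ.Scoped d → HasGraph G σ → HasState G st σ →
      (∀ i < d, σ.vars (2 * i + 4) = env i) →
      Does s n (φ.compile d) σ fun τ =>
        Frame (2 * d + 3) σ τ ∧ τ.vars (2 * d + 3) = if φ.Holds G st d env then 1 else 0 := by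
  induction φ with
  | adj i j =>
    intro d env σ hsc hg hst henv
    refine atom_does (by omega) ?_
    simp [Expr.eval, matIdx, varReg, henv i hsc.1, henv j hsc.2, hg.order, hg.adj, Holds]
  | st i c =>
    intro d env σ hsc hg hst henv
    refine atom_does (by omega) ?_
    simp [Expr.eval, varReg, henv i hsc, hst.state, Holds]
  | eq i j =>
    intro d env σ hsc hg hst henv
    refine atom_does (by omega) ?_
    simp [Expr.eval, varReg, henv i hsc.1, henv j hsc.2, Holds, Fin.ext_iff]
  | conn i j =>
    intro d env σ hsc hg hst henv
    refine atom_does (by omega) ?_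
    simp [Expr.eval, matIdx, varReg, henv i hsc.1, henv j hsc.2, hg.order, hst.conn n le_rfl,
      Holds, solAvoid_order]
  | connAvoid k i j =>
    intro d env σ hsc hg hst henv
    refine atom_does (by omega) ?_
    simp [Expr.eval, matIdx, varReg, henv k hsc.1, henv i hsc.2.1, henv j hsc.2.2, hg.order,
      hst.conn _ (env k).2.le, Holds, solAvoid_coe]
  | neg φ ih =>
    intro d env σ hsc hg hst henv
    refine Does.seq ((ih d env σ hsc hg hst henv).mono fun τ hτ => ?_)
    refine (atom_does (p := φ.neg.Holds G st d env) (by omega) ?_).mono fun υ hυ =>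
      ⟨hτ.1.trans hυ.1, hυ.2⟩
    simp [Expr.eval, hτ.2, Holds]
  | and φ ψ ihφ ihψ =>
    intro d env σ hsc hg hst henv
    refine Does.seq ((ihφ d env σ hsc.1 hg hst henv).mono fun τ hτ => Does.ite (fun h => ?_)
      fun h => Does.skip ⟨hτ.1, ?_⟩)
    · have hφ : φ.Holds G st d env := by
        by_contra hφ
        simp [Expr.eval, hτ.2, hφ] at h
      refine (ihψ d env τ hsc.2 (hg.frame (by omega) hτ.1) (hst.frame hτ.1) fun i hi => ?_).mono
        fun υ hυ => ⟨hτ.1.trans hυ.1, by simp [hυ.2, Holds, hφ]⟩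
      rw [hτ.1.vars _ (by omega), henv i hi]
    · have hφ : ¬ φ.Holds G st d env := by
        intro hφ
        simp [Expr.eval, hτ.2, hφ] at h
      simp [hτ.2, Holds, hφ]
  | ex φ ih =>
    intro d env σ hsc hg hst henv
    refine Does.seq (Does.assign (by simp [Expr.eval]; omega) ?_)
    refine Does.forLoop (fun m τ => Frame (2 * d + 3) σ τ ∧ τ.vars (2 * d + 3) =
      if ∃ v : Fin n, (v : ℕ) < m ∧ φ.Holds G st (d + 1) (Function.update env d v) then 1 else 0)
      (by omega) ?_ (by omega) ⟨?_, ?_⟩ ?_ ?_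
    · simp [hg.order]
    · exact ((Frame.refl _ σ).setVar le_rfl).setVar (by omega)
    · simp [Expr.eval]
    · rintro i hi τ h0 hx ⟨hf, hr⟩
      refine Does.seq ((ih (d + 1) (Function.update env d ⟨i, hi⟩) τ hsc (hg.frame (by omega) hf)
        (hst.frame hf) fun j hj => ?_).mono fun υ hυ => ?_)
      · by_cases hjd : j = d
        · simp [hjd, hx]
        · rw [Function.update_of_ne hjd, hf.vars _ (by omega), henv j (by omega)]
      have e0 : υ.vars 0 = n := (hυ.1.vars 0 (by omega)).trans h0
      have e1 : υ.vars (2 * d + 4) = i := (hυ.1.vars _ (by omega)).trans hx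
      have e2 : υ.vars (2 * d + 3) = _ := (hυ.1.vars _ (by omega)).trans hr
      have hf' : Frame (2 * d + 3) σ υ := hf.trans (hυ.1.mono (by omega))
      have e3 : (Expr.var (2 * d + 5)).eval υ =
          if φ.Holds G st (d + 1) (Function.update env d ⟨i, hi⟩) then 1 else 0 := hυ.2
      refine Does.ite (fun h => Does.assign (by simp [Expr.eval]; omega) ⟨?_, ?_, ?_, ?_⟩)
        fun h => Does.skip ⟨e0, e1, hf'.setVar (by omega), ?_⟩
      · simp [e0]
      · simp [e1]
      · exact (hf'.setVar le_rfl).setVar (by omega)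
      · have hφ : φ.Holds G st (d + 1) (Function.update env d ⟨i, hi⟩) := by
          by_contra hφ
          simp [e3, hφ] at h
        rw [if_pos ⟨⟨i, hi⟩, Nat.lt_succ_self i, hφ⟩]
        simp [Expr.eval]
      · have hφ : ¬ φ.Holds G st (d + 1) (Function.update env d ⟨i, hi⟩) := by
          intro hφ
          simp [e3, hφ] at h
        rw [Store.setVar_vars, if_neg (by omega), e2]
        congr 1
        refine propext (exists_congr fun v => and_congr_left fun hv => ?_)
        have : (v : ℕ) ≠ i := by
          rintro rfl
          exact hφ hv
        omega
    · rintro τ - ⟨hf, hr⟩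
      refine ⟨hf, hr.trans ?_⟩
      simp only [Holds, Fin.is_lt, true_and]
      congr

end Eval

/-! ## Connections inside the solution -/

/-- `τ` agrees with `σ` on the registers in `R`, the arrays in `A`, and the output. -/
structure Keep (R A : ℕ → Prop) (σ τ : Store) : Prop where
  vars : ∀ r, R r → τ.vars r = σ.vars r
  arr : ∀ a, A a → τ.arr a = σ.arr a
  out : τ.out = σ.out

section Keep

variable {R R' A A' : ℕ → Prop} {σ τ υ : Store}

theorem Keep.refl (R A : ℕ → Prop) (σ : Store) : Keep R A σ σ :=
  ⟨fun _ _ => rfl, fun _ _ => rfl, rfl⟩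

theorem Keep.trans (h : Keep R A σ τ) (h' : Keep R A τ υ) : Keep R A σ υ :=
  ⟨fun r hr => (h'.vars r hr).trans (h.vars r hr),
    fun a ha => (h'.arr a ha).trans (h.arr a ha), h'.out.trans h.out⟩

theorem Keep.mono (h : Keep R A σ τ) (hR : ∀ r, R' r → R r) (hA : ∀ a, A' a → A a) :
    Keep R' A' σ τ :=
  ⟨fun r hr => h.vars r (hR r hr), fun a ha => h.arr a (hA a ha), h.out⟩

theorem Keep.setVar (h : Keep R A σ τ) {x v : ℕ} (hx : ¬ R x) : Keep R A σ (τ.setVar x v) := by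
  refine ⟨fun r hr => ?_, h.arr, h.out⟩
  rw [Store.setVar_vars, if_neg (by rintro rfl; exact hx hr), h.vars r hr]

theorem Keep.setArr (h : Keep R A σ τ) {a i v : ℕ} (ha : ¬ A a) :
    Keep R A σ (τ.setArr a i v) := by
  refine ⟨h.vars, fun b hb => ?_, h.out⟩
  rw [← h.arr b hb]
  funext j
  rw [Store.setArr_arr, if_neg]
  rintro ⟨rfl, -⟩
  exact ha hb

theorem Frame.keep {k : ℕ} (h : Frame k σ τ) : Keep (· < k) A σ τ :=
  ⟨h.vars, fun a _ => by rw [h.arr], h.out⟩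

theorem HasGraph.keep {n : ℕ} {G : SimpleGraph (Fin n)} (h : HasGraph G σ) (hk : Keep R A σ τ)
    (h0 : R 0) (h0' : A 0) : HasGraph G τ :=
  ⟨(hk.vars 0 h0).trans h.order, by rw [hk.arr 0 h0']; exact h.adj⟩

theorem HasState.keep {n : ℕ} {G : SimpleGraph (Fin n)} {st : State (Fin n)}
    (h : HasState G st σ) (hk : Keep R A σ τ) (h2 : A 2) (h3 : A 3) : HasState G st τ :=
  ⟨by rw [hk.arr 2 h2]; exact h.state, by rw [hk.arr 3 h3]; exact h.conn⟩

end Keep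

/-- Two nested loops whose common invariant runs through the pairs in lexicographic order. -/
theorem Does.forLoop₂ {s n x y : ℕ} {P : Prog} {σ : Store} {Q : Store → Prop}
    (I : ℕ → ℕ → Store → Prop) (hx : x ≠ 0) (hy : y ≠ 0) (hxy : x ≠ y) (hn : σ.vars 0 = n)
    (hs : n < s) (hIx : ∀ i j τ v, I i j τ → I i j (τ.setVar x v))
    (hIy : ∀ i j τ v, I i j τ → I i j (τ.setVar y v)) (h0 : I 0 0 σ)
    (hnext : ∀ i τ, I i n τ → I (i + 1) 0 τ)
    (hI : ∀ i < n, ∀ j < n, ∀ τ, τ.vars 0 = n → τ.vars x = i → τ.vars y = j → I i j τ →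
      Does s n P τ fun τ' =>
        τ'.vars 0 = n ∧ τ'.vars x = i ∧ τ'.vars y = j ∧ I i (j + 1) τ')
    (hQ : ∀ τ, τ.vars 0 = n → I n 0 τ → Q τ) :
    Does s n (CDSEnum.forLoop x (CDSEnum.forLoop y P)) σ Q := by
  refine Does.forLoop (fun i τ => I i 0 τ) hx hn hs (hIx _ _ _ _ h0) ?_ hQ
  intro i hi τ h1 h2 h3
  refine Does.forLoop (fun j τ => τ.vars x = i ∧ I i j τ) hy h1 hs
    ⟨by simp [hxy, h2], hIy _ _ _ _ h3⟩ ?_ ?_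
  · rintro j hj υ g1 g2 ⟨g3, g4⟩
    refine (hI i hi j hj υ g1 g3 g2 g4).mono fun υ' k => ⟨k.1, k.2.2.1, ?_, hIy _ _ _ _ k.2.2.2⟩
    simp [hxy, k.2.1]
  · rintro υ g1 ⟨g2, g3⟩
    exact ⟨g1, g2, hIx _ _ _ _ (hnext _ _ g3)⟩

/-! ### Reachability by Warshall's algorithm -/

section Closure

variable {n : ℕ}

/-- Reachability with intermediate vertices smaller than `m`. -/
def PathBelow (B : Fin n → Fin n → Prop) : ℕ → Fin n → Fin n → Prop
  | 0, u, v => B u v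
  | m + 1, u, v => PathBelow B m u v ∨
      ∃ h : m < n, PathBelow B m u ⟨m, h⟩ ∧ PathBelow B m ⟨m, h⟩ v

theorem PathBelow.of_base {B : Fin n → Fin n → Prop} {u v : Fin n} (h : B u v) :
    ∀ m, PathBelow B m u v
  | 0 => h
  | m + 1 => .inl (of_base h m)

/-- In the step to `m + 1`, a middle vertex below `m` is removed by induction, and two passages
through `m` are shortened to one; the middle vertex `m` itself is covered by the definition. -/
theorem PathBelow.trans {B : Fin n → Fin n → Prop} {u k v : Fin n} : ∀ {m : ℕ}, (k : ℕ) < m →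
    PathBelow B m u k → PathBelow B m k v → PathBelow B m u v
  | 0, hk, _, _ => absurd hk (Nat.not_lt_zero _)
  | m + 1, hk, h1, h2 => by
    rcases Nat.lt_succ_iff_lt_or_eq.1 hk with hk | hk
    · rcases h1 with h1 | ⟨hm, h1, h1'⟩ <;> rcases h2 with h2 | ⟨hm, h2, h2'⟩
      · exact .inl (trans hk h1 h2)
      · exact .inr ⟨hm, trans hk h1 h2, h2'⟩
      · exact .inr ⟨hm, h1, trans hk h1' h2⟩
      · exact .inr ⟨hm, h1, h2'⟩
    · obtain ⟨k, hkn⟩ := k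
      obtain rfl : k = m := hk
      refine .inr ⟨hkn, ?_, ?_⟩
      · rcases h1 with h1 | ⟨_, h1, -⟩ <;> exact h1
      · rcases h2 with h2 | ⟨_, -, h2⟩ <;> exact h2

/-- Equality or adjacency inside a set of vertices. -/
def AdjIn (G : SimpleGraph (Fin n)) (T : Set (Fin n)) (u v : Fin n) : Prop :=
  u ∈ T ∧ v ∈ T ∧ (u = v ∨ G.Adj u v)

theorem AdjIn.linked {G : SimpleGraph (Fin n)} {T : Set (Fin n)} {u v : Fin n}
    (h : AdjIn G T u v) : Linked G T u v := by
  obtain ⟨hu, hv, rfl | h⟩ := h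
  · exact .refl hu
  · exact .of_adj hu hv h

theorem Linked.pathBelow {G : SimpleGraph (Fin n)} {T : Set (Fin n)} {u v : Fin n}
    (h : Linked G T u v) : PathBelow (AdjIn G T) n u v :=
  h.induction (P := PathBelow (AdjIn G T) n u) (.of_base ⟨h.1, h.1, .inl rfl⟩ n)
    fun a _ ha hb _ hab hP => hP.trans a.2 (.of_base ⟨ha, hb, .inr hab⟩ n)

end Closure

section Reach

theorem row_index_inj {n a b c d : ℕ} (hb : b < n) (hd : d < n)
    (h : a * n + b = c * n + d) : a = c ∧ b = d := by
  have hn : 0 < n := by omega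
  have h1 := congrArg (· / n) h
  have h2 := congrArg (· % n) h
  simp only [mul_comm _ n, Nat.mul_add_div hn, Nat.div_eq_of_lt hb, Nat.div_eq_of_lt hd,
    Nat.mul_add_mod, Nat.mod_eq_of_lt hb, Nat.mod_eq_of_lt hd] at h1 h2
  exact ⟨by simpa using h1, h2⟩

theorem matrix_index_inj {n k u v k' u' v' : ℕ} (hu : u < n) (hv : v < n) (hu' : u' < n)
    (hv' : v' < n) (h : (k * n + u) * n + v = (k' * n + u') * n + v') :
    k = k' ∧ u = u' ∧ v = v' := by
  obtain ⟨h1, h2⟩ := row_index_inj hv hv' h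
  obtain ⟨h3, h4⟩ := row_index_inj hu hu' h1
  exact ⟨h3, h4, h2⟩

/-- The index of an entry of the `k`-th matrix of connections, for `k` in register `4`. -/
def connIdx (u v : Expr) : Expr := matIdx (matIdx (.var 4) u) v

/-- Initialize the matrix of connections that avoid the vertex in register `4`. -/
def connInit : Prog :=
  forLoop 5 (forLoop 6 (.put 3 (connIdx (.var 5) (.var 6))
    (.mul (.mul (.eq (.get 2 (.var 5)) (.num 1)) (.eq (.get 2 (.var 6)) (.num 1)))
      (.mul (.mul (.eq (.eq (.var 5) (.var 4)) (.num 0)) (.eq (.eq (.var 6) (.var 4)) (.num 0)))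
        (.lt (.num 0) (.add (.eq (.var 5) (.var 6)) (.get 0 (matIdx (.var 5) (.var 6)))))))))

/-- Add the connections through the vertex in register `7`. -/
def connRound : Prog :=
  forLoop 5 (forLoop 6 (.ite
    (.mul (.get 3 (connIdx (.var 5) (.var 7))) (.get 3 (connIdx (.var 7) (.var 6))))
    (.put 3 (connIdx (.var 5) (.var 6)) (.num 1)) .skip))

/-- Compute the matrix of connections that avoid the vertex in register `4`. -/
def connMatrix : Prog := .seq connInit (forLoop 7 connRound)

/-- Compute all matrices of connections. -/
def connAll : Prog := .seq (.seq (.assign 4 (.var 0)) connMatrix) (forLoop 4 connMatrix)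

variable {n s : ℕ} {G : SimpleGraph (Fin n)} {st : State (Fin n)} {σ τ : Store}

/-- The registers and arrays that the computation of one matrix does not touch. -/
def KeepConn (n k : ℕ) (σ τ : Store) : Prop :=
  Keep (· < 5) (· ≠ 3) σ τ ∧ ∀ k' u v : ℕ, u < n → v < n → k' ≠ k →
    τ.arr 3 ((k' * n + u) * n + v) = σ.arr 3 ((k' * n + u) * n + v)

theorem KeepConn.refl (n k : ℕ) (σ : Store) : KeepConn n k σ σ :=
  ⟨.refl _ _ σ, fun _ _ _ _ _ _ => rfl⟩

theorem KeepConn.trans {k : ℕ} {υ : Store} (h : KeepConn n k σ τ) (h' : KeepConn n k τ υ) :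
    KeepConn n k σ υ :=
  ⟨h.1.trans h'.1, fun k' u v hu hv hk => (h'.2 k' u v hu hv hk).trans (h.2 k' u v hu hv hk)⟩

theorem KeepConn.setVar {k x v : ℕ} (h : KeepConn n k σ τ) (hx : 5 ≤ x) :
    KeepConn n k σ (τ.setVar x v) := ⟨h.1.setVar (by omega), h.2⟩

theorem KeepConn.setArr {k u v w : ℕ} (hu : u < n) (hv : v < n) (h : KeepConn n k σ τ) :
    KeepConn n k σ (τ.setArr 3 ((k * n + u) * n + v) w) := by
  refine ⟨h.1.setArr (by simp), fun k' u' v' hu' hv' hk => ?_⟩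
  rw [Store.setArr_arr, if_neg, h.2 k' u' v' hu' hv' hk]
  rintro ⟨-, he⟩
  exact hk (matrix_index_inj hu' hv' hu hv he).1

theorem setArr_conn {k k' w : ℕ} {u v u' v' : Fin n} :
    (τ.setArr 3 ((k * n + u) * n + v) w).arr 3 ((k' * n + u') * n + v') =
      if k' = k ∧ u' = u ∧ v' = v then w else τ.arr 3 ((k' * n + u') * n + v') := by
  rw [Store.setArr_arr]
  refine if_congr ⟨fun h => ?_, ?_⟩ rfl rfl
  · obtain ⟨h1, h2, h3⟩ := matrix_index_inj u'.2 v'.2 u.2 v.2 h.2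
    exact ⟨h1, Fin.ext h2, Fin.ext h3⟩
  · rintro ⟨rfl, rfl, rfl⟩
    exact ⟨rfl, rfl⟩

/-- The size `(n + 10) ^ 3` leaves room for `n + 1` matrices with `n ^ 2` entries and for `5 * n +
5` stack rows of length `n`. -/
theorem index_lt (hs : (n + 10) ^ 3 ≤ s) {k u v : ℕ} (hk : k ≤ n) (hu : u < n) (hv : v < n) :
    (k * n + u) * n + v < s := by
  have h1 : k * n ≤ n * n := Nat.mul_le_mul_right n hk
  have h2 : (k * n + u) * n ≤ (n * n + n) * n := Nat.mul_le_mul_right n (by omega)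
  nlinarith

theorem lt_size (hs : (n + 10) ^ 3 ≤ s) : n + 10 < s := by
  nlinarith [sq_nonneg (n : ℤ)]

open Classical in
theorem connInit_does (hs : (n + 10) ^ 3 ≤ s) (hg : HasGraph G σ)
    (hst : ∀ v : Fin n, σ.arr 2 v = st v) {k : ℕ} (hk : k ≤ n) (h4 : σ.vars 4 = k) :
    Does s n connInit σ fun τ => KeepConn n k σ τ ∧ ∀ u v : Fin n,
      τ.arr 3 ((k * n + u) * n + v) = if AdjIn G (solAvoid st k) u v then 1 else 0 := by
  have hs' := lt_size hs
  refine Does.forLoop₂ (fun i j τ => KeepConn n k σ τ ∧ ∀ u v : Fin n,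
    ((u : ℕ) < i ∨ (u : ℕ) = i ∧ (v : ℕ) < j) →
      τ.arr 3 ((k * n + u) * n + v) = if AdjIn G (solAvoid st k) u v then 1 else 0)
    (by omega) (by omega) (by omega) hg.order (by omega) ?_ ?_ ?_ ?_ ?_ ?_
  · exact fun i j τ v h => ⟨h.1.setVar (by omega), h.2⟩
  · exact fun i j τ v h => ⟨h.1.setVar (by omega), h.2⟩
  · exact ⟨.refl n k σ, fun u v h => by omega⟩
  · refine fun i τ h => ⟨h.1, fun u v huv => h.2 u v ?_⟩
    have := v.2
    omega
  · rintro i hi j hj τ h0 h5 h6 ⟨hK, hE⟩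
    have h4' : τ.vars 4 = k := (hK.1.vars 4 (by omega)).trans h4
    have e1 : (connIdx (.var 5) (.var 6)).eval τ =
        (k * n + (⟨i, hi⟩ : Fin n)) * n + (⟨j, hj⟩ : Fin n) := by
      simp [connIdx, matIdx, Expr.eval, h0, h4', h5, h6]
    have a0 := hg.adj ⟨i, hi⟩ ⟨j, hj⟩
    have a1 := hst ⟨i, hi⟩
    have a2 := hst ⟨j, hj⟩
    rw [← hK.1.arr 0 (by omega)] at a0
    rw [← hK.1.arr 2 (by omega)] at a1 a2
    have e2 : (Expr.mul (.mul (.eq (.get 2 (.var 5)) (.num 1)) (.eq (.get 2 (.var 6)) (.num 1)))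
      (.mul (.mul (.eq (.eq (.var 5) (.var 4)) (.num 0)) (.eq (.eq (.var 6) (.var 4)) (.num 0)))
        (.lt (.num 0)
          (.add (.eq (.var 5) (.var 6)) (.get 0 (matIdx (.var 5) (.var 6))))))).eval τ =
        if AdjIn G (solAvoid st k) ⟨i, hi⟩ ⟨j, hj⟩ then 1 else 0 := by
      simp only [Expr.eval, matIdx, h0, h4', h5, h6]
      simp only at a0 a1 a2
      rw [a0, a1, a2]
      simp only [AdjIn, solAvoid, Set.mem_ofPred_eq, Fin.mk.injEq]
      by_cases c1 : st ⟨i, hi⟩ = 1 <;> by_cases c2 : st ⟨j, hj⟩ = 1 <;> by_cases c3 : i = k <;>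
        by_cases c4 : j = k <;> by_cases c5 : i = j <;> by_cases c6 : G.Adj ⟨i, hi⟩ ⟨j, hj⟩ <;>
        simp [c1, c2, c3, c4, c5, c6]
    refine Does.put ?_ ?_ ?_
    · rw [e1]; exact index_lt hs hk hi hj
    · rw [e2]; split_ifs <;> omega
    · rw [e1, e2]
      refine ⟨h0, h5, h6, hK.setArr hi hj, fun u v huv => ?_⟩
      rw [setArr_conn]
      by_cases c : u = ⟨i, hi⟩ ∧ v = ⟨j, hj⟩
      · rw [if_pos ⟨rfl, c⟩, c.1, c.2]
      · rw [if_neg fun h => c h.2]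
        refine hE u v ?_
        rw [Fin.ext_iff, Fin.ext_iff] at c
        simp only at c
        omega
  · rintro τ - ⟨hK, hE⟩
    exact ⟨hK, fun u v => hE u v (.inl u.2)⟩

/-- The entries of the `k`-th matrix are bits, and only connections are marked. -/
def ConnSound (G : SimpleGraph (Fin n)) (st : State (Fin n)) (k : ℕ) (τ : Store) : Prop :=
  ∀ u v : Fin n, τ.arr 3 ((k * n + u) * n + v) = 0 ∨
    τ.arr 3 ((k * n + u) * n + v) = 1 ∧ Linked G (solAvoid st k) u v

/-- The round works in place. This is safe since marks are only added where a connection exists and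
are never erased; it does not matter whether an entry is read before or after its update in the same
round. -/
theorem connRound_does (hs : (n + 10) ^ 3 ≤ s) (h0 : σ.vars 0 = n) {k : ℕ} (hk : k ≤ n)
    (h4 : σ.vars 4 = k) (m : Fin n) (h7 : σ.vars 7 = m) (hc : ConnSound G st k σ) :
    Does s n connRound σ fun τ => (KeepConn n k σ τ ∧ τ.vars 7 = m ∧ ConnSound G st k τ) ∧
      (∀ u v : Fin n, σ.arr 3 ((k * n + u) * n + v) = 1 → τ.arr 3 ((k * n + u) * n + v) = 1) ∧
      ∀ u v : Fin n, σ.arr 3 ((k * n + u) * n + m) = 1 → σ.arr 3 ((k * n + m) * n + v) = 1 →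
        τ.arr 3 ((k * n + u) * n + v) = 1 := by
  have hs' := lt_size hs
  refine Does.forLoop₂ (fun i j τ => (KeepConn n k σ τ ∧ τ.vars 7 = m ∧ ConnSound G st k τ) ∧
      (∀ u v : Fin n, σ.arr 3 ((k * n + u) * n + v) = 1 → τ.arr 3 ((k * n + u) * n + v) = 1) ∧
      ∀ u v : Fin n, ((u : ℕ) < i ∨ (u : ℕ) = i ∧ (v : ℕ) < j) →
        σ.arr 3 ((k * n + u) * n + m) = 1 → σ.arr 3 ((k * n + m) * n + v) = 1 →
          τ.arr 3 ((k * n + u) * n + v) = 1)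
    (by omega) (by omega) (by omega) h0 (by omega) ?_ ?_ ?_ ?_ ?_ ?_
  · exact fun i j τ v h => ⟨⟨h.1.1.setVar (by omega), by simpa using h.1.2.1, h.1.2.2⟩, h.2⟩
  · exact fun i j τ v h => ⟨⟨h.1.1.setVar (by omega), by simpa using h.1.2.1, h.1.2.2⟩, h.2⟩
  · exact ⟨⟨.refl n k σ, h7, hc⟩, fun u v h => h, fun u v h => by omega⟩
  · refine fun i τ h => ⟨h.1, h.2.1, fun u v huv => h.2.2 u v ?_⟩
    have := v.2
    omega
  · rintro i hi j hj τ g0 g5 g6 ⟨⟨hK, g7, hS⟩, hM, hE⟩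
    have g4 : τ.vars 4 = k := (hK.1.vars 4 (by omega)).trans h4
    have e1 : (connIdx (.var 5) (.var 6)).eval τ =
        (k * n + (⟨i, hi⟩ : Fin n)) * n + (⟨j, hj⟩ : Fin n) := by
      simp [connIdx, matIdx, Expr.eval, g0, g4, g5, g6]
    have e2 : (Expr.mul (.get 3 (connIdx (.var 5) (.var 7)))
        (.get 3 (connIdx (.var 7) (.var 6)))).eval τ =
        τ.arr 3 ((k * n + (⟨i, hi⟩ : Fin n)) * n + m) *
          τ.arr 3 ((k * n + m) * n + (⟨j, hj⟩ : Fin n)) := by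
      simp [connIdx, matIdx, Expr.eval, g0, g4, g5, g6, g7]
    refine Does.ite (fun h => ?_) fun h => Does.skip ⟨g0, g5, g6, ⟨hK, g7, hS⟩, hM, ?_⟩
    · rw [e2] at h
      have l1 := (hS ⟨i, hi⟩ m).resolve_left (left_ne_zero_of_mul h)
      have l2 := (hS m ⟨j, hj⟩).resolve_left (right_ne_zero_of_mul h)
      refine Does.put (by rw [e1]; exact index_lt hs hk hi hj) (by simp [Expr.eval]; omega) ?_
      rw [e1, show (Expr.num 1).eval τ = 1 from rfl]
      refine ⟨g0, g5, g6, ⟨hK.setArr hi hj, g7, fun u v => ?_⟩, fun u v huv => ?_,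
        fun u v huv h1 h2 => ?_⟩
      · rw [setArr_conn]
        by_cases c : u = ⟨i, hi⟩ ∧ v = ⟨j, hj⟩
        · rw [if_pos ⟨rfl, c⟩, c.1, c.2]
          exact .inr ⟨rfl, l1.2.trans l2.2⟩
        · rw [if_neg fun h => c h.2]
          exact hS u v
      · rw [setArr_conn]
        split_ifs
        · rfl
        · exact hM u v huv
      · rw [setArr_conn]
        by_cases c : u = ⟨i, hi⟩ ∧ v = ⟨j, hj⟩
        · rw [if_pos ⟨rfl, c⟩]
        · rw [if_neg fun h => c h.2]
          refine hE u v ?_ h1 h2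
          rw [Fin.ext_iff, Fin.ext_iff] at c
          simp only at c
          omega
    · intro u v huv h1 h2
      by_cases c : u = ⟨i, hi⟩ ∧ v = ⟨j, hj⟩
      · rw [c.1] at h1
        rw [c.2] at h2
        rw [e2, hM _ _ h1, hM _ _ h2] at h
        omega
      · refine hE u v ?_ h1 h2
        rw [Fin.ext_iff, Fin.ext_iff] at c
        simp only at c
        omega
  · rintro τ - ⟨h1, h2, h3⟩
    exact ⟨h1, h2, fun u v => h3 u v (.inl u.2)⟩

open Classical in
theorem connMatrix_does (hs : (n + 10) ^ 3 ≤ s) (hg : HasGraph G σ)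
    (hst : ∀ v : Fin n, σ.arr 2 v = st v) {k : ℕ} (hk : k ≤ n) (h4 : σ.vars 4 = k) :
    Does s n connMatrix σ fun τ => KeepConn n k σ τ ∧ ∀ u v : Fin n,
      τ.arr 3 ((k * n + u) * n + v) = if Linked G (solAvoid st k) u v then 1 else 0 := by
  have hs' := lt_size hs
  refine Does.seq ((connInit_does hs hg hst hk h4).mono ?_)
  rintro τ ⟨hK, hE⟩
  refine Does.forLoop (fun m υ => KeepConn n k σ υ ∧ ConnSound G st k υ ∧ ∀ u v : Fin n,
      PathBelow (AdjIn G (solAvoid st k)) m u v → υ.arr 3 ((k * n + u) * n + v) = 1)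
    (by omega) ((hK.1.vars 0 (by omega)).trans hg.order) (by omega)
    ⟨hK.setVar (by omega), fun u v => ?_, fun u v h => ?_⟩ ?_ ?_
  · rw [Store.setVar_arr, hE]
    by_cases h : AdjIn G (solAvoid st k) u v
    · exact .inr ⟨if_pos h, h.linked⟩
    · exact .inl (if_neg h)
  · rw [Store.setVar_arr, hE]
    exact if_pos h
  · rintro m hm υ g0 g7 ⟨hK', hS, hP⟩
    refine (connRound_does hs g0 hk ((hK'.1.vars 4 (by omega)).trans h4) ⟨m, hm⟩ g7 hS).mono ?_
    rintro ω ⟨⟨k1, k2, k3⟩, k4, k5⟩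
    refine ⟨(k1.1.vars 0 (by omega)).trans g0, k2, (hK'.trans k1).setVar (by omega), k3,
      fun u v h => ?_⟩
    rcases h with h | ⟨_, h, h'⟩
    · exact k4 u v (hP u v h)
    · exact k5 u v (hP _ _ h) (hP _ _ h')
  · rintro υ - ⟨hK', hS, hP⟩
    refine ⟨hK', fun u v => ?_⟩
    by_cases h : Linked G (solAvoid st k) u v
    · rw [if_pos h, hP u v h.pathBelow]
    · rw [if_neg h]
      exact (hS u v).resolve_right fun h' => h h'.2

theorem connAll_does (hs : (n + 10) ^ 3 ≤ s) (hg : HasGraph G σ)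
    (hst : ∀ v : Fin n, σ.arr 2 v = st v) :
    Does s n connAll σ fun τ => Keep (· < 4) (· ≠ 3) σ τ ∧ HasState G st τ := by
  classical
  have hs' := lt_size hs
  have hm : ∀ τ, Keep (· < 4) (· ≠ 3) σ τ → HasGraph G τ ∧ ∀ v : Fin n, τ.arr 2 v = st v :=
    fun τ h => ⟨hg.keep h (by omega) (by omega), by rw [h.arr 2 (by omega)]; exact hst⟩
  have hk1 := (Keep.refl (· < 4) (· ≠ 3) σ).setVar (x := 4) (v := n) (by omega)
  -- The index `n` is not a vertex, so the first matrix avoids nothing and describes the components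
  -- of the whole solution.
  refine Does.seq (Does.seq (Does.assign (by simp [Expr.eval, hg.order]; omega) ?_))
  simp only [Expr.eval, hg.order]
  refine (connMatrix_does hs (hm _ hk1).1 (hm _ hk1).2 le_rfl (by simp)).mono ?_
  rintro τ ⟨hK, hE⟩
  have hk2 := hk1.trans (hK.1.mono (R' := (· < 4)) (fun r hr => by omega) fun a ha => ha)
  refine Does.forLoop (fun m υ => Keep (· < 4) (· ≠ 3) σ υ ∧ ∀ k ≤ n, (k < m ∨ k = n) →
      ∀ u v : Fin n, υ.arr 3 ((k * n + u) * n + v) =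
        if Linked G (solAvoid st k) u v then 1 else 0)
    (by omega) (hm _ hk2).1.order (by omega) ⟨hk2.setVar (by omega), ?_⟩ ?_ ?_
  · rintro k - (h | rfl) u v
    · omega
    · rw [Store.setVar_arr, hE]
  · rintro m hmn υ g0 g4 ⟨hK', hE'⟩
    refine (connMatrix_does hs (hm _ hK').1 (hm _ hK').2 hmn.le g4).mono ?_
    rintro ω ⟨k1, k2⟩
    refine ⟨(k1.1.vars 0 (by omega)).trans g0, (k1.1.vars 4 (by omega)).trans g4,
      (hK'.trans (k1.1.mono (fun r hr => by omega) fun a ha => ha)).setVar (by omega),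
      fun k hk hkm u v => ?_⟩
    rw [Store.setVar_arr]
    by_cases h : k = m
    · rw [h, k2]
    · rw [k1.2 k u v u.2 v.2 h, hE' k hk (by omega)]
  · rintro υ - ⟨hK', hE'⟩
    refine ⟨hK', (hm _ hK').2, fun k hk u v => hE' k hk (by omega) u v⟩

end Reach

/-! ## The stack of states -/

section Stack

variable {n s : ℕ} {G : SimpleGraph (Fin n)} {st c : State (Fin n)} {σ τ : Store}
  {l : List (State (Fin n))} {env : ℕ → Fin n}

/-- The stack holds the states `l`. -/
structure HasStack (l : List (State (Fin n))) (σ : Store) : Prop where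
  size : σ.vars 1 = l.length
  row : ∀ k (h : k < l.length) (v : Fin n), σ.arr 1 (k * n + v) = l[k] v

/-- The stack holds the states `l`, and the next row holds the state `c`. -/
def HasTop (l : List (State (Fin n))) (c : State (Fin n)) (σ : Store) : Prop :=
  HasStack l σ ∧ ∀ v : Fin n, σ.arr 1 (l.length * n + v) = c v

/-- The index of a cell in the row above the stack. -/
def topIdx (e : Expr) : Expr := matIdx (.var 1) e

theorem HasStack.setVar {x v : ℕ} (h : HasStack l σ) (hx : x ≠ 1) :
    HasStack l (σ.setVar x v) := ⟨by simp [hx.symm, h.size], h.row⟩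

theorem HasStack.congr (h : HasStack l σ) (h1 : τ.vars 1 = σ.vars 1) (h2 : τ.arr 1 = σ.arr 1) :
    HasStack l τ := ⟨h1.trans h.size, by rw [h2]; exact h.row⟩

theorem HasStack.setTop (h : HasStack l σ) (v : Fin n) (w : ℕ) :
    HasStack l (σ.setArr 1 (l.length * n + v) w) := by
  refine ⟨h.size, fun k hk u => ?_⟩
  rw [Store.setArr_arr, if_neg, h.row k hk u]
  rintro ⟨-, he⟩
  have := (row_index_inj u.2 v.2 he).1
  omega

theorem HasTop.setTop (h : HasTop l c σ) (v : Fin n) (w : ℕ) :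
    HasTop l (Function.update c v w) (σ.setArr 1 (l.length * n + v) w) := by
  refine ⟨h.1.setTop v w, fun u => ?_⟩
  rw [Store.setArr_arr, h.2 u]
  by_cases huv : u = v
  · rw [huv, if_pos ⟨rfl, rfl⟩, Function.update_self]
  · rw [Function.update_of_ne huv, if_neg]
    rintro ⟨-, he⟩
    exact huv (Fin.ext (row_index_inj u.2 v.2 he).2)

theorem top_lt (hs : (n + 10) ^ 3 ≤ s) {k : ℕ} (hk : k ≤ 5 * n + 4) (v : Fin n) :
    k * n + v < s := by
  have h1 : k * n ≤ (5 * n + 4) * n := Nat.mul_le_mul_right n hk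
  have := v.2
  nlinarith

/-- The variables of a decision are in scope. -/
def Op.Scoped : Op → Prop
  | take i => i < 4
  | drop i => i < 4
  | clear i => i < 4

/-- Apply a decision to the row above the stack. -/
def Op.prog : Op → Prog
  | take i => .put 1 (topIdx (varReg i)) (.num 1)
  | drop i => .put 1 (topIdx (varReg i)) (.num 2)
  | clear i => forLoop 12 (.ite
      (.mul (.get 0 (matIdx (varReg i) (.var 12))) (.eq (.get 1 (topIdx (.var 12))) (.num 0)))
      (.put 1 (topIdx (.var 12)) (.num 2)) .skip)

theorem setTop_does (hs : (n + 10) ^ 3 ≤ s) (hg : HasGraph G σ) (hl : l.length ≤ 5 * n + 4)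
    (ht : HasTop l c σ) {e : Expr} {v : Fin n} (he : e.eval σ = v) {k : ℕ} (hk : k ≤ 2) :
    Does s n (.put 1 (topIdx e) (.num k)) σ fun τ =>
      Keep (fun _ => True) (· ≠ 1) σ τ ∧ HasTop l (Function.update c v k) τ := by
  have hs' := lt_size hs
  have e1 : (topIdx e).eval σ = l.length * n + v := by
    simp [topIdx, matIdx, Expr.eval, hg.order, ht.1.size, he]
  refine Does.put (by rw [e1]; exact top_lt hs hl v) (by simp [Expr.eval]; omega) ?_
  rw [e1]
  exact ⟨(Keep.refl _ _ σ).setArr (by simp), ht.setTop v k⟩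

theorem Op.prog_does (hs : (n + 10) ^ 3 ≤ s) (hg : HasGraph G σ) (hl : l.length ≤ 5 * n + 4)
    (henv : ∀ i < 4, σ.vars (2 * i + 4) = env i) {o : Op} (ho : o.Scoped)
    (ht : HasTop l c σ) :
    Does s n o.prog σ fun τ =>
      Keep (· < 12) (· ≠ 1) σ τ ∧ HasTop l (o.apply G env c) τ := by
  classical
  have hs' := lt_size hs
  cases o with
  | take i =>
    exact (setTop_does hs hg hl ht (e := varReg i) (v := env i) (henv i ho) (by omega)).mono
      fun τ h => ⟨h.1.mono (fun _ _ => trivial) fun _ h => h, h.2⟩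
  | drop i =>
    exact (setTop_does hs hg hl ht (e := varReg i) (v := env i) (henv i ho) (by omega)).mono
      fun τ h => ⟨h.1.mono (fun _ _ => trivial) fun _ h => h, h.2⟩
  | clear i =>
    refine Does.forLoop (fun m τ => Keep (· < 12) (· ≠ 1) σ τ ∧
      HasTop l (fun u => if (u : ℕ) < m ∧ c u = 0 ∧ G.Adj (env i) u then 2 else c u) τ)
      (by omega) hg.order (by omega) ⟨(Keep.refl _ _ σ).setVar (by omega), ?_⟩ ?_ ?_
    · simpa using ⟨ht.1.setVar (by omega), ht.2⟩
    · rintro m hm τ g0 g12 ⟨hK, hT⟩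
      have hg' := hg.keep hK (by omega) (by omega)
      have a0 := hg'.adj (env i) ⟨m, hm⟩
      have a1 := hT.2 ⟨m, hm⟩
      simp only [lt_self_iff_false, false_and, if_false] at a0 a1
      have hi : i < 4 := ho
      have e1 : (Expr.mul (.get 0 (matIdx (varReg i) (.var 12)))
          (.eq (.get 1 (topIdx (.var 12))) (.num 0))).eval τ =
          if c ⟨m, hm⟩ = 0 ∧ G.Adj (env i) ⟨m, hm⟩ then 1 else 0 := by
        simp only [Expr.eval, matIdx, varReg, topIdx, g0, g12, hT.1.size,
          (hK.vars (2 * i + 4) (by omega)).trans (henv i hi)]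
        rw [a0, a1]
        by_cases h1 : c ⟨m, hm⟩ = 0 <;> by_cases h2 : G.Adj (env i) ⟨m, hm⟩ <;> simp [h1, h2]
      refine Does.ite (fun h => ?_) fun h => Does.skip ⟨g0, g12, hK.setVar (by omega), ?_⟩
      · have hc : c ⟨m, hm⟩ = 0 ∧ G.Adj (env i) ⟨m, hm⟩ := by
          by_contra hc
          simp [e1, hc] at h
        refine (setTop_does hs hg' hl hT (e := .var 12) (v := ⟨m, hm⟩) g12 le_rfl).mono
          fun υ hυ => ⟨(hυ.1.vars 0 trivial).trans g0, (hυ.1.vars 12 trivial).trans g12,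
            (hK.trans (hυ.1.mono (fun _ _ => trivial) fun _ h => h)).setVar (by omega), ?_⟩
        · refine ⟨hυ.2.1.setVar (by omega), fun u => ?_⟩
          rw [Store.setVar_arr, hυ.2.2 u]
          by_cases hu : u = ⟨m, hm⟩
          · subst hu
            simp [hc]
          · rw [Function.update_of_ne hu]
            have : (u : ℕ) ≠ m := fun e => hu (Fin.ext e)
            refine if_congr (and_congr_left fun _ => ?_) rfl rfl
            omega
      · have hc : ¬ (c ⟨m, hm⟩ = 0 ∧ G.Adj (env i) ⟨m, hm⟩) := by
          intro hc
          simp [e1, hc] at h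
        refine ⟨hT.1.setVar (by omega), fun u => ?_⟩
        rw [Store.setVar_arr, hT.2 u]
        refine if_congr (and_congr_left fun hu => ?_) rfl rfl
        have : (u : ℕ) ≠ m := by
          rintro rfl
          exact hc hu
        omega
    · rintro τ - ⟨hK, hT⟩
      refine ⟨hK, hT.1, fun u => ?_⟩
      rw [hT.2 u]
      simp [Op.apply, clearNbrs]

/-- Apply a list of decisions to the row above the stack. -/
def opsProg : List Op → Prog
  | [] => .skip
  | o :: ops => .seq o.prog (opsProg ops)

theorem opsProg_does (hs : (n + 10) ^ 3 ≤ s) (hl : l.length ≤ 5 * n + 4) (ops : List Op) :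
    ∀ {c : State (Fin n)} {σ : Store}, HasGraph G σ → (∀ i < 4, σ.vars (2 * i + 4) = env i) →
      (∀ o ∈ ops, o.Scoped) → HasTop l c σ →
      Does s n (opsProg ops) σ fun τ =>
        Keep (· < 12) (· ≠ 1) σ τ ∧ HasTop l (applyOps G env c ops) τ := by
  induction ops with
  | nil => exact fun _ _ _ ht => Does.skip ⟨.refl _ _ _, ht⟩
  | cons o ops ih =>
    intro c σ hg henv ho ht
    refine Does.seq ((Op.prog_does hs hg hl henv (ho o (by simp)) ht).mono ?_)
    rintro τ ⟨hK, hT⟩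
    refine (ih (hg.keep hK (by omega) (by omega)) (fun i hi => ?_)
      (fun o h => ho o (by simp [h])) hT).mono fun υ hυ => ⟨hK.trans hυ.1, hυ.2⟩
    exact (hK.vars _ (by omega)).trans (henv i hi)

/-- Push the state that arises by a list of decisions. -/
def pushChild (ops : List Op) : Prog :=
  .seq (forLoop 12 (.put 1 (topIdx (.var 12)) (.get 2 (.var 12))))
    (.seq (opsProg ops) (.assign 1 (.add (.var 1) (.num 1))))

theorem HasTop.push (h : HasTop l c σ) : HasStack (l ++ [c]) (σ.setVar 1 (l.length + 1)) := by
  refine ⟨by simp, fun k hk v => ?_⟩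
  rw [Store.setVar_arr]
  rw [List.length_append, List.length_singleton] at hk
  by_cases hkl : k < l.length
  · rw [List.getElem_append_left hkl, h.1.row k hkl v]
  · obtain rfl : k = l.length := by omega
    simp [h.2 v]

theorem pushChild_does (hs : (n + 10) ^ 3 ≤ s) (hl : l.length ≤ 5 * n + 4) (hg : HasGraph G σ)
    (henv : ∀ i < 4, σ.vars (2 * i + 4) = env i) {ops : List Op} (ho : ∀ o ∈ ops, o.Scoped)
    (hw : ∀ v : Fin n, σ.arr 2 v = st v) (hst : ∀ v, st v < 3) (hS : HasStack l σ) :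
    Does s n (pushChild ops) σ fun τ => Keep (fun r => r < 12 ∧ r ≠ 1) (· ≠ 1) σ τ ∧
      HasStack (l ++ [applyOps G env st ops]) τ := by
  have hs' := lt_size hs
  have h5 : 5 * n + 5 < s := by
    have : (n + 10) * 100 ≤ (n + 10) * ((n + 10) * (n + 10)) :=
      Nat.mul_le_mul_left _ (Nat.mul_le_mul (by omega : 10 ≤ n + 10) (by omega : 10 ≤ n + 10))
    have : (n + 10) ^ 3 = (n + 10) * ((n + 10) * (n + 10)) := by ring
    omega
  refine Does.seq (Does.forLoop (fun m τ => Keep (· < 12) (· ≠ 1) σ τ ∧ HasStack l τ ∧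
    ∀ v : Fin n, (v : ℕ) < m → τ.arr 1 (l.length * n + v) = st v) (by omega) hg.order (by omega)
    ⟨(Keep.refl _ _ σ).setVar (by omega), hS.setVar (by omega), fun v hv => by omega⟩ ?_ ?_)
  · rintro m hm τ g0 g12 ⟨hK, hT, hE⟩
    have e1 : (topIdx (.var 12)).eval τ = l.length * n + (⟨m, hm⟩ : Fin n) := by
      simp [topIdx, matIdx, Expr.eval, g0, g12, hT.size]
    have e2 : (Expr.get 2 (.var 12)).eval τ = st ⟨m, hm⟩ := by
      rw [← hw, ← hK.arr 2 (by omega)]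
      simp [Expr.eval, g12]
    refine Does.put (by rw [e1]; exact top_lt hs hl _) (by rw [e2]; have := hst ⟨m, hm⟩; omega) ?_
    rw [e1, e2]
    refine ⟨g0, g12, (hK.setArr (by simp)).setVar (by omega), (hT.setTop _ _).setVar (by omega),
      fun v hv => ?_⟩
    rw [Store.setVar_arr, Store.setArr_arr]
    by_cases hvm : v = ⟨m, hm⟩
    · rw [hvm, if_pos ⟨rfl, rfl⟩]
    · rw [if_neg, hE v]
      · have : (v : ℕ) ≠ m := fun e => hvm (Fin.ext e)
        omega
      · rintro ⟨-, he⟩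
        exact hvm (Fin.ext (row_index_inj v.2 hm he).2)
  · rintro τ - ⟨hK, hT, hE⟩
    refine Does.seq ((opsProg_does hs hl ops (hg.keep hK (by omega) (by omega))
      (fun i hi => (hK.vars _ (by omega)).trans (henv i hi)) ho
      ⟨hT, fun v => hE v v.2⟩).mono ?_)
    rintro υ ⟨hK', hT'⟩
    have e : (Expr.add (.var 1) (.num 1)).eval υ = l.length + 1 := by
      simp [Expr.eval, hT'.1.size]
    refine Does.assign (by rw [e]; omega) ?_
    rw [e]
    exact ⟨((hK.trans hK').mono (fun r hr => hr.1) fun a ha => ha).setVar (by omega), hT'.push⟩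

/-- Push the states that arise by lists of decisions. -/
def pushAll : List (List Op) → Prog
  | [] => .skip
  | ops :: cs => .seq (pushChild ops) (pushAll cs)

theorem pushAll_does (hs : (n + 10) ^ 3 ≤ s) (hst : ∀ v, st v < 3) (cs : List (List Op)) :
    ∀ {l : List (State (Fin n))} {σ : Store}, l.length + cs.length ≤ 5 * n + 5 → HasGraph G σ →
      (∀ i < 4, σ.vars (2 * i + 4) = env i) → (∀ ops ∈ cs, ∀ o ∈ ops, o.Scoped) →
      (∀ v : Fin n, σ.arr 2 v = st v) → HasStack l σ →
      Does s n (pushAll cs) σ fun τ => Keep (fun r => r < 12 ∧ r ≠ 1) (· ≠ 1) σ τ ∧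
        HasStack (l ++ cs.map (applyOps G env st)) τ := by
  induction cs with
  | nil => exact fun _ _ _ _ _ hS => Does.skip ⟨.refl _ _ _, by simpa using hS⟩
  | cons ops cs ih =>
    intro l σ hl hg henv ho hw hS
    rw [List.length_cons] at hl
    refine Does.seq ((pushChild_does hs (by omega) hg henv (ho ops (by simp)) hw hst hS).mono ?_)
    rintro τ ⟨hK, hT⟩
    refine (ih (by simp; omega) (hg.keep hK (by omega) (by omega))
      (fun i hi => (hK.vars _ (by omega)).trans (henv i hi)) (fun ops h => ho ops (by simp [h]))
      (by rw [hK.arr 2 (by omega)]; exact hw) hT).mono fun υ hυ => ⟨hK.trans hυ.1, ?_⟩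
    simpa using hυ.2

end Stack

/-! ## The search for an applicable rule -/

instance Fml.decidableScoped : (φ : Fml) → (d : ℕ) → Decidable (φ.Scoped d)
  | adj i j, d => inferInstanceAs (Decidable (i < d ∧ j < d))
  | st i _, d => inferInstanceAs (Decidable (i < d))
  | eq i j, d => inferInstanceAs (Decidable (i < d ∧ j < d))
  | conn i j, d => inferInstanceAs (Decidable (i < d ∧ j < d))
  | connAvoid k i j, d => inferInstanceAs (Decidable (k < d ∧ i < d ∧ j < d))
  | neg φ, d => decidableScoped φ d
  | and φ ψ, d => @instDecidableAnd _ _ (decidableScoped φ d) (decidableScoped ψ d)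
  | ex φ, d => decidableScoped φ (d + 1)

instance Op.decidableScoped : (o : Op) → Decidable o.Scoped
  | take i => inferInstanceAs (Decidable (i < 4))
  | drop i => inferInstanceAs (Decidable (i < 4))
  | clear i => inferInstanceAs (Decidable (i < 4))

/-- A rule is well-formed: its variables are in scope, and there are at most five cases. -/
def RuleScoped (ρ : Fml × List (List Op)) : Prop :=
  ρ.1.Scoped 4 ∧ (∀ ops ∈ ρ.2, ∀ o ∈ ops, o.Scoped) ∧ ρ.2.length ≤ 5

theorem ruleScoped_of_mem_rules : ∀ ρ ∈ rules, RuleScoped ρ := by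
  unfold RuleScoped
  decide

/-- Apply a rule to the variables, unless a rule was applied before. -/
def ruleProg (ρ : Fml × List (List Op)) : Prog :=
  -- Register 2 is the flag of success, after which all later attempts run idle. Register 11 is `2 *
  -- 4 + 3`, the truth value at depth 4.
  .ite (.var 2) .skip (.seq (ρ.1.compile 4)
    (.ite (.var 11) (.seq (pushAll ρ.2) (.assign 2 (.num 1))) .skip))

/-- Apply the first rule that is applicable to the variables. -/
def rulesProg : List (Fml × List (List Op)) → Prog
  | [] => .skip
  | ρ :: rs => .seq (ruleProg ρ) (rulesProg rs)

/-- Try the rules with all values of the last `j` variables. -/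
def searchFrom : ℕ → Prog
  | 0 => rulesProg rules
  | j + 1 => forLoop (2 * (3 - j) + 4) (searchFrom j)

section Search

variable {n s : ℕ} {G : SimpleGraph (Fin n)} {st : State (Fin n)} {σ τ : Store}
  {l : List (State (Fin n))} {env : ℕ → Fin n}

/-- The registers that are kept while the rules are tried. -/
def SearchReg (r : ℕ) : Prop := r < 11 ∧ r ≠ 1 ∧ r ≠ 2

theorem rulesProg_done (rs : List (Fml × List (List Op))) (hd : σ.vars 2 = 1) :
    Does s n (rulesProg rs) σ fun τ => τ = σ := by
  induction rs with
  | nil => exact Does.skip rfl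
  | cons ρ rs ih =>
    refine Does.seq (Does.ite (fun _ => Does.skip ih) fun h => ?_)
    simp [Expr.eval, hd] at h

/-- No rule in `rs` was applicable, or one of them was applied. -/
def Tried (G : SimpleGraph (Fin n)) (st : State (Fin n)) (l : List (State (Fin n)))
    (env : ℕ → Fin n) (rs : List (Fml × List (List Op))) (τ : Store) : Prop :=
  (τ.vars 2 = 0 ∧ HasStack l τ ∧ ∀ ρ ∈ rs, ¬ ρ.1.Holds G st 4 env) ∨
    τ.vars 2 = 1 ∧ ∃ ρ ∈ rs, ρ.1.Holds G st 4 env ∧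
      HasStack (l ++ ρ.2.map (applyOps G env st)) τ

theorem rulesProg_does (hs : (n + 10) ^ 3 ≤ s) (hst : ∀ v, st v < 3) (hl : l.length ≤ 5 * n)
    (rs : List (Fml × List (List Op))) (hrs : ∀ ρ ∈ rs, RuleScoped ρ) :
    ∀ {σ : Store}, HasGraph G σ → HasState G st σ → (∀ i < 4, σ.vars (2 * i + 4) = env i) →
      HasStack l σ → σ.vars 2 = 0 →
      Does s n (rulesProg rs) σ fun τ =>
        Keep SearchReg (· ≠ 1) σ τ ∧ Tried G st l env rs τ := by
  classical
  have hs' := lt_size hs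
  induction rs with
  | nil => exact fun {_} _ _ _ hS h2 => Does.skip ⟨.refl _ _ _, .inl ⟨h2, hS, by simp⟩⟩
  | cons ρ rs ih =>
    intro σ hg hh henv hS h2
    obtain ⟨sc1, sc2, sc3⟩ := hrs ρ (by simp)
    refine Does.seq (Does.ite (fun h => absurd h2 h) fun _ => Does.seq
      ((ρ.1.compile_does (by omega) 4 env σ sc1 hg hh henv).mono fun τ hτ => ?_))
    have hK : Keep SearchReg (· ≠ 1) σ τ := hτ.1.keep.mono (fun r hr => hr.1) fun _ h => h
    have h2' : τ.vars 2 = 0 := (hτ.1.vars 2 (by omega)).trans h2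
    have hS' : HasStack l τ := hS.congr (hτ.1.vars 1 (by omega)) (by rw [hτ.1.arr])
    have henv' : ∀ i < 4, τ.vars (2 * i + 4) = env i := fun i hi =>
      (hτ.1.vars _ (by omega)).trans (henv i hi)
    have h11 : (Expr.var 11).eval τ = if ρ.1.Holds G st 4 env then 1 else 0 := hτ.2
    have hg' := hg.frame (by omega) hτ.1
    have hh' := hh.frame hτ.1
    refine Does.ite (fun h => ?_) fun h => Does.skip ?_
    · have hρ : ρ.1.Holds G st 4 env := by
        by_contra hρ
        simp [h11, hρ] at h
      refine Does.seq ((pushAll_does hs hst ρ.2 (by omega) hg' henv' sc2 hh'.state hS').mono ?_)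
      rintro υ ⟨hK', hS''⟩
      refine Does.assign (by simp [Expr.eval]; omega) ?_
      refine (rulesProg_done rs (by simp [Expr.eval])).mono ?_
      rintro _ rfl
      refine ⟨(hK.trans (hK'.mono (fun r hr => ⟨by have := hr.1; omega, hr.2.1⟩)
        fun _ h => h)).setVar (fun h => h.2.2 rfl), .inr ⟨by simp [Expr.eval], ρ, by simp, hρ,
        hS''.setVar (by omega)⟩⟩
    · have hρ : ¬ ρ.1.Holds G st 4 env := by
        intro hρ
        simp [h11, hρ] at h
      refine (ih (fun ρ h => hrs ρ (by simp [h])) hg' hh' henv' hS' h2').mono ?_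
      rintro υ ⟨hK', hT⟩
      refine ⟨hK.trans hK', ?_⟩
      rcases hT with ⟨t1, t2, t3⟩ | ⟨t1, ρ', t2, t3⟩
      · refine .inl ⟨t1, t2, fun ρ' h' => ?_⟩
        rcases List.mem_cons.1 h' with rfl | h'
        exacts [hρ, t3 ρ' h']
      · exact .inr ⟨t1, ρ', by simp [t2], t3⟩

/-- The assignment of the variables given by four vertices. -/
def envOf (f : Fin 4 → Fin n) : ℕ → Fin n := env4 (f 0) (f 1) (f 2) (f 3)

theorem envOf_apply (f : Fin 4 → Fin n) (i : Fin 4) : envOf f i = f i := by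
  fin_cases i <;> rfl

/-- No rule is applicable to the assignments in `D`, or some rule was applied. -/
def Searched (G : SimpleGraph (Fin n)) (st : State (Fin n)) (l : List (State (Fin n)))
    (σ : Store) (D : Set (Fin 4 → Fin n)) (τ : Store) : Prop :=
  Keep (· = 0) (· ≠ 1) σ τ ∧
    ((τ.vars 2 = 0 ∧ HasStack l τ ∧ ∀ f ∈ D, ∀ ρ ∈ rules, ¬ ρ.1.Holds G st 4 (envOf f)) ∨
      τ.vars 2 = 1 ∧ ∃ f, ∃ ρ ∈ rules, ρ.1.Holds G st 4 (envOf f) ∧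
        HasStack (l ++ ρ.2.map (applyOps G (envOf f) st)) τ)

theorem Searched.setVar {D : Set (Fin 4 → Fin n)} {x v : ℕ} (h : Searched G st l σ D τ)
    (hx : 3 ≤ x) : Searched G st l σ D (τ.setVar x v) := by
  refine ⟨h.1.setVar (by omega), ?_⟩
  rcases h.2 with ⟨t1, t2, t3⟩ | ⟨t1, f, ρ, t2, t3, t4⟩
  · exact .inl ⟨by rw [Store.setVar_vars, if_neg (by omega), t1], t2.setVar (by omega), t3⟩
  · exact .inr ⟨by rw [Store.setVar_vars, if_neg (by omega), t1], f, ρ, t2, t3,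
      t4.setVar (by omega)⟩

theorem Searched.mono {D D' : Set (Fin 4 → Fin n)} (h : Searched G st l σ D τ) (hD : D' ⊆ D) :
    Searched G st l σ D' τ :=
  ⟨h.1, h.2.imp_left fun t => ⟨t.1, t.2.1, fun f hf => t.2.2 f (hD hf)⟩⟩

/-- The first `m` variables have the values given by `f`. -/
def FixedVars (m : ℕ) (f : Fin 4 → Fin n) (τ : Store) : Prop :=
  ∀ i : Fin 4, (i : ℕ) < m → τ.vars (2 * i + 4) = f i

/-- `D` collects the assignments tried so far. With the first `4 - j` variables fixed as in `f`, the
remaining loops add all assignments that agree with `f` there. -/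
theorem searchFrom_does (hs : (n + 10) ^ 3 ≤ s) (hst : ∀ v, st v < 3) (hl : l.length ≤ 5 * n)
    (hg : HasGraph G σ) (hh : HasState G st σ) :
    ∀ j ≤ 4, ∀ (f : Fin 4 → Fin n) (D : Set (Fin 4 → Fin n)) (τ : Store),
      FixedVars (4 - j) f τ → Searched G st l σ D τ →
      Does s n (searchFrom j) τ fun υ => FixedVars (4 - j) f υ ∧
        Searched G st l σ (D ∪ {f' | ∀ i : Fin 4, (i : ℕ) < 4 - j → f' i = f i}) υ := by
  have hs' := lt_size hs
  intro j
  induction j with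
  | zero =>
    intro _ f D τ hf hD
    have hset : {f' : Fin 4 → Fin n | ∀ i : Fin 4, (i : ℕ) < 4 - 0 → f' i = f i} = {f} :=
      Set.ext fun f' => ⟨fun h => funext fun i => h i (by omega), fun h i _ => by rw [h]⟩
    rw [hset]
    have henv : ∀ i < 4, τ.vars (2 * i + 4) = envOf f i := fun i hi => by
      rw [hf ⟨i, hi⟩ (by simpa using hi)]
      exact congrArg Fin.val (envOf_apply f ⟨i, hi⟩).symm
    rcases hD.2 with ⟨t1, t2, t3⟩ | ⟨t1, t2⟩
    · refine (rulesProg_does hs hst hl rules ruleScoped_of_mem_rules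
        (hg.keep hD.1 rfl (by omega)) (hh.keep hD.1 (by omega) (by omega)) henv t2 t1).mono ?_
      rintro υ ⟨hK, hT⟩
      refine ⟨fun i hi => ?_, hD.1.trans (hK.mono ?_ fun _ h => h), ?_⟩
      · rw [hK.vars _ ⟨by omega, by omega, by omega⟩, hf i hi]
      · rintro r rfl
        exact ⟨by omega, by omega, by omega⟩
      · rcases hT with ⟨u1, u2, u3⟩ | ⟨u1, ρ, u2, u3⟩
        · refine .inl ⟨u1, u2, fun f' hf' => ?_⟩
          rcases hf' with hf' | rfl
          exacts [t3 f' hf', u3]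
        · exact .inr ⟨u1, f, ρ, u2, u3⟩
    · refine (rulesProg_done rules t1).mono ?_
      rintro _ rfl
      exact ⟨hf, hD.1, .inr ⟨t1, t2⟩⟩
  | succ j ih =>
    intro hj f D τ hf hD
    refine Does.forLoop (fun m υ => FixedVars (4 - (j + 1)) f υ ∧ Searched G st l σ
      (D ∪ {f' | (∀ i : Fin 4, (i : ℕ) < 4 - (j + 1) → f' i = f i) ∧
        (f' ⟨3 - j, by omega⟩ : ℕ) < m}) υ)
      (by omega) ((hD.1.vars 0 rfl).trans hg.order) (by omega) ⟨?_, ?_⟩ ?_ ?_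
    · intro i hi
      rw [Store.setVar_vars, if_neg (by omega), hf i hi]
    · exact (hD.setVar (by omega)).mono (by simp)
    · rintro m hm υ g0 gm ⟨hf', hD'⟩
      refine (ih (by omega) (Function.update f ⟨3 - j, by omega⟩ ⟨m, hm⟩) _ υ ?_ hD').mono ?_
      · intro i hi
        by_cases h : (i : ℕ) = 3 - j
        · rw [show i = ⟨3 - j, by omega⟩ from Fin.ext h, Function.update_self]
          exact gm
        · rw [Function.update_of_ne (fun e => h (congrArg Fin.val e))]
          exact hf' i (by omega)
      · rintro ω ⟨hf'', hD''⟩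
        refine ⟨(hD''.1.vars 0 rfl).trans hg.order, ?_, fun i hi => ?_, ?_⟩
        · have := hf'' ⟨3 - j, by omega⟩ (by simp only; omega)
          rwa [Function.update_self] at this
        · rw [Store.setVar_vars, if_neg (by omega), hf'' i (by omega), Function.update_of_ne]
          intro e
          have := congrArg Fin.val e
          simp only at this
          omega
        · refine (hD''.setVar (by omega)).mono ?_
          rintro f' (h | ⟨h1, h2⟩)
          · exact .inl (.inl h)
          · by_cases h3 : (f' ⟨3 - j, by omega⟩ : ℕ) < m
            · exact .inl (.inr ⟨h1, h3⟩)
            · refine .inr fun i hi => ?_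
              by_cases h : (i : ℕ) = 3 - j
              · rw [show i = ⟨3 - j, by omega⟩ from Fin.ext h, Function.update_self]
                exact Fin.ext (by simp only; omega)
              · rw [Function.update_of_ne (fun e => h (congrArg Fin.val e))]
                exact h1 i (by omega)
    · rintro υ - ⟨hf', hD'⟩
      refine ⟨hf', hD'.mono ?_⟩
      rintro f' (h | h)
      · exact .inl h
      · exact .inr ⟨h, Fin.is_lt _⟩

/-- Apply the first applicable rule, if there is one. -/
def searchProg : Prog := .seq (.assign 2 (.num 0)) (searchFrom 4)

/-- The search covers all assignments of four vertices, so by `exists_rule` it fails only if no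
vertex is undecided. -/
theorem searchProg_does (hs : (n + 10) ^ 3 ≤ s) (hst : ∀ v, st v < 3) (hl : l.length ≤ 5 * n)
    (hG : IsDegenerate G 2) (hsol : ∃ v, st v = 1) (hg : HasGraph G σ) (hh : HasState G st σ)
    (hS : HasStack l σ) :
    Does s n searchProg σ fun τ => Keep (· = 0) (· ≠ 1) σ τ ∧
      ((τ.vars 2 = 1 ∧ ∃ cs, GoodStep G 0.106 0.106 st cs ∧ HasStack (l ++ cs) τ) ∨
        τ.vars 2 = 0 ∧ HasStack l τ ∧ ∀ v, st v ≠ 0) := by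
  have hs' := lt_size hs
  obtain ⟨v, hv⟩ := hsol
  refine Does.seq (Does.assign (by simp [Expr.eval]; omega) ?_)
  refine (searchFrom_does hs hst hl hg hh 4 le_rfl (fun _ => v) ∅ _ (fun i hi => by omega)
    ⟨(Keep.refl _ _ σ).setVar (by omega), .inl ⟨by simp [Expr.eval], hS.setVar (by omega),
      by simp⟩⟩).mono ?_
  rintro τ ⟨-, hK, hT⟩
  refine ⟨hK, ?_⟩
  rcases hT with ⟨t1, t2, t3⟩ | ⟨t1, f, ρ, t2, t3, t4⟩
  · refine .inr ⟨t1, t2, fun u hu => ?_⟩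
    obtain ⟨ρ, hρ, x, y, z, w, h⟩ := exists_rule hG ⟨u, hu⟩
    exact t3 ![x, y, z, w] (.inr fun i hi => by omega) ρ hρ h
  · exact .inl ⟨t1, _, goodStep_of_mem_rules (by norm_num) (by norm_num) (by norm_num)
      (by norm_num) ⟨v, hv⟩ t2 t3, t4⟩

end Search

/-! ## Processing one state -/

open Fml in
/-- The vertices of the solution different from the variable `0` form a connected dominating
set. -/
def cdsAvoidFml : Fml :=
  conj [neg (ex (and (or (neg (st 1 1)) (eq 1 0))
      (neg (ex (conj [st 2 1, neg (eq 2 0), adj 1 2]))))),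
    ex (and (st 1 1) (neg (eq 1 0))),
    neg (ex (ex (conj [st 1 1, neg (eq 1 0), st 2 1, neg (eq 2 0), neg (connAvoid 0 1 2)])))]

open Fml in
/-- The solution is a minimal connected dominating set. -/
def minimalFml : Fml :=
  -- At depth 0, `conj` would mention a variable that is not in scope, hence the nested `and`.
  -- Testing the removal of single vertices suffices by `isMinimalCDS_iff`.
  and (neg (ex (undom 1 0))) (and (ex (st 0 1)) (and
    (neg (ex (ex (conj [st 0 1, st 1 1, neg (conn 0 1)]))))
    (neg (ex (and (st 0 1) cdsAvoidFml)))))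

theorem holds_cdsAvoidFml {V : Type u} [Fintype V] [DecidableEq V] {G : SimpleGraph V}
    {st : State V} {env : ℕ → V} : cdsAvoidFml.Holds G st 1 env ↔
      IsCDS G ((toInstance st).sol.erase (env 0)) := by
  rw [isCDS_iff]
  simp only [cdsAvoidFml, Fml.conj, Fml.Holds, Fml.holds_or, Finset.coe_erase, coe_sol,
    Finset.Nonempty, Finset.mem_erase, mem_sol]
  simp
  constructor
  · rintro ⟨⟨h1, h2⟩, ⟨w, hw⟩, h3⟩
    refine ⟨fun v => ?_, ⟨w, hw.symm⟩, fun u hu1 hu2 v hv1 hv2 => h3 u hu2 hu1 v hv2 hv1⟩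
    by_cases hv : v = env 0
    · obtain ⟨u, hu1, hu2, hu3⟩ := h2
      exact .inr ⟨u, ⟨hu2, hu1⟩, hv ▸ hu3⟩
    · by_cases hv1 : st v = 1
      · exact .inl ⟨hv, hv1⟩
      · obtain ⟨u, hu1, hu2, hu3⟩ := h1 v hv1
        exact .inr ⟨u, ⟨hu2, hu1⟩, hu3⟩
  · rintro ⟨h1, ⟨w, hw⟩, h3⟩
    refine ⟨⟨fun v hv => ?_, ?_⟩, ⟨w, hw.symm⟩,
      fun u hu1 hu2 v hv1 hv2 => h3 u hu2 hu1 v hv2 hv1⟩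
    · obtain ⟨u, ⟨hu1, hu2⟩, hu3⟩ := (h1 v).resolve_left fun h => hv h.2
      exact ⟨u, hu2, hu1, hu3⟩
    · obtain ⟨u, ⟨hu1, hu2⟩, hu3⟩ := (h1 (env 0)).resolve_left fun h => h.1 rfl
      exact ⟨u, hu2, hu1, hu3⟩

theorem holds_minimalFml {V : Type u} [Fintype V] [DecidableEq V] {G : SimpleGraph V}
    {st : State V} {env : ℕ → V} : minimalFml.Holds G st 0 env ↔
      IsMinimalCDS G (toInstance st).sol := by
  rw [isMinimalCDS_iff, isCDS_iff]
  simp only [minimalFml, Fml.conj, Fml.Holds, zero_add, Fml.holds_undom zero_lt_one,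
    holds_cdsAvoidFml, coe_sol, Finset.Nonempty, mem_sol, Undom, Dom, Function.update_self]
  simp
  refine ⟨?_, ?_⟩
  · rintro ⟨h1, h2, h3, h4⟩
    exact ⟨⟨fun v => or_iff_not_imp_left.2 (h1 v), h2, fun u hu v hv => h3 u hu v hv⟩, h4⟩
  · rintro ⟨⟨h1, h2, h3⟩, h4⟩
    exact ⟨fun v => or_iff_not_imp_left.1 (h1 v), h2, fun u hu v hv => h3 u hu v hv, h4⟩

/-- Output the solution. -/
def emitProg : Prog :=
  .seq (forLoop 4 (.write (.eq (.get 2 (.var 4)) (.num 1)))) (.write (.num 2))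

/-- Output the solution if it is a minimal connected dominating set and no rule was applied. -/
def leafProg : Prog :=
  .ite (.var 2) .skip (.seq (minimalFml.compile 0) (.ite (.var 3) emitProg .skip))

/-- Pop a state from the stack. -/
def popProg : Prog :=
  .seq (.assign 1 (.sub (.var 1) (.num 1)))
    (forLoop 4 (.put 2 (.var 4) (.get 1 (topIdx (.var 4)))))

/-- Process the state on the top of the stack. -/
def stepProg : Prog := .seq popProg (.seq connAll (.seq searchProg leafProg))

section Machine

variable {n s : ℕ} {G : SimpleGraph (Fin n)} {st : State (Fin n)} {σ τ : Store}
  {l : List (State (Fin n))}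

theorem emitProg_does (hs : 2 < s) (hns : n < s) (h0 : σ.vars 0 = n)
    (h2 : ∀ v : Fin n, σ.arr 2 v = st v) :
    Does s n emitProg σ fun τ => (∀ r < 3, τ.vars r = σ.vars r) ∧ τ.arr = σ.arr ∧
      τ.out = σ.out ++ encodeSet (toInstance st).sol := by
  let f : Fin n → ℕ := fun i => if i ∈ (toInstance st).sol then 1 else 0
  refine Does.seq (Does.forLoop (fun m τ => (∀ r < 3, τ.vars r = σ.vars r) ∧ τ.arr = σ.arr ∧
    τ.out = σ.out ++ (List.ofFn f).take m) (by omega) h0 hns ⟨fun r hr => ?_, rfl, by simp⟩ ?_ ?_)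
  · rw [Store.setVar_vars, if_neg (by omega)]
  · rintro m hm τ g0 g4 ⟨t1, t2, t3⟩
    have e : (Expr.eq (.get 2 (.var 4)) (.num 1)).eval τ = f ⟨m, hm⟩ := by
      have := h2 ⟨m, hm⟩
      simp only at this
      simp only [Expr.eval, g4, t2, this, f, mem_sol]
    refine Does.write ?_ ⟨g0, g4, fun r hr => ?_, t2, ?_⟩
    · rw [e]
      simp only [f]
      split_ifs <;> omega
    · rw [Store.setVar_vars, if_neg (by omega), Store.emit_vars, t1 r hr]
    · have hlen : m < (List.ofFn f).length := by simpa using hm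
      rw [e, Store.setVar_out, Store.emit_out, t3, ← List.take_concat_get' _ m hlen]
      simp
  · rintro τ - ⟨t1, t2, t3⟩
    refine Does.write (by simpa [Expr.eval] using hs) ⟨t1, t2, ?_⟩
    rw [Store.emit_out, t3, List.take_of_length_le (by simp)]
    simp [encodeSet, f, Expr.eval]

open Classical in
theorem leafProg_does (hs : (n + 10) ^ 3 ≤ s) (hg : HasGraph G σ) (hh : HasState G st σ)
    (v : Fin n) (h2 : σ.vars 2 = 0) :
    Does s n leafProg σ fun τ => (∀ r < 3, τ.vars r = σ.vars r) ∧ τ.arr = σ.arr ∧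
      τ.out = σ.out ++
        if IsMinimalCDS G (toInstance st).sol then encodeSet (toInstance st).sol else [] := by
  have hs' := lt_size hs
  refine Does.ite (fun h => absurd h2 h) fun _ => Does.seq
    ((minimalFml.compile_does (by omega) 0 (fun _ => v) σ (by decide) hg hh
      (fun i hi => by omega)).mono fun τ hτ => ?_)
  have h3 : (Expr.var 3).eval τ = if IsMinimalCDS G (toInstance st).sol then 1 else 0 := by
    have := hτ.2
    simp only [holds_minimalFml] at this
    exact this
  refine Does.ite (fun h => ?_) fun h =>
    Does.skip ⟨fun r hr => hτ.1.vars r (by omega), hτ.1.arr, ?_⟩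
  · have hM : IsMinimalCDS G (toInstance st).sol := by
      by_contra hM
      simp [h3, hM] at h
    refine (emitProg_does (by omega) (by omega) ((hτ.1.vars 0 (by omega)).trans hg.order)
      (hh.frame hτ.1).state).mono ?_
    rintro υ ⟨t1, t2, t3⟩
    refine ⟨fun r hr => (t1 r hr).trans (hτ.1.vars r (by omega)), t2.trans hτ.1.arr, ?_⟩
    rw [t3, if_pos hM, hτ.1.out]
  · have hM : ¬ IsMinimalCDS G (toInstance st).sol := by
      intro hM
      simp [h3, hM] at h
    rw [if_neg hM, hτ.1.out, List.append_nil]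

theorem popProg_does (hs : (n + 10) ^ 3 ≤ s) (hg : HasGraph G σ) (hl : l.length ≤ 5 * n)
    (hst : ∀ v, st v < 3) (hS : HasStack (l ++ [st]) σ) :
    Does s n popProg σ fun τ => HasGraph G τ ∧ HasStack l τ ∧ (∀ v : Fin n, τ.arr 2 v = st v) ∧
      τ.out = σ.out := by
  have hs' := lt_size hs
  have h1 : (Expr.sub (.var 1) (.num 1)).eval σ = l.length := by
    simp [Expr.eval, hS.size]
  have hls : 5 * n < s := by
    have : (n + 10) * 100 ≤ (n + 10) * ((n + 10) * (n + 10)) :=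
      Nat.mul_le_mul_left _ (Nat.mul_le_mul (by omega : 10 ≤ n + 10) (by omega : 10 ≤ n + 10))
    have : (n + 10) ^ 3 = (n + 10) * ((n + 10) * (n + 10)) := by ring
    omega
  refine Does.seq (Does.assign (by rw [h1]; omega) ?_)
  rw [h1]
  have hT : HasTop l st (σ.setVar 1 l.length) := by
    refine ⟨⟨by simp, fun k hk v => ?_⟩, fun v => ?_⟩
    · rw [Store.setVar_arr, hS.row k (by simp; omega) v, List.getElem_append_left hk]
    · rw [Store.setVar_arr, hS.row l.length (by simp) v]
      simp
  have hg1 : HasGraph G (σ.setVar 1 l.length) := ⟨by simp [hg.order], hg.adj⟩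
  refine Does.forLoop (fun m τ => Keep (· < 4) (· ≠ 2) (σ.setVar 1 l.length) τ ∧
    ∀ v : Fin n, (v : ℕ) < m → τ.arr 2 v = st v) (by omega) hg1.order (by omega)
    ⟨(Keep.refl _ _ _).setVar (by omega), fun v hv => by omega⟩ ?_ ?_
  · rintro m hm τ g0 g4 ⟨hK, hE⟩
    have e : (Expr.get 1 (topIdx (.var 4))).eval τ = st ⟨m, hm⟩ := by
      have := hT.2 ⟨m, hm⟩
      rw [← hK.arr 1 (by omega)] at this
      rw [← this]
      have hv1 := (hK.vars 1 (by omega)).trans hT.1.size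
      simp [Expr.eval, topIdx, matIdx, g0, g4, hv1]
    refine Does.put (by simp [Expr.eval, g4]; omega) (by rw [e]; have := hst ⟨m, hm⟩; omega) ?_
    rw [e, show (Expr.var 4).eval τ = m from g4]
    refine ⟨g0, g4, (hK.setArr (by simp)).setVar (by omega), fun v hv => ?_⟩
    rw [Store.setVar_arr, Store.setArr_arr]
    by_cases h : (v : ℕ) = m
    · rw [if_pos ⟨rfl, h⟩, show v = ⟨m, hm⟩ from Fin.ext h]
    · rw [if_neg (fun e => h e.2), hE v (by omega)]
  · rintro τ - ⟨hK, hE⟩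
    exact ⟨hg1.keep hK (by omega) (by omega), hT.1.congr (hK.vars 1 (by omega))
      (hK.arr 1 (by omega)), fun v => hE v v.2, hK.out⟩

open Classical in
/-- The state on the top of the stack is replaced by the cases of a rule, or, if it is completely
decided, it is removed and its solution is output if it is a minimal connected dominating set. -/
theorem stepProg_does (hs : (n + 10) ^ 3 ≤ s) (hG : IsDegenerate G 2) (hg : HasGraph G σ)
    (hl : l.length ≤ 5 * n) (hst : ∀ v, st v < 3) (hsol : ∃ v, st v = 1)
    (hS : HasStack (l ++ [st]) σ) :
    Does s n stepProg σ fun τ => HasGraph G τ ∧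
      ((∃ cs, GoodStep G 0.106 0.106 st cs ∧ HasStack (l ++ cs) τ ∧ τ.out = σ.out) ∨
        (∀ v, st v ≠ 0) ∧ HasStack l τ ∧ τ.out = σ.out ++
          if IsMinimalCDS G (toInstance st).sol then encodeSet (toInstance st).sol else []) := by
  refine Does.seq ((popProg_does hs hg hl hst hS).mono ?_)
  rintro τ ⟨hg1, hS1, hw1, ho1⟩
  refine Does.seq ((connAll_does hs hg1 hw1).mono ?_)
  rintro υ ⟨hK, hh⟩
  have hg2 := hg1.keep hK (by omega) (by omega)
  have hS2 := hS1.congr (hK.vars 1 (by omega)) (hK.arr 1 (by omega))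
  refine Does.seq ((searchProg_does hs hst hl hG hsol hg2 hh hS2).mono ?_)
  rintro φ ⟨hK', hT⟩
  have hg3 := hg2.keep hK' rfl (by omega)
  have ho3 : φ.out = σ.out := by rw [hK'.out, hK.out, ho1]
  rcases hT with ⟨t1, cs, t2, t3⟩ | ⟨t1, t2, t3⟩
  · exact Does.ite (fun _ => Does.skip ⟨hg3, .inl ⟨cs, t2, t3, ho3⟩⟩)
      fun h => by simp [Expr.eval, t1] at h
  · obtain ⟨v, -⟩ := hsol
    refine (leafProg_does hs hg3 (hh.keep hK' (by omega) (by omega)) v t1).mono ?_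
    rintro ψ ⟨u1, u2, u3⟩
    exact ⟨⟨(u1 0 (by omega)).trans hg3.order, by rw [u2]; exact hg3.adj⟩,
      .inr ⟨t3, t2.congr (u1 1 (by omega)) (by rw [u2]), by rw [u3, ho3]⟩⟩

end Machine

/-! ## The enumeration algorithm -/

/-- A completely decided state accepts only its solution. -/
theorem accept_iff_of_decided {V : Type u} [Fintype V] [DecidableEq V] {st : State V}
    {M : Finset V} (h : ∀ v, st v ≠ 0) : Accept st M ↔ M = (toInstance st).sol := by
  constructor
  · rintro ⟨h1, h2⟩
    ext v
    rw [mem_sol]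
    refine ⟨fun hv => ?_, h1 v⟩
    have := h2 v hv
    have := h v
    omega
  · rintro rfl
    exact ⟨fun v hv => mem_sol.2 hv, fun v hv => (mem_sol.1 hv).le⟩

theorem Ext.accept {V : Type u} {st c : State V} {M : Finset V} (h : Ext st c)
    (hc : Accept c M) : Accept st M := by
  refine ⟨fun v hv => hc.1 v ?_, fun v hv => ?_⟩
  · have := h.1 v
    omega
  · have := h.1 v
    have := hc.2 v hv
    omega

/-! ### A potential that bounds the number of rounds -/

section Weight

variable {V : Type u} [Fintype V] [DecidableEq V] {G : SimpleGraph V} {st : State V}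

/-- A bound for the number of states that are generated from `st`. -/
noncomputable def weight (G : SimpleGraph V) (st : State V) : ℝ :=
  3 * rate ^ mu G 0.106 0.106 st - 1

theorem one_le_rate_rpow_mu : 1 ≤ rate ^ mu G 0.106 0.106 st :=
  Real.one_le_rpow one_lt_rate.le (mu_nonneg (by norm_num) (by norm_num))

theorem one_le_weight : 1 ≤ weight G st := by
  have := one_le_rate_rpow_mu (G := G) (st := st)
  unfold weight
  linarith

theorem sum_map_weight (cs : List (State V)) : (cs.map (weight G)).sum =
    3 * (cs.map fun c => rate ^ mu G 0.106 0.106 c).sum - cs.length := by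
  induction cs with
  | nil => simp
  | cons c cs ih =>
    simp only [List.map_cons, List.sum_cons, ih, weight, List.length_cons, Nat.cast_add,
      Nat.cast_one]
    ring

theorem two_le_length_of_mem_branchingVectors {α δ : ℝ} {r : List ℝ}
    (hr : r ∈ branchingVectors α δ) : 2 ≤ r.length := by
  simp only [branchingVectors, List.mem_cons, List.not_mem_nil, or_false] at hr
  rcases hr with rfl | rfl | rfl | rfl | rfl | rfl | rfl | rfl | rfl | rfl <;> simp

theorem rate_rpow_neg_four_fifths_le : rate ^ (-(4 / 5) : ℝ) ≤ 2 / 3 := by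
  have h : (3 / 2 : ℝ) ≤ rate ^ (4 / 5 : ℝ) := by
    rw [show rate ^ (4 / 5 : ℝ) = (rate ^ 4) ^ (5 : ℝ)⁻¹ by
      rw [← Real.rpow_natCast rate, ← Real.rpow_mul rate_pos.le]; norm_num,
      Real.le_rpow_inv_iff_of_pos (by norm_num) (by positivity [rate_pos]) (by norm_num)]
    norm_num [rate]
  rw [Real.rpow_neg rate_pos.le]
  exact (inv_anti₀ (by norm_num) h).trans (by norm_num)

/-- With at least two cases, the terms `rate ^ μ` do not grow in total, while the summand `-1`
occurs at least once more. A single case has no such surplus, but the gain `4 / 5` makes its power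
at most two thirds, which saves `rate ^ μ ≥ 1`. -/
theorem GoodStep.sum_weight_le {cs : List (State V)} (h : GoodStep G 0.106 0.106 st cs) :
    (cs.map (weight G)).sum + 1 ≤ weight G st := by
  have h1 := one_le_rate_rpow_mu (G := G) (st := st)
  rcases h.drop with rfl | ⟨c, rfl, hc⟩ | ⟨r, hr, hf⟩
  · simpa using one_le_weight
  · have h2 : rate ^ mu G 0.106 0.106 c ≤ rate ^ mu G 0.106 0.106 st * (2 / 3) := by
      refine (Real.rpow_le_rpow_of_exponent_le one_lt_rate.le hc).trans ?_
      rw [sub_eq_add_neg, Real.rpow_add rate_pos]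
      exact mul_le_mul_of_nonneg_left rate_rpow_neg_four_fifths_le (by linarith)
    simp only [weight, List.map_cons, List.map_nil, List.sum_cons, List.sum_nil]
    linarith
  · have h2 := sum_rate_rpow_le hf
    have h3 := sum_rate_le_one hr
    have h4 : (2 : ℝ) ≤ cs.length := by
      rw [hf.length_eq]
      exact_mod_cast two_le_length_of_mem_branchingVectors hr
    have h5 := mul_le_of_le_one_right (by linarith : 0 ≤ rate ^ mu G 0.106 0.106 st) h3
    rw [sum_map_weight, weight]
    linarith

end Weight

/-! ### Correctness and running time of the enumeration -/

section Invariant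

variable {n s : ℕ} {G : SimpleGraph (Fin n)} {st : State (Fin n)} {σ τ : Store}
  {l : List (State (Fin n))} {L : List (Finset (Fin n))}

open Classical in
/-- The invariant of the enumeration: `l` is the stack, and `L` are the sets found so far. -/
structure Pending (G : SimpleGraph (Fin n)) (l : List (State (Fin n)))
    (L : List (Finset (Fin n))) : Prop where
  -- Replacing the top by at most five cases raises positions by at most 4, and each case has at
  -- least one undecided vertex fewer.
  height : ∀ k (h : k < l.length), k + 4 * (toInstance l[k]).free.card ≤ 5 * n
  valid : ∀ st ∈ l, (∀ v, st v < 3) ∧ ∃ v, st v = 1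
  found : ∀ M ∈ L, IsMinimalCDS G M
  count : ∀ M, IsMinimalCDS G M → L.count M + l.countP (fun st => Accept st M) = 1

theorem Pending.top (h : Pending G (l ++ [st]) L) :
    l.length + 4 * (toInstance st).free.card ≤ 5 * n := by
  simpa using h.height l.length (by simp)

theorem Pending.step {cs : List (State (Fin n))} (h : Pending G (l ++ [st]) L)
    (hc : GoodStep G 0.106 0.106 st cs) : Pending G (l ++ cs) L := by
  classical
  refine ⟨fun k hk => ?_, fun c hcl => ?_, h.found, fun M hM => ?_⟩
  · by_cases hkl : k < l.length
    · have := h.height k (by simp; omega)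
      rw [List.getElem_append_left hkl] at this ⊢
      exact this
    · rw [List.getElem_append_right (by omega)]
      rw [List.length_append] at hk
      have h1 := (hc.ext _ (List.getElem_mem (l := cs) (n := k - l.length) (by omega))).card_free_lt
      have h2 := h.top
      have h3 := hc.length
      omega
  · rcases List.mem_append.1 hcl with hcl | hcc
    · exact h.valid c (by simp [hcl])
    · obtain ⟨h1, h2⟩ := h.valid st (by simp)
      refine ⟨fun v => ?_, (hc.ext c hcc).exists_sol h2⟩
      have := (hc.ext c hcc).1 v
      have := h1 v
      omega
  -- Only the contribution of the top changes: if it accepts `M`, exactly one case does; if not, no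
  -- case does, since decisions are kept.
  · rw [← h.count M hM, List.countP_append, List.countP_append, List.countP_singleton]
    congr 2
    by_cases hA : Accept st M
    · simpa [hA] using hc.count M hM hA
    · simpa [hA, List.countP_eq_zero] using fun c hcc hcM => hA ((hc.ext c hcc).accept hcM)

open Classical in
theorem Pending.leaf (h : Pending G (l ++ [st]) L) (hst : ∀ v, st v ≠ 0) :
    Pending G l
      (L ++ if IsMinimalCDS G (toInstance st).sol then [(toInstance st).sol] else []) := by
  refine ⟨fun k hk => ?_, fun c hc => h.valid c (by simp [hc]), fun M hM => ?_, fun M hM => ?_⟩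
  · have := h.height k (by simp; omega)
    rwa [List.getElem_append_left hk] at this
  · rcases List.mem_append.1 hM with hM | hM
    · exact h.found M hM
    · split_ifs at hM with hmin
      · rwa [List.mem_singleton.1 hM]
      · simp at hM
  · rw [← h.count M hM, List.count_append, List.countP_append, List.countP_singleton]
    simp only [accept_iff_of_decided hst]
    by_cases hMs : M = (toInstance st).sol
    · subst hMs
      simp [hM]
      omega
    · have : (if IsMinimalCDS G (toInstance st).sol then [(toInstance st).sol] else []).count M
          = 0 := by
        split_ifs <;> simp [Ne.symm hMs]
      simp [this, hMs]

/-- When the stack is empty, every minimal connected dominating set has been found once. -/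
theorem Pending.finish (h : Pending G [] L) : L.Nodup ∧ ∀ M, M ∈ L ↔ IsMinimalCDS G M := by
  classical
  have hc : ∀ M, IsMinimalCDS G M → L.count M = 1 := fun M hM => by simpa using h.count M hM
  refine ⟨List.nodup_iff_count_le_one.2 fun M => ?_, fun M => ⟨h.found M, fun hM => ?_⟩⟩
  · by_cases hM : M ∈ L
    · have := hc M (h.found M hM)
      convert this.le
    · rw [List.count_eq_zero_of_not_mem hM]
      exact zero_le_one
  · exact List.count_pos_iff.1 (by rw [hc M hM]; exact one_pos)

/-- Process the states on the stack until it is empty. -/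
def drainProg : Prog := .loop (.var 1) stepProg

/-- `N` bounds the total weight of the stack and thereby the number of rounds: every round lowers
the total weight by at least 1, and a stack of weight less than 1 is empty. -/
theorem drainProg_exec (hs : (n + 10) ^ 3 ≤ s) (hG : IsDegenerate G 2) (N : ℕ) :
    ∀ (l : List (State (Fin n))) (L : List (Finset (Fin n))) (σ : Store),
      (l.map (weight G)).sum ≤ N → Pending G l L → HasGraph G σ → HasStack l σ →
      σ.out = L.flatMap encodeSet →
      ∃ τ t L', Exec s drainProg σ τ t ∧ t ≤ N * (timeBound n stepProg + 2) + 2 ∧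
        Pending G [] L' ∧ τ.out = L'.flatMap encodeSet := by
  classical
  induction N with
  | zero =>
    intro l L σ hN hP hg hS ho
    rcases List.eq_nil_or_concat' l with rfl | ⟨l, st, rfl⟩
    · exact ⟨σ, _, L, .loop_done (by simp [Expr.eval, hS.size]), by simp [Expr.cost], hP, ho⟩
    · have h1 := one_le_weight (G := G) (st := st)
      have h2 : 0 ≤ (l.map (weight G)).sum := List.sum_nonneg fun x hx => by
        obtain ⟨c, -, rfl⟩ := List.mem_map.1 hx
        linarith [one_le_weight (G := G) (st := c)]
      simp only [List.map_append, List.sum_append, List.map_cons, List.map_nil, List.sum_cons,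
        List.sum_nil, Nat.cast_zero] at hN
      linarith
  | succ N ih =>
    intro l L σ hN hP hg hS ho
    rcases List.eq_nil_or_concat' l with rfl | ⟨l, st, rfl⟩
    · exact ⟨σ, _, L, .loop_done (by simp [Expr.eval, hS.size]), by simp [Expr.cost], hP, ho⟩
    · simp only [List.map_append, List.sum_append, List.map_cons, List.map_nil, List.sum_cons,
        List.sum_nil, Nat.cast_succ] at hN
      obtain ⟨v1, v2⟩ := hP.valid st (by simp)
      obtain ⟨τ, t, e1, b1, hg', hT⟩ :=
        stepProg_does hs hG hg (by have := hP.top; omega) v1 v2 hS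
      have next : ∃ (l' : List (State (Fin n))) (L' : List (Finset (Fin n))),
          (l'.map (weight G)).sum ≤ (N : ℝ) ∧ Pending G l' L' ∧ HasStack l' τ ∧
          τ.out = L'.flatMap encodeSet := by
        rcases hT with ⟨cs, h1, h2, h3⟩ | ⟨h1, h2, h3⟩
        · refine ⟨l ++ cs, L, ?_, hP.step h1, h2, h3.trans ho⟩
          have := h1.sum_weight_le
          rw [List.map_append, List.sum_append]
          linarith
        · refine ⟨l, _, ?_, hP.leaf h1, h2, ?_⟩
          · linarith [one_le_weight (G := G) (st := st)]
          · rw [h3, ho, List.flatMap_append]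
            split_ifs <;> simp
      obtain ⟨l', L', n1, n2, n3, n4⟩ := next
      obtain ⟨υ, t', L'', e2, b2, r⟩ := ih l' L' τ n1 n2 hg' n3 n4
      refine ⟨υ, _, L'', .loop_step (by simp [Expr.eval, hS.size]) e1 e2, ?_, r⟩
      simp only [Expr.cost]
      nlinarith

/-! ## The initial states -/

/-- The state that fixes `v` as the smallest vertex of the solution. -/
def startState (v : Fin n) : State (Fin n) := fun u => if u < v then 2 else if u = v then 1 else 0

theorem accept_startState {v : Fin n} {M : Finset (Fin n)} :
    Accept (startState v) M ↔ IsLeast (M : Set (Fin n)) v := by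
  simp only [Accept, startState]
  constructor
  · rintro ⟨h1, h2⟩
    refine ⟨h1 v (by simp), fun u hu => ?_⟩
    by_contra h
    have := h2 u hu
    rw [if_pos (not_le.1 h)] at this
    omega
  · rintro ⟨h1, h2⟩
    refine ⟨fun u hu => ?_, fun u hu => ?_⟩
    · obtain rfl : u = v := by
        by_contra h
        rw [if_neg h] at hu
        split_ifs at hu
        omega
      exact h1
    · rw [if_neg (not_lt.2 (h2 hu))]
      split_ifs <;> omega

/-- A minimal set is accepted by exactly one start state, that of its least vertex. The height
condition holds as `k < n` and at most `n` vertices are undecided. -/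
theorem pending_start : Pending G (List.ofFn startState) [] := by
  classical
  refine ⟨fun k hk => ?_, fun st hst => ?_, by simp, fun M hM => ?_⟩
  · rw [List.length_ofFn] at hk
    have := Finset.card_le_univ (toInstance (startState ⟨k, hk⟩)).free
    rw [Fintype.card_fin] at this
    simp only [List.getElem_ofFn]
    omega
  · obtain ⟨v, rfl⟩ := (List.mem_ofFn' _ _).1 hst
    refine ⟨fun u => ?_, v, by simp [startState]⟩
    unfold startState
    split_ifs <;> omega
  · obtain ⟨v, hv⟩ : ∃ v, IsLeast (M : Set (Fin n)) v :=
      ⟨M.min' (isCDS_iff.1 hM.prop).2.1, M.isLeast_min' _⟩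
    have : ∀ u, Accept (startState u) M ↔ u = v := fun u =>
      accept_startState.trans ⟨fun h => h.unique hv, fun h => h ▸ hv⟩
    rw [List.ofFn_eq_map, List.countP_map]
    simp only [Function.comp_def, this]
    have hcount := List.count_eq_one_of_mem (List.nodup_finRange n) (List.mem_finRange v)
    rw [List.count_nil, zero_add, ← hcount, List.count]
    congr

/-- The initial measure is at most `n + 0.106`, hence below `n + 1`, and `rate < 2`; the factor 6 is
`3 * 2`. -/
theorem weight_startState_le (v : Fin n) : weight G (startState v) ≤ 6 * rate ^ n := by
  have hsol : (toInstance (startState v)).sol = {v} := by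
    ext u
    simp only [mem_sol, startState, Finset.mem_singleton]
    split_ifs with h1 h2
    · simp [h1.ne]
    · simp [h2]
    · simp [h2]
  have hm := mu_le_card_add (G := G) (st := startState v) (α := 0.106) (δ := 0.106)
    (by norm_num) (by norm_num)
  rw [hsol, Fintype.card_fin, Finset.card_singleton] at hm
  have h1 : rate ^ mu G 0.106 0.106 (startState v) ≤ rate ^ (n + 1) := by
    rw [← Real.rpow_natCast]
    refine Real.rpow_le_rpow_of_exponent_le one_lt_rate.le (hm.trans ?_)
    push_cast
    norm_num
  have h2 : rate ^ (n + 1) ≤ rate ^ n * 2 := by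
    rw [pow_succ]
    exact mul_le_mul_of_nonneg_left (by norm_num [rate]) (pow_nonneg rate_pos.le n)
  unfold weight
  linarith

theorem sum_weight_start_le :
    ((List.ofFn (startState (n := n))).map (weight G)).sum ≤ n * (6 * rate ^ n) := by
  refine (List.sum_le_card_nsmul _ (6 * rate ^ n) ?_).trans ?_
  · intro x hx
    obtain ⟨st, hst, rfl⟩ := List.mem_map.1 hx
    obtain ⟨v, rfl⟩ := (List.mem_ofFn' _ _).1 hst
    exact weight_startState_le v
  · simp

/-- Push the initial states. -/
def startProg : Prog :=
  .seq (forLoop 4 (forLoop 5 (.put 1 (matIdx (.var 4) (.var 5))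
    (.add (.mul (.lt (.var 5) (.var 4)) (.num 2)) (.eq (.var 5) (.var 4))))))
    (.assign 1 (.var 0))

theorem startProg_does (hs : (n + 10) ^ 3 ≤ s) (hg : HasGraph G σ) :
    Does s n startProg σ fun τ => HasGraph G τ ∧ HasStack (List.ofFn (startState (n := n))) τ ∧
      τ.out = σ.out := by
  have hs' := lt_size hs
  refine Does.seq (Does.forLoop₂ (fun i j τ => Keep (· < 4) (· ≠ 1) σ τ ∧ ∀ v u : Fin n,
    ((v : ℕ) < i ∨ (v : ℕ) = i ∧ (u : ℕ) < j) → τ.arr 1 (v * n + u) = startState v u)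
    (by omega) (by omega) (by omega) hg.order (by omega) ?_ ?_ ?_ ?_ ?_ ?_)
  · exact fun i j τ v h => ⟨h.1.setVar (by omega), h.2⟩
  · exact fun i j τ v h => ⟨h.1.setVar (by omega), h.2⟩
  · exact ⟨.refl _ _ σ, fun u v h => by omega⟩
  · refine fun i τ h => ⟨h.1, fun u v huv => h.2 u v ?_⟩
    have := v.2
    omega
  · rintro i hi j hj τ h0 h4 h5 ⟨hK, hE⟩
    have e1 : (matIdx (.var 4) (.var 5)).eval τ = i * n + (⟨j, hj⟩ : Fin n) := by
      simp [matIdx, Expr.eval, h0, h4, h5]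
    have e2 : (Expr.add (.mul (.lt (.var 5) (.var 4)) (.num 2)) (.eq (.var 5) (.var 4))).eval τ =
        startState ⟨i, hi⟩ ⟨j, hj⟩ := by
      simp only [Expr.eval, h4, h5, startState, Fin.mk_lt_mk, Fin.mk.injEq]
      split_ifs <;> omega
    refine Does.put ?_ ?_ ?_
    · rw [e1]
      exact top_lt hs (by omega) _
    · rw [e2, startState]
      split_ifs <;> omega
    · rw [e1, e2]
      refine ⟨h0, h4, h5, hK.setArr (by simp), fun v u hvu => ?_⟩
      rw [Store.setArr_arr]
      by_cases c : (v : ℕ) = i ∧ (u : ℕ) = j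
      · rw [if_pos ⟨rfl, by rw [c.1, c.2]⟩, show v = ⟨i, hi⟩ from Fin.ext c.1,
          show u = ⟨j, hj⟩ from Fin.ext c.2]
      · rw [if_neg fun h => c (row_index_inj u.2 hj h.2)]
        exact hE v u (by omega)
  · rintro τ h0 ⟨hK, hE⟩
    refine Does.assign (by simp [Expr.eval, h0]; omega) ?_
    rw [show (Expr.var 0).eval τ = n from h0]
    refine ⟨⟨by simp [h0], (hg.keep hK (by omega) (by omega)).adj⟩, ⟨by simp, fun k hk v => ?_⟩,
      hK.out⟩
    rw [List.length_ofFn] at hk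
    rw [Store.setVar_arr, List.getElem_ofFn]
    exact hE ⟨k, hk⟩ v (.inl hk)

theorem hasGraph_inputStore (G : SimpleGraph (Fin n)) : HasGraph G (inputStore G) := by
  classical
  refine ⟨rfl, fun i j => ?_⟩
  refine if_congr ⟨?_, fun h => ⟨rfl, i, j, rfl, h⟩⟩ rfl rfl
  rintro ⟨-, i', j', he, h⟩
  obtain ⟨h1, h2⟩ := row_index_inj j.2 j'.2 he
  rwa [Fin.ext h1, Fin.ext h2]

/-- The enumeration algorithm. -/
def enumProg : Prog := .seq startProg drainProg

theorem enumProg_enumerates (hs : (n + 10) ^ 3 ≤ s) (hG : IsDegenerate G 2) {T : ℝ}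
    (hT : ∀ N : ℕ, (N : ℝ) < n * (6 * rate ^ n) + 1 →
      ((timeBound n startProg + (N * (timeBound n stepProg + 2) + 2) : ℕ) : ℝ) ≤ T) :
    EnumeratesWithin enumProg G s T := by
  obtain ⟨σ, t, e1, b1, hg, hS, ho⟩ := startProg_does hs (hasGraph_inputStore G)
  have h0 : (0 : ℝ) ≤ n * (6 * rate ^ n) := by positivity [rate_pos]
  -- The number of rounds is the total initial weight bound, rounded up; this is why `hT` allows an
  -- additional 1.
  obtain ⟨τ, t', L, e2, b2, hP, ho'⟩ := drainProg_exec hs hG ⌈(n : ℝ) * (6 * rate ^ n)⌉₊ _ [] σ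
    (sum_weight_start_le.trans (Nat.le_ceil _)) pending_start hg hS ho
  refine ⟨τ, t + t', L, .seq e1 e2, le_trans ?_ (hT _ (Nat.ceil_lt_add_one h0)),
    hP.finish.1, hP.finish.2, ho'⟩
  exact Nat.cast_le.2 (Nat.add_le_add b1 b2)

end Invariant

theorem exists_enumeratesWithin : ∃ (P : Prog) (C : ℝ) (p : Polynomial ℕ),
    ∀ (n : ℕ) (G : SimpleGraph (Fin n)), IsDegenerate G 2 →
      EnumeratesWithin P G (p.eval n) (C * (1.9767 : ℝ) ^ n) := by
  obtain ⟨a, ha⟩ := exists_timeBound_le startProg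
  obtain ⟨b, hb⟩ := exists_timeBound_le stepProg
  obtain ⟨A, hA⟩ := exists_pow_mul_rate_le a
  obtain ⟨B, hB⟩ := exists_pow_mul_rate_le (b + 1)
  obtain ⟨D, hD⟩ := exists_pow_mul_rate_le 1
  -- `A` pays for the initialization. At most `7 * (n + 2) * rate ^ n` rounds of cost `timeBound n
  -- stepProg + 2` give `7 * B + 14 * D`, and the final 2 steps give `2 * D`.
  refine ⟨enumProg, A + 7 * B + 16 * D, (.X + 10) ^ 3, fun n G hG =>
    enumProg_enumerates (by simp) hG fun N hN => ?_⟩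
  have ha' : (timeBound n startProg : ℝ) ≤ ((n : ℝ) + 2) ^ a := by exact_mod_cast ha n
  have hb' : (timeBound n stepProg : ℝ) ≤ ((n : ℝ) + 2) ^ b := by exact_mod_cast hb n
  have hr : (1 : ℝ) ≤ rate ^ n := one_le_pow₀ one_lt_rate.le
  have hn : (0 : ℝ) ≤ n := Nat.cast_nonneg n
  have hN' : (N : ℝ) ≤ 7 * ((n + 2) * rate ^ n) := by nlinarith
  have h1 : (n + 2 : ℝ) ^ a ≤ (n + 2) ^ a * rate ^ n := le_mul_of_one_le_right (by positivity) hr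
  have h2 : (N : ℝ) * (timeBound n stepProg + 2) ≤
      7 * ((n + 2) * rate ^ n) * ((n + 2) ^ b + 2) :=
    mul_le_mul hN' (by linarith) (by positivity) (by positivity [rate_pos])
  have h3 : 7 * ((n + 2) * rate ^ n) * ((n + 2 : ℝ) ^ b + 2) =
      7 * ((n + 2) ^ (b + 1) * rate ^ n) + 14 * ((n + 2) ^ 1 * rate ^ n) := by ring
  have h4 : (2 : ℝ) ≤ 2 * ((n + 2) ^ 1 * rate ^ n) := by nlinarith
  push_cast
  linarith [hA n, hB n, hD n]

end CDSEnum

theorem mainTheorem2 :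
    -- enumeration in time `O(1.9767 ^ n)` and polynomial space
    (∃ (P : CDSEnum.Prog) (C : ℝ) (p : Polynomial ℕ),
      ∀ (n : ℕ) (G : SimpleGraph (Fin n)), CDSEnum.IsDegenerate G 2 →
        CDSEnum.EnumeratesWithin P G (p.eval n) (C * (1.9767 : ℝ) ^ n)) ∧
    -- the branching number is attained with the measure given by `α = δ = 0.106`
    ((∀ r ∈ CDSEnum.branchingVectors 0.106 0.106,
        ∃ x : ℝ, CDSEnum.IsBranchingNumber r x ∧ x < 1.9767) ∧
      ∀ (V : Type u) [Fintype V] [DecidableEq V] (G : SimpleGraph V), CDSEnum.IsDegenerate G 2 →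
        ∀ (I : CDSEnum.BranchInstance V) (v : V), I.sol = {v} →
          CDSEnum.HasSearchTree G 0.106 0.106 I) ∧
    -- the number of minimal connected dominating sets
    (∃ C : ℝ, ∀ (V : Type u) [Fintype V] (G : SimpleGraph V), CDSEnum.IsDegenerate G 2 →
      ({S : Finset V | CDSEnum.IsMinimalCDS G S}.ncard : ℝ) ≤
        C * (1.9767 : ℝ) ^ Fintype.card V) :=
  ⟨CDSEnum.exists_enumeratesWithin,
    ⟨fun _ hr => CDSEnum.exists_branchingNumber hr, fun _ _ _ _ hG I v hI =>
      CDSEnum.hasSearchTree (by norm_num) (by norm_num) (by norm_num) (by norm_num) hG I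
        (hI ▸ Finset.singleton_nonempty v)⟩,
    CDSEnum.exists_ncard_le⟩
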